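/- All objects are smooth ($C^\infty$). Let $M^n$, $n\ge 1$, be a Riemannian manifold and let $f:M^n\to\mathbb R^{n+p}$ be an isometric immersion with second fundamental form $\alpha$ and normal connection $\nabla^\perp$. Let $D=D^{n-1}\subset TM$ be a smooth totally geodesic distribution of rank $n-1$, and suppose that $f$ is $D$-ruled, i.e. $f$ maps each leaf of $D$ to an open subset of an $(n-1)$-dimensional affine subspace of $\mathbb R^{n+p}$. For an open set $U\subset M$, a normal subbundle $L\subset T^\perp_fM|_U$ of rank $\ell$ and a map $f':U\to\mathbb R^{n+\ell}$, say that $f'$ is a *ruled $L$-reduction* of $f$ on $U$ if $f'$ is a $D$-ruled isometric immersion and there is a vector bundle isometry $\sigma:L\to T^\perp_{f'}U$ with $\sigma\big((\nabla^\perp_X\xi)_L\big)=\nabla'^{\perp}_X\sigma\xi$ for all sections $\xi$ of $L$ and all $X\in TU$ (that is, $\sigma$ is parallel), such that the second fundamental form of $f'$ is $\alpha'=\sigma\circ\alpha_L$, where the subscript $L$ denotes the orthogonal projection onto $L$ and $\nabla'^\perp$ is the normal connection of $f'$. Say that $f$ is a *composition of $f'$ on $U$* if there are an open set $W\subset\mathbb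 R^{n+\ell}$ with $f'(U)\subset W$ and an isometric immersion $h:W\to\mathbb R^{n+p}$ such that $f=h\circ f'$ on $U$. Let $$L_D(x):=\operatorname{span}\alpha(T_xM,D(x))\subset T^\perp_{f}M(x).$$ (i) Let $V\subset M$ be open, let $L\subset T^\perp_fM|_V$ be a normal subbundle of rank $\ell$ that is parallel along $D$ (that is, $\nabla^\perp_X\xi\in L$ for all $X\in D$ and all sections $\xi$ of $L$) and satisfies $L_D\subset L$, and let $f':V\to\mathbb R^{n+\ell}$ be a ruled $L$-reduction of $f$ on $V$. If $x\in V$ and $\operatorname{Im}\alpha(x)\not\subset L(x)$, then $f$ is a composition of $f'$ on some open neighborhood $U\subset V$ of $x$. (ii) There is an open dense subset $O\subset M$ such that on each connected component $U$ of $O$ the following hold. The dimension of $L_D$ is constant on $U$, say equal to $\ell_D$, and $\ell_D$ is the rank of the curvature operator $\Lambda^2T_yM\to\mathfrak{so}(T_yM)$, $X\wedge Y\mapsto R(X,Y)$, at every $y\in U$. There is a ruled $L_D$-reduction $f_D:U\to\mathbb R^{n+\ell_D}$ of $f$ on $U$; in particular $f_D$ is an $(n-1)$-ruled isometric immersion.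 For every such $f_D$, the immersion $f$ is a composition of $f_D$ on $U$: $f=h\circ f_D$ with $h$ an isometric immersion of an open subset of $\mathbb R^{n+\ell_D}$ that contains $f_D(U)$ into $\mathbb R^{n+p}$. -/

import Mathlib

set_option maxSynthPendingDepth 3

open scoped Manifold ContDiff

noncomputable section

namespace RuledComposition

/-- The Euclidean space of dimension `k`. -/
abbrev Euc (k : ℕ) : Type := EuclideanSpace ℝ (Fin k)

/-! ### Levi-Civita connection and curvature of a metric written in coordinates -/

section Coordinates

variable {E : Type*} [NormedAddCommGroup E] [NormedSpace ℝ E]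

/-- Christoffel symbols of the first kind of a metric `G` on the vector space `E`:
`2 Γ(u, v; w) = ∂_u G(v, w) + ∂_v G(u, w) - ∂_w G(u, v)`. -/
def christoffelFirst (G : E → E →L[ℝ] E →L[ℝ] ℝ) (y : E) : E →L[ℝ] E →L[ℝ] E →L[ℝ] ℝ :=
  let A : E →L[ℝ] E →L[ℝ] E →L[ℝ] ℝ := fderiv ℝ G y
  (1 / 2 : ℝ) • (A + A.flip -
    (ContinuousLinearMap.flipₗᵢ ℝ E E ℝ).toContinuousLinearEquiv.toContinuousLinearMap.comp A.flip)

theorem christoffelFirst_apply (G : E → E →L[ℝ] E →L[ℝ] ℝ) (y u v w : E) :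
    christoffelFirst G y u v w =
      (1 / 2) * (fderiv ℝ G y u v w + fderiv ℝ G y v u w - fderiv ℝ G y w u v) := by
  simp [christoffelFirst]

/-- Christoffel symbols of the second kind: `G(Γ(u, v), w) = Γ(u, v; w)`. -/
def christoffel (G : E → E →L[ℝ] E →L[ℝ] ℝ) (y : E) : E →L[ℝ] E →L[ℝ] E :=
  (ContinuousLinearMap.compL ℝ E (E →L[ℝ] ℝ) E (G y).inverse).comp (christoffelFirst G y)

/-- The curvature tensor `R(u, v) = ∇_u ∇_v - ∇_v ∇_u - ∇_[u, v]` in coordinates. -/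
def curvatureTensor (G : E → E →L[ℝ] E →L[ℝ] ℝ) (y u v : E) : E →L[ℝ] E :=
  fderiv ℝ (christoffel G) y u v - fderiv ℝ (christoffel G) y v u +
    (christoffel G y u).comp (christoffel G y v) - (christoffel G y v).comp (christoffel G y u)

/-- The curvature tensor as an alternating map in its first two arguments. -/
def curvatureAlternating (G : E → E →L[ℝ] E →L[ℝ] ℝ) (y : E) :
    E [⋀^Fin 2]→ₗ[ℝ] (E →L[ℝ] E) where
  toFun m := curvatureTensor G y (m 0) (m 1)
  map_update_add' := by
    intro _ m i a b
    fin_cases i <;> ext w <;> simp [curvatureTensor] <;> abel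
  map_update_smul' := by
    intro _ m i c a
    fin_cases i <;> ext w <;> simp [curvatureTensor, smul_sub, smul_add]
  map_eq_zero_of_eq' := by
    intro m i j h hij
    fin_cases i <;> fin_cases j <;> simp_all [curvatureTensor]

/-- The curvature operator on bivectors, `X ∧ Y ↦ R(X, Y)`, with values in the (skew-symmetric)
endomorphisms. -/
def curvatureOperatorCoord (G : E → E →L[ℝ] E →L[ℝ] ℝ) (y : E) :
    ⋀[ℝ]^2 E →ₗ[ℝ] (E →L[ℝ] E) :=
  exteriorPower.alternatingMapLinearEquiv (curvatureAlternating G y)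

end Coordinates

/-! ### Riemannian geometry of a smooth manifold -/

section Manifold

variable {n : ℕ} {M : Type*} [TopologicalSpace M] [ChartedSpace (Euc n) M]
  [IsManifold (𝓡 n) ∞ M]

variable (n M) in
/-- Smooth Riemannian metrics on `M`. -/
abbrev SmoothMetric : Type _ :=
  Bundle.ContMDiffRiemannianMetric (𝓡 n) ∞ (Euc n) (fun x : M ↦ TangentSpace (𝓡 n) x)

/-- The metric `g` written in the preferred chart at `x`. -/
def metricInChart (g : SmoothMetric n M) (x : M) (y : Euc n) : Euc n →L[ℝ] Euc n →L[ℝ] ℝ :=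
  let z : M := (extChartAt (𝓡 n) x).symm y
  let A : Euc n →L[ℝ] Euc n := mfderiv 𝓘(ℝ, Euc n) (𝓡 n) (extChartAt (𝓡 n) x).symm y
  let B : Euc n →L[ℝ] Euc n →L[ℝ] ℝ := g.inner z
  B.bilinearComp A A

/-- The vector field `Y` written in the preferred chart at `x`. -/
def fieldInChart (Y : ∀ z : M, TangentSpace (𝓡 n) z) (x : M) (y : Euc n) : Euc n :=
  mfderiv (𝓡 n) 𝓘(ℝ, Euc n) (extChartAt (𝓡 n) x) ((extChartAt (𝓡 n) x).symm y)
    (Y ((extChartAt (𝓡 n) x).symm y))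

/-- The Levi-Civita connection: `leviCivita g Y x X = ∇_X Y` at `x`, computed in the preferred chart
at `x` (in which the coordinates of a tangent vector at `x` are the vector itself). -/
def leviCivita (g : SmoothMetric n M) (Y : ∀ z : M, TangentSpace (𝓡 n) z) (x : M)
    (X : TangentSpace (𝓡 n) x) : TangentSpace (𝓡 n) x :=
  let y : Euc n := extChartAt (𝓡 n) x x
  (fderiv ℝ (fieldInChart Y x) y X + christoffel (metricInChart g x) y X (Y x) : Euc n)

/-- The curvature operator of `g` at `x`, on bivectors of `T_x M`. -/
def curvatureOperator (g : SmoothMetric n M) (x : M) : ⋀[ℝ]^2 (Euc n) →ₗ[ℝ] (Euc n →L[ℝ] Euc n) :=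
  curvatureOperatorCoord (metricInChart g x) (extChartAt (𝓡 n) x x)

/-- The rank of the curvature operator of `g` at `x`. -/
def curvatureRank (g : SmoothMetric n M) (x : M) : ℕ :=
  Module.finrank ℝ (LinearMap.range (curvatureOperator g x))

variable (n M) in
/-- Fields of tangent subspaces. -/
abbrev TangentSubspaces : Type _ := ∀ x : M, Submodule ℝ (TangentSpace (𝓡 n) x)

/-- `Y` is a smooth vector field on `V`. -/
def IsSmoothFieldOn (Y : ∀ z : M, TangentSpace (𝓡 n) z) (V : Set M) : Prop :=
  ContMDiffOn (𝓡 n) (𝓡 n).tangent ∞ (fun z ↦ (⟨z, Y z⟩ : TangentBundle (𝓡 n) M)) V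

/-- `D` is a smooth distribution of rank `d` on the open set `U`: locally it has a smooth frame. -/
def IsSmoothDistributionOn (D : TangentSubspaces n M) (d : ℕ) (U : Set M) : Prop :=
  ∀ x ∈ U, ∃ V : Set M, IsOpen V ∧ x ∈ V ∧ V ⊆ U ∧
    ∃ Y : Fin d → ∀ z : M, TangentSpace (𝓡 n) z,
      (∀ i, IsSmoothFieldOn (Y i) V) ∧
      ∀ z ∈ V, LinearIndependent ℝ (fun i ↦ Y i z) ∧
        Submodule.span ℝ (Set.range fun i ↦ Y i z) = D z

/-- `D` is totally geodesic on the open set `U`: `∇_X Y` is in `D` for all `X`, `Y` in `D`. -/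
def IsTotallyGeodesicOn (g : SmoothMetric n M) (D : TangentSubspaces n M) (U : Set M) : Prop :=
  ∀ V : Set M, IsOpen V → V ⊆ U → ∀ Y : (∀ z : M, TangentSpace (𝓡 n) z), IsSmoothFieldOn Y V →
    (∀ z ∈ V, Y z ∈ D z) → ∀ x ∈ V, ∀ X ∈ D x, leviCivita g Y x X ∈ D x

/-- The leaf through `x` of the restriction to `U` of the integrable distribution `D`: the points
that can be joined to `x` by a smooth curve in `U` that is everywhere tangent to `D`. -/
def leafOn (D : TangentSubspaces n M) (U : Set M) (x : M) : Set M :=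
  {y | ∃ γ : ℝ → M, ContMDiff 𝓘(ℝ, ℝ) (𝓡 n) ∞ γ ∧ γ 0 = x ∧ γ 1 = y ∧
    ∀ t : ℝ, γ t ∈ U ∧ mfderiv 𝓘(ℝ, ℝ) (𝓡 n) γ t (1 : ℝ) ∈ D (γ t)}

/-- `A` is a relatively open subset of a `d`-dimensional affine subspace. -/
def IsOpenInAffineSubspace {m : ℕ} (A : Set (Euc m)) (d : ℕ) : Prop :=
  ∃ S : AffineSubspace ℝ (Euc m), Module.finrank ℝ S.direction = d ∧
    ∃ O : Set (Euc m), IsOpen O ∧ A = O ∩ S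

/-! ### Immersions into Euclidean space -/

/-- `f` is a smooth isometric immersion of the open submanifold `U` of `M`. -/
structure IsIsometricImmersionOn (g : SmoothMetric n M) {m : ℕ} (f : M → Euc m) (U : Set M) : Prop where
  smooth : ContMDiffOn (𝓡 n) 𝓘(ℝ, Euc m) ∞ f U
  isometric : ∀ x ∈ U, ∀ v w : TangentSpace (𝓡 n) x,
    inner ℝ (mvfderiv (𝓡 n) f x v) (mvfderiv (𝓡 n) f x w) = g.inner x v w

/-- `f` is `D`-ruled on the open set `U`, where `D` has rank `d`. -/
structure IsRuledOn (g : SmoothMetric n M) (D : TangentSubspaces n M) (d : ℕ) {m : ℕ} (f : M → Euc m)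
    (U : Set M) : Prop where
  smooth : IsSmoothDistributionOn D d U
  totallyGeodesic : IsTotallyGeodesicOn g D U
  ruled : ∀ x ∈ U, IsOpenInAffineSubspace (f '' leafOn D U x) d

variable (n) in
/-- The normal space of `f` at `x`. -/
def normalSpace {m : ℕ} (f : M → Euc m) (x : M) : Submodule ℝ (Euc m) :=
  (LinearMap.range (mvfderiv (𝓡 n) f x).toLinearMap)ᗮ

/-- The second fundamental form `α(v, w)` of `f` at `x`: the normal component of the second
derivative of `f` in a chart. -/
def secondFundamentalForm {m : ℕ} (f : M → Euc m) (x : M) (v w : TangentSpace (𝓡 n) x) : Euc m :=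
  (normalSpace n f x).starProjection
    (fderiv ℝ (fderiv ℝ (f ∘ (extChartAt (𝓡 n) x).symm)) (extChartAt (𝓡 n) x x) v w)

/-- The normal connection of `f`: the normal component at `x` of the derivative of `ξ` along `X`. -/
def normalDeriv {m : ℕ} (f ξ : M → Euc m) (x : M) (X : TangentSpace (𝓡 n) x) : Euc m :=
  (normalSpace n f x).starProjection (mvfderiv (𝓡 n) ξ x X)

/-- `L_D`, the span of `α(TM, D)`. -/
def rulingNormalSpace {m : ℕ} (D : TangentSubspaces n M) (f : M → Euc m) (x : M) :
    Submodule ℝ (Euc m) :=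
  Submodule.span ℝ {ξ | ∃ v : TangentSpace (𝓡 n) x, ∃ w ∈ D x, ξ = secondFundamentalForm f x v w}

variable (n) in
/-- `ξ` is a smooth section over `V` of the family of subspaces `L`. -/
def IsSmoothSectionOn {m : ℕ} (L : M → Submodule ℝ (Euc m)) (ξ : M → Euc m) (V : Set M) : Prop :=
  ContMDiffOn (𝓡 n) 𝓘(ℝ, Euc m) ∞ ξ V ∧ ∀ z ∈ V, ξ z ∈ L z

variable (n) in
/-- `L` is a smooth subbundle of rank `r` of the normal bundle of `f` over the open set `U`. -/
structure IsNormalSubbundleOn {m : ℕ} (f : M → Euc m) (L : M → Submodule ℝ (Euc m)) (r : ℕ)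
    (U : Set M) : Prop where
  normal : ∀ x ∈ U, L x ≤ normalSpace n f x
  smooth : ∀ x ∈ U, ∃ V : Set M, IsOpen V ∧ x ∈ V ∧ V ⊆ U ∧ ∃ ξ : Fin r → M → Euc m,
    (∀ i, IsSmoothSectionOn n L (ξ i) V) ∧
    ∀ z ∈ V, LinearIndependent ℝ (fun i ↦ ξ i z) ∧
      Submodule.span ℝ (Set.range fun i ↦ ξ i z) = L z

/-- The normal subbundle `L` of `f` is parallel along `D` over the open set `U`. -/
def IsParallelAlongOn {m : ℕ} (f : M → Euc m) (D : TangentSubspaces n M)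
    (L : M → Submodule ℝ (Euc m)) (U : Set M) : Prop :=
  ∀ V : Set M, IsOpen V → V ⊆ U → ∀ ξ : M → Euc m, IsSmoothSectionOn n L ξ V →
    ∀ x ∈ V, ∀ X ∈ D x, normalDeriv f ξ x X ∈ L x

variable (n) in
/-- Over the open set `U`, `σ` restricts to a parallel vector bundle isometry from the normal
subbundle `L` of `f` (with the connection induced by the normal connection) onto the normal
bundle of `f'`. The values of `σ x` off `L x` are irrelevant. -/
structure IsParallelBundleIsometryOn {m k : ℕ} (f : M → Euc m) (L : M → Submodule ℝ (Euc m))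
    (f' : M → Euc k) (σ : M → Euc m →ₗ[ℝ] Euc k) (U : Set M) : Prop where
  onto : ∀ x ∈ U, (L x).map (σ x) = normalSpace n f' x
  isometric : ∀ x ∈ U, ∀ ξ ∈ L x, ‖σ x ξ‖ = ‖ξ‖
  smooth : ∀ V : Set M, IsOpen V → V ⊆ U → ∀ ξ : M → Euc m, IsSmoothSectionOn n L ξ V →
    ContMDiffOn (𝓡 n) 𝓘(ℝ, Euc k) ∞ (fun x ↦ σ x (ξ x)) V
  parallel : ∀ V : Set M, IsOpen V → V ⊆ U → ∀ ξ : M → Euc m, IsSmoothSectionOn n L ξ V →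
    ∀ x ∈ V, ∀ X : TangentSpace (𝓡 n) x,
      normalDeriv f' (fun z ↦ σ z (ξ z)) x X = σ x ((L x).starProjection (normalDeriv f ξ x X))

/-- `f' : U → ℝ^k` is a `D`-ruled isometric immersion whose second fundamental form is `σ ∘ α_L`, for
the parallel vector bundle isometry `σ` from `L` onto the normal bundle of `f'`. -/
structure IsRuledReductionOn (g : SmoothMetric n M) (D : TangentSubspaces n M) (d : ℕ) {m k : ℕ}
    (f : M → Euc m) (L : M → Submodule ℝ (Euc m)) (f' : M → Euc k)
    (σ : M → Euc m →ₗ[ℝ] Euc k) (U : Set M) : Prop where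
  immersion : IsIsometricImmersionOn g f' U
  ruled : IsRuledOn g D d f' U
  isometry : IsParallelBundleIsometryOn n f L f' σ U
  form : ∀ x ∈ U, ∀ v w : TangentSpace (𝓡 n) x,
    secondFundamentalForm f' x v w = σ x ((L x).starProjection (secondFundamentalForm f x v w))

end Manifold

/-- `f` is on `U` a (regular) composition `f = h ∘ f'`, where `h` is an isometric immersion into
`ℝ^m` of an open subset `W` of `ℝ^k` that contains `f'(U)`. -/
def IsCompositionOn {M : Type*} {m k : ℕ} (f : M → Euc m) (f' : M → Euc k) (U : Set M) : Prop :=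
  ∃ (W : Set (Euc k)) (h : Euc k → Euc m), IsOpen W ∧ f' '' U ⊆ W ∧ ContDiffOn ℝ ∞ h W ∧
    (∀ y ∈ W, ∀ v w : Euc k, inner ℝ (fderiv ℝ h y v) (fderiv ℝ h y w) = inner ℝ v w) ∧
    ∀ x ∈ U, f x = h (f' x)

end RuledComposition

end

open RuledComposition

/-! Each leaf of D is mapped into an affine subspace, so near any point f has the form c(t) + W(t)s,
with ruling coordinate s and one transversal parameter t (`IsRuledOn.exists_box`). Suppose that L
contains L_D and is parallel along D. Along D, the normal part of the derivative of a tangent field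
is a value of α(TM, D), hence lies in L_D, and that of a section of L lies in L. So the spaces f_*TM
⊕ L are constant in Euclidean space along the rulings and depend on t only. For a reduction f', the
frames (df, ξ) and (df', σξ) have equal inner products and equal connection coefficients. Hence the
isometry τ that carries the second to the first depends on t only, τ' is orthogonal to the image of
τ, and f = τ(t)f' + c(t) with c' orthogonal to that image too (`IsRuledBox.exists_rolling`): a copy
of ℝ^(n+ℓ) rolls along f without slipping.

The velocity τ'(t)y + c'(t) is normal to the image of τ(t), and it vanishes at y = f'(t, s). If t(y)
is a smooth choice of a time at which y has velocity zero, then h(y) = τ(t(y))y + c(t(y)) has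
derivative τ(t(y)), because the variation of t is multiplied by the velocity. So h is isometric, and
it extends f over f'. In codimension one the velocity is a single scalar, and the implicit function
theorem gives t(y) as soon as the acceleration is nonzero. In higher codimension the velocity gives
too many equations. The motion is then factored through a parallel family of hyperplanes, tilted so
that both factors have nonzero acceleration, and one inducts on the codimension
(`IsRollingOn.hasFlatExtension`). The acceleration at f'(t, s) is -τ'(∂_t f'). Since α(TM, D) ⊂ L,
its vanishing would put all values of α in L (`IsRuledBox.deriv_rolling_ne_zero`). This proves (i).

For (ii), the span of c', W and W' is f_*TM ⊕ L_D. On a small interval it has constant rank and a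
parallel orthonormal frame τ; integrating τ*c' and taking τ*W as ruling gives a ruled immersion, the
development, which is a reduction to L_D. Either the acceleration is nonzero somewhere, and the
extension exists nearby, or it vanishes on the whole box; then τ is constant and f is the
development followed by an affine isometry. Every other reduction to L_D comes from another parallel
frame of the same spaces, so it differs from the development by a rigid motion. A maximal disjoint
family of such boxes has dense union. Finally, α vanishes on D × D, so for t transversal to D the
Gauss equation gives R(t, ·) and α(t, ·) the same kernel on D, which yields the rank of the
curvature operator (`finrank_range_alternating`). -/

namespace RuledComposition

open Set Filter Topology

/-! ### Differential equations, antiderivatives and the inverse function theorem -/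

section Toolbox

variable {E F : Type*} [NormedAddCommGroup E] [NormedSpace ℝ E]
  [NormedAddCommGroup F] [NormedSpace ℝ F]

/-- A smooth vector field on an open set has, for a uniform time, smooth integral curves that
start near a given point and stay in the open set. -/
theorem exists_integral_curves [CompleteSpace E] {v : E → E} {Ω : Set E} (hΩ : IsOpen Ω)
    (hv : ContDiffOn ℝ ∞ v Ω) {x₀ : E} (hx₀ : x₀ ∈ Ω) :
    ∃ r > (0 : ℝ), ∃ ε > (0 : ℝ), ∀ x ∈ Metric.ball x₀ r, ∃ α : ℝ → E, α 0 = x ∧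
      ContDiffOn ℝ ∞ α (Ioo (-ε) ε) ∧
      ∀ t ∈ Ioo (-ε) ε, α t ∈ Ω ∧ HasDerivAt α (v (α t)) t := by
  have hv1 : ContDiffAt ℝ 1 v x₀ :=
    (hv.contDiffAt (hΩ.mem_nhds hx₀)).of_le (by exact_mod_cast le_top)
  obtain ⟨ε, hε, a, r, L, K, hr, hpl⟩ := IsPicardLindelof.of_contDiffAt_one hv1
  obtain ⟨α, hα, L', hL'⟩ :=
    (hpl 0).exists_forall_mem_closedBall_eq_hasDerivWithinAt_lipschitzOnWith
  simp only [zero_sub, zero_add] at hα hL'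
  obtain ⟨ρ, hρ, hρΩ⟩ := Metric.isOpen_iff.1 hΩ x₀ hx₀
  have hr' : (0 : ℝ) < r := hr
  have hx₀' : x₀ ∈ Metric.closedBall x₀ (r : ℝ) := Metric.mem_closedBall_self hr'.le
  have hcont : ContinuousAt (α x₀) 0 := by
    have := ((hα x₀ hx₀').2 0 ⟨by linarith, by linarith⟩).hasDerivAt
      (Icc_mem_nhds (by linarith) (by linarith))
    exact this.continuousAt
  obtain ⟨δ, hδ, hδ'⟩ := Metric.continuousAt_iff.1 hcont (ρ / 2) (by linarith)
  -- The Lipschitz constant in the initial value may be zero; adding one allows dividing by it.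
  have hL1 : (0 : ℝ) < L' + 1 := by positivity
  have hmem : ∀ x ∈ Metric.ball x₀ (min r (ρ / 2 / (L' + 1))), ∀ t ∈ Icc (-ε) ε, |t| < δ →
      α x t ∈ Ω := by
    intro x hx t ht htδ
    rw [Metric.mem_ball, lt_min_iff] at hx
    apply hρΩ
    have h1 := (hL' t ht).dist_le_mul x (Metric.mem_closedBall.2 hx.1.le) x₀ hx₀'
    have h2 : dist (α x₀ t) (α x₀ 0) < ρ / 2 := hδ' (by simpa using htδ)
    rw [(hα x₀ hx₀').1] at h2
    have h3 : L' * dist x x₀ ≤ (L' + 1) * dist x x₀ := by gcongr; linarith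
    have h4 : (L' + 1) * dist x x₀ < ρ / 2 := by
      have := (lt_div_iff₀ hL1).1 hx.2
      linarith
    calc dist (α x t) x₀ ≤ dist (α x t) (α x₀ t) + dist (α x₀ t) x₀ := dist_triangle _ _ _
      _ < ρ := by linarith
  refine ⟨min r (ρ / 2 / (L' + 1)), by positivity, min ε δ / 2, by positivity, fun x hx ↦
    ⟨α x, ?_⟩⟩
  have hxr : x ∈ Metric.closedBall x₀ (r : ℝ) :=
    Metric.mem_closedBall.2 ((lt_min_iff.1 (Metric.mem_ball.1 hx)).1.le)
  have hsub : Icc (-(min ε δ / 2)) (min ε δ / 2) ⊆ Icc (-ε) ε := by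
    apply Icc_subset_Icc <;> linarith [min_le_left ε δ, lt_min hε hδ]
  have hin : ∀ t ∈ Icc (-(min ε δ / 2)) (min ε δ / 2), α x t ∈ Ω := fun t ht ↦ by
    refine hmem x hx t (hsub ht) ?_
    rw [abs_lt]
    constructor <;> linarith [ht.1, ht.2, min_le_right ε δ, lt_min hε hδ]
  refine ⟨(hα x hxr).1, ?_, fun t ht ↦ ⟨hin t (Ioo_subset_Icc_self ht), ?_⟩⟩
  · have := ODE.contDiffOn_enat_Icc_of_hasDerivWithinAt (n := ⊤) (f := fun _ ↦ v) (α := α x)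
      (tmin := -(min ε δ / 2)) (tmax := min ε δ / 2) (u := Ω)
      (hv.comp contDiffOn_snd (fun p hp ↦ hp.2))
      (fun t ht ↦ ((hα x hxr).2 t (hsub ht)).mono hsub) hin
    exact this.mono Ioo_subset_Icc_self
  · exact ((hα x hxr).2 t (hsub (Ioo_subset_Icc_self ht))).hasDerivAt
      (Icc_mem_nhds (by linarith [ht.1, min_le_left ε δ, lt_min hε hδ])
        (by linarith [ht.2, min_le_left ε δ, lt_min hε hδ]))

/-- Smooth local solutions of linear differential equations. -/
theorem exists_linear_ode_solution [CompleteSpace E] {A : ℝ → E →L[ℝ] E} {J : Set ℝ}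
    (hJ : IsOpen J) (hA : ContDiffOn ℝ ∞ A J) {t₀ : ℝ} (ht₀ : t₀ ∈ J) (x₀ : E) :
    ∃ ε > (0 : ℝ), Ioo (t₀ - ε) (t₀ + ε) ⊆ J ∧ ∃ X : ℝ → E, X t₀ = x₀ ∧
      ContDiffOn ℝ ∞ X (Ioo (t₀ - ε) (t₀ + ε)) ∧
      ∀ t ∈ Ioo (t₀ - ε) (t₀ + ε), HasDerivAt X (A t (X t)) t := by
  -- Time is adjoined as a coordinate of speed one, which makes the equation autonomous; `hfst`
  -- recovers that this coordinate is t₀ + t.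
  have hv : ContDiffOn ℝ ∞ (fun p : ℝ × E ↦ ((1 : ℝ), A p.1 p.2)) (J ×ˢ univ) := by
    refine contDiffOn_const.prodMk ?_
    exact (hA.comp contDiffOn_fst (fun p hp ↦ hp.1)).clm_apply contDiffOn_snd
  obtain ⟨r, hr, ε, hε, h⟩ := exists_integral_curves (hJ.prod isOpen_univ) hv
    (x₀ := (t₀, x₀)) ⟨ht₀, mem_univ _⟩
  obtain ⟨α, h0, hs, hd⟩ := h (t₀, x₀) (Metric.mem_ball_self hr)
  have hfst : ∀ t ∈ Ioo (-ε) ε, (α t).1 = t₀ + t := by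
    have hd1 : ∀ t ∈ Ioo (-ε) ε, HasDerivAt (fun t ↦ (α t).1 - t) 0 t := fun t ht ↦ by
      have h1 : HasDerivAt (fun t ↦ (α t).1) 1 t :=
        (ContinuousLinearMap.fst ℝ ℝ E).hasFDerivAt.comp_hasDerivAt t (hd t ht).2
      have h2 := h1.sub (hasDerivAt_id' t)
      rw [sub_self] at h2
      exact h2
    intro t ht
    have hc := (convex_Ioo (-ε) ε).is_const_of_fderivWithin_eq_zero (𝕜 := ℝ)
      (f := fun t ↦ (α t).1 - t)
      (fun t ht ↦ (hd1 t ht).differentiableAt.differentiableWithinAt)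
      (fun t ht ↦ by
        rw [fderivWithin_of_isOpen isOpen_Ioo ht]
        ext; simpa using (hd1 t ht).deriv) ht (y := 0) ⟨by linarith, by linarith⟩
    simp only [h0] at hc
    linarith
  have hmap : ∀ t ∈ Ioo (t₀ - ε) (t₀ + ε), t - t₀ ∈ Ioo (-ε) ε := fun t ht ↦
    ⟨by linarith [ht.1], by linarith [ht.2]⟩
  refine ⟨ε, hε, fun t ht ↦ ?_, fun t ↦ (α (t - t₀)).2, by simp [h0], ?_, fun t ht ↦ ?_⟩
  · have := (hd _ (hmap t ht)).1.1
    rwa [hfst _ (hmap t ht), add_sub_cancel] at this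
  · exact (contDiff_snd.comp_contDiffOn (hs.comp (contDiff_id.sub contDiff_const).contDiffOn hmap))
  · have h1 : HasDerivAt (fun t ↦ (α t).2) (A (α (t - t₀)).1 (α (t - t₀)).2) (t - t₀) :=
      (ContinuousLinearMap.snd ℝ ℝ E).hasFDerivAt.comp_hasDerivAt _ (hd _ (hmap t ht)).2
    rw [hfst _ (hmap t ht), add_sub_cancel] at h1
    have := h1.scomp t ((hasDerivAt_id' t).sub_const t₀)
    rw [one_smul] at this
    exact this

/-- Smooth functions on an interval have smooth antiderivatives. -/
theorem exists_smooth_antiderivative [CompleteSpace E] {g : ℝ → E} {J : Set ℝ} (hJ : IsOpen J)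
    (hJc : J.OrdConnected) (hg : ContDiffOn ℝ ∞ g J) :
    ∃ G : ℝ → E, ContDiffOn ℝ ∞ G J ∧ ∀ t ∈ J, HasDerivAt G (g t) t := by
  rcases J.eq_empty_or_nonempty with rfl | ⟨t₀, ht₀⟩
  · exact ⟨0, by simp⟩
  have hd : ∀ t ∈ J, HasDerivAt (fun t ↦ ∫ s in t₀..t, g s) (g t) t := fun t ht ↦ by
    have hsub : uIcc t₀ t ⊆ J := hJc.uIcc_subset ht₀ ht
    exact intervalIntegral.integral_hasDerivAt_right
      ((hg.continuousOn.mono hsub).intervalIntegrable)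
      (hg.continuousOn.stronglyMeasurableAtFilter hJ t ht)
      (hg.continuousOn.continuousAt (hJ.mem_nhds ht))
  refine ⟨_, ?_, hd⟩
  rw [contDiffOn_infty_iff_deriv_of_isOpen hJ]
  exact ⟨fun t ht ↦ (hd t ht).differentiableAt.differentiableWithinAt,
    hg.congr fun t ht ↦ (hd t ht).deriv⟩

/-- The inverse function theorem for smooth maps on open sets. -/
theorem exists_smooth_local_inverse [CompleteSpace E] {f : E → F} {Ω : Set E} (hΩ : IsOpen Ω)
    (hf : ContDiffOn ℝ ∞ f Ω) {x : E} (hx : x ∈ Ω) (f' : E ≃L[ℝ] F)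
    (hf' : HasFDerivAt f (f' : E →L[ℝ] F) x) :
    ∃ e : OpenPartialHomeomorph E F, x ∈ e.source ∧ e.source ⊆ Ω ∧ (e : E → F) = f ∧
      ContDiffOn ℝ ∞ e.symm e.target := by
  have hfx : ContDiffAt ℝ ∞ f x := hf.contDiffAt (hΩ.mem_nhds hx)
  let e₀ := hfx.toOpenPartialHomeomorph f hf' (by simp)
  have hcont : ContinuousOn (fderiv ℝ f) Ω := hf.continuousOn_fderiv_of_isOpen hΩ (by simp)
  -- Restricting to points with invertible derivative makes the inverse smooth on its whole domain,
  -- not only at the image of x.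
  let U : Set E := Ω ∩ fderiv ℝ f ⁻¹' range ((↑) : (E ≃L[ℝ] F) → E →L[ℝ] F)
  have hU : IsOpen U := hcont.isOpen_inter_preimage hΩ ContinuousLinearEquiv.isOpen
  refine ⟨e₀.restrOpen U hU, ?_, ?_, rfl, ?_⟩
  · exact ⟨hfx.mem_toOpenPartialHomeomorph_source hf' (by simp), hx, f', hf'.fderiv.symm⟩
  · exact fun y hy ↦ hy.2.1
  · intro y hy
    have hy' : (e₀.restrOpen U hU).symm y ∈ (e₀.restrOpen U hU).source :=
      (e₀.restrOpen U hU).map_target hy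
    obtain ⟨hyΩ, g', hg'⟩ := hy'.2
    have hc : ContDiffAt ℝ ∞ f ((e₀.restrOpen U hU).symm y) := hf.contDiffAt (hΩ.mem_nhds hyΩ)
    refine ((e₀.restrOpen U hU).contDiffAt_symm (f₀' := g') hy ?_ hc).contDiffWithinAt
    rw [hg']
    exact (hc.differentiableAt (by simp)).hasFDerivAt

theorem ContDiffOn.clm_inverse {G : Type*} [NormedAddCommGroup G] [NormedSpace ℝ G]
    [CompleteSpace E] {A : G → E →L[ℝ] F} {s : Set G}
    {r : WithTop ℕ∞} (hA : ContDiffOn ℝ r A s) (hi : ∀ x ∈ s, (A x).IsInvertible) :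
    ContDiffOn ℝ r (fun x ↦ (A x).inverse) s := fun x hx ↦
  (hi x hx).contDiffAt_map_inverse.comp_contDiffWithinAt x (hA x hx)

theorem isInvertible_of_injective [FiniteDimensional ℝ E] {A : E →L[ℝ] E}
    (hA : Function.Injective A) : A.IsInvertible :=
  ⟨(LinearEquiv.ofInjectiveEndo A.toLinearMap hA).toContinuousLinearEquiv, by ext; rfl⟩

end Toolbox

/-! ### Adjoints and least-squares left inverses -/

section Adjoint

variable {E F G : Type*} [NormedAddCommGroup E] [InnerProductSpace ℝ E] [CompleteSpace E]
  [NormedAddCommGroup F] [InnerProductSpace ℝ F] [CompleteSpace F]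
  [NormedAddCommGroup G] [NormedSpace ℝ G]

/-- The adjoint as a bounded linear map. -/
noncomputable def adjointL (E F : Type*) [NormedAddCommGroup E] [InnerProductSpace ℝ E]
    [CompleteSpace E] [NormedAddCommGroup F] [InnerProductSpace ℝ F] [CompleteSpace F] :
    (E →L[ℝ] F) →L[ℝ] (F →L[ℝ] E) :=
  LinearMap.mkContinuous
    { toFun := fun A ↦ ContinuousLinearMap.adjoint A
      map_add' := fun A B ↦ by simp
      map_smul' := fun c A ↦ by simp } 1 (fun A ↦ by simp)

@[simp] theorem adjointL_apply (A : E →L[ℝ] F) :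
    adjointL E F A = ContinuousLinearMap.adjoint A := rfl

theorem ContDiffOn.clm_adjoint {A : G → E →L[ℝ] F} {s : Set G} {r : WithTop ℕ∞}
    (hA : ContDiffOn ℝ r A s) : ContDiffOn ℝ r (fun x ↦ ContinuousLinearMap.adjoint (A x)) s :=
  (adjointL E F).contDiff.comp_contDiffOn hA

theorem HasDerivAt.clm_adjoint {A : ℝ → E →L[ℝ] F} {A' : E →L[ℝ] F} {t : ℝ}
    (hA : HasDerivAt A A' t) :
    HasDerivAt (fun t ↦ ContinuousLinearMap.adjoint (A t)) (ContinuousLinearMap.adjoint A') t :=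
  (adjointL E F).hasFDerivAt.comp_hasDerivAt t hA

theorem isInvertible_adjoint_comp_self [FiniteDimensional ℝ E] {A : E →L[ℝ] F}
    (hA : Function.Injective A) : ((ContinuousLinearMap.adjoint A).comp A).IsInvertible := by
  apply isInvertible_of_injective
  rw [injective_iff_map_eq_zero]
  intro x hx
  have : inner ℝ (A x) (A x) = 0 := by
    rw [← ContinuousLinearMap.adjoint_inner_left, ← ContinuousLinearMap.comp_apply, hx,
      inner_zero_left]
  exact (injective_iff_map_eq_zero A).1 hA x (inner_self_eq_zero.1 this)

/-- The left inverse `(A* A)⁻¹ A*` of an injective linear map. -/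
noncomputable def leftInv (A : E →L[ℝ] F) : F →L[ℝ] E :=
  ((ContinuousLinearMap.adjoint A).comp A).inverse.comp (ContinuousLinearMap.adjoint A)

theorem leftInv_apply [FiniteDimensional ℝ E] {A : E →L[ℝ] F} (hA : Function.Injective A) (x : E) :
    leftInv A (A x) = x := by
  have := (isInvertible_adjoint_comp_self hA).inverse_apply_eq (x := x)
    (y := (ContinuousLinearMap.adjoint A).comp A x)
  simpa [leftInv] using this

theorem ContDiffOn.leftInv [FiniteDimensional ℝ E] {A : G → E →L[ℝ] F} {s : Set G} {r : WithTop ℕ∞}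
    (hA : ContDiffOn ℝ r A s) (hi : ∀ x ∈ s, Function.Injective (A x)) :
    ContDiffOn ℝ r (fun x ↦ leftInv (A x)) s :=
  (ContDiffOn.clm_inverse (hA.clm_adjoint.clm_comp hA)
    fun x hx ↦ isInvertible_adjoint_comp_self (hi x hx)).clm_comp hA.clm_adjoint

end Adjoint

end RuledComposition

namespace RuledComposition

open Set Filter Topology

theorem eq_of_hasFDerivAt_zero {E F : Type*} [NormedAddCommGroup E] [NormedSpace ℝ E]
    [NormedAddCommGroup F] [NormedSpace ℝ F] {f : E → F} {s : Set E} (hs : IsOpen s)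
    (hc : Convex ℝ s) (hf : ∀ x ∈ s, HasFDerivAt f (0 : E →L[ℝ] F) x) {x y : E} (hx : x ∈ s)
    (hy : y ∈ s) : f x = f y :=
  hc.is_const_of_fderivWithin_eq_zero (𝕜 := ℝ)
    (fun z hz ↦ (hf z hz).differentiableAt.differentiableWithinAt)
    (fun z hz ↦ by rw [fderivWithin_of_isOpen hs hz]; exact (hf z hz).fderiv) hx hy

section LeftInv

variable {E F : Type*} [NormedAddCommGroup E] [InnerProductSpace ℝ E] [FiniteDimensional ℝ E]
  [NormedAddCommGroup F] [InnerProductSpace ℝ F] [CompleteSpace F]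

/-- These are the normal equations: `A ∘ leftInv A` is the orthogonal projection onto the range of
A. -/
theorem inner_sub_leftInv {A : E →L[ℝ] F} (hA : Function.Injective A) (y : F) (x : E) :
    inner ℝ (y - A (leftInv A y)) (A x) = 0 := by
  have h := (isInvertible_adjoint_comp_self hA).self_apply_inverse
    (ContinuousLinearMap.adjoint A y)
  have h2 : ContinuousLinearMap.adjoint A (A (leftInv A y)) = ContinuousLinearMap.adjoint A y := by
    simpa [leftInv] using h
  rw [← ContinuousLinearMap.adjoint_inner_left, map_sub, h2, sub_self, inner_zero_left]

end LeftInv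

section Isometric

variable {E F : Type*} [NormedAddCommGroup E] [InnerProductSpace ℝ E]
  [NormedAddCommGroup F] [InnerProductSpace ℝ F]

theorem inner_map_of_norm_eq {τ : E →L[ℝ] F} (h : ∀ v, ‖τ v‖ = ‖v‖) (v w : E) :
    inner ℝ (τ v) (τ w) = inner ℝ v w :=
  LinearIsometry.inner_map_map ⟨τ.toLinearMap, h⟩ v w

theorem injective_of_norm_eq {τ : E →L[ℝ] F} (h : ∀ v, ‖τ v‖ = ‖v‖) : Function.Injective τ :=
  LinearIsometry.injective ⟨τ.toLinearMap, h⟩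

theorem adjoint_apply_of_norm_eq [CompleteSpace E] [CompleteSpace F] {τ : E →L[ℝ] F}
    (h : ∀ v, ‖τ v‖ = ‖v‖) (v : E) :
    ContinuousLinearMap.adjoint τ (τ v) = v :=
  ext_inner_right ℝ fun w ↦ by
    rw [ContinuousLinearMap.adjoint_inner_left, inner_map_of_norm_eq h]

end Isometric

/-! ### Parallel frames, rolling motions and their flat extension in codimension one -/

/-- A family of subspaces of a Euclidean space with a smooth frame has a parallel orthonormal
frame: its derivative is orthogonal to the subspaces. -/
theorem exists_parallel_frame {k m : ℕ} {A : ℝ → Euc k →L[ℝ] Euc m} {J : Set ℝ} (hJ : IsOpen J)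
    (hA : ContDiffOn ℝ ∞ A J) (hi : ∀ t ∈ J, Function.Injective (A t)) {t₀ : ℝ} (ht₀ : t₀ ∈ J) :
    ∃ ε > (0 : ℝ), Ioo (t₀ - ε) (t₀ + ε) ⊆ J ∧ ∃ τ : ℝ → Euc k →L[ℝ] Euc m,
      ContDiffOn ℝ ∞ τ (Ioo (t₀ - ε) (t₀ + ε)) ∧ ∀ t ∈ Ioo (t₀ - ε) (t₀ + ε),
        (∀ v, ‖τ t v‖ = ‖v‖) ∧ (τ t).range = (A t).range ∧
        ∀ v w, inner ℝ (deriv τ t v) (A t w) = 0 := by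
  have hA' : ContDiffOn ℝ ∞ (deriv A) J := hA.deriv_of_isOpen hJ (by simp)
  -- With A⁺ = `leftInv A`, the equation R' = -A⁺A'R is the condition that the derivative of AR have
  -- no component in the range of A.
  have hB : ContDiffOn ℝ ∞ (fun t ↦ -((leftInv (A t)).comp (deriv A t))) J :=
    ((ContDiffOn.leftInv hA hi).clm_comp hA').neg
  have hfin : Module.finrank ℝ (A t₀).range = k := by
    have := LinearMap.finrank_range_of_inj (f := (A t₀).toLinearMap) (hi t₀ ht₀)
    simpa using this
  let b := (stdOrthonormalBasis ℝ (A t₀).range).reindex (finCongr hfin)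
  -- The initial value makes A R₀ an orthonormal frame of the range at t₀; `hiso` shows that it
  -- stays orthonormal, since its derivative is orthogonal to the range.
  let R₀ : Euc k →L[ℝ] Euc k := (leftInv (A t₀)).comp
    ((Submodule.subtypeL _).comp (b.repr.symm.toContinuousLinearEquiv : Euc k →L[ℝ] (A t₀).range))
  have hR₀ : ∀ v, A t₀ (R₀ v) = b.repr.symm v := fun v ↦ by
    obtain ⟨x, hx⟩ := (b.repr.symm v).2
    have hx' : A t₀ x = b.repr.symm v := hx
    have : R₀ v = leftInv (A t₀) (b.repr.symm v) := rfl
    rw [this, ← hx', leftInv_apply (hi t₀ ht₀)]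
  obtain ⟨ε, hε, hsub, R, hR0, hRs, hRd⟩ := exists_linear_ode_solution hJ
    ((ContinuousLinearMap.compL ℝ (Euc k) (Euc k) (Euc k)).contDiff.comp_contDiffOn hB) ht₀ R₀
  have hd : ∀ t ∈ Ioo (t₀ - ε) (t₀ + ε), HasDerivAt (fun t ↦ (A t).comp (R t))
      ((deriv A t).comp (R t) + (A t).comp
        ((-((leftInv (A t)).comp (deriv A t))).comp (R t))) t := fun t ht ↦ by
    have h1 : HasDerivAt A (deriv A t) t :=
      ((hA.differentiableOn (by simp)).differentiableAt (hJ.mem_nhds (hsub ht))).hasDerivAt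
    exact h1.clm_comp (hRd t ht)
  have hperp : ∀ t ∈ Ioo (t₀ - ε) (t₀ + ε), ∀ v w,
      inner ℝ (deriv (fun t ↦ (A t).comp (R t)) t v) (A t w) = 0 := fun t ht v w ↦ by
    rw [(hd t ht).deriv]
    have := inner_sub_leftInv (hi t (hsub ht)) (deriv A t (R t v)) w
    simpa [sub_eq_add_neg] using this
  have ht₀' : t₀ ∈ Ioo (t₀ - ε) (t₀ + ε) := ⟨by linarith, by linarith⟩
  have hiso : ∀ t ∈ Ioo (t₀ - ε) (t₀ + ε), ∀ v, ‖(A t).comp (R t) v‖ = ‖v‖ := fun t ht v ↦ by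
    have hz : ∀ s ∈ Ioo (t₀ - ε) (t₀ + ε), HasDerivAt
        (fun s ↦ inner ℝ ((A s).comp (R s) v) ((A s).comp (R s) v)) 0 s := fun s hs ↦ by
      have h1 : HasDerivAt (fun s ↦ (A s).comp (R s) v)
          (deriv (fun t ↦ (A t).comp (R t)) s v) s := by
        have := (hd s hs).differentiableAt.hasDerivAt.clm_apply (hasDerivAt_const s v)
        simpa using this
      have h2 := h1.inner ℝ h1
      have h3 := hperp s hs v (R s v)
      convert! h2 using 1
      rw [real_inner_comm, ContinuousLinearMap.comp_apply, h3, add_zero]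
    have hconst := eq_of_hasFDerivAt_zero isOpen_Ioo (convex_Ioo _ _)
      (fun s hs ↦ by simpa using (hz s hs).hasFDerivAt) ht ht₀'
    have h0 : ‖(A t₀).comp (R t₀) v‖ = ‖v‖ := by
      rw [ContinuousLinearMap.comp_apply, hR0, hR₀]
      exact b.repr.symm.norm_map v
    rw [ContinuousLinearMap.comp_apply] at h0 ⊢
    rw [h0] at hconst
    exact (pow_left_inj₀ (norm_nonneg _) (norm_nonneg _) two_ne_zero).1 hconst
  refine ⟨ε, hε, hsub, fun t ↦ (A t).comp (R t), (hA.mono hsub).clm_comp hRs, fun t ht ↦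
    ⟨hiso t ht, ?_, hperp t ht⟩⟩
  apply Submodule.eq_of_le_of_finrank_eq
  · rintro _ ⟨v, rfl⟩
    exact ⟨R t v, rfl⟩
  · have h1 := LinearMap.finrank_range_of_inj (f := ((A t).comp (R t)).toLinearMap)
      (injective_of_norm_eq (hiso t ht))
    have h2 := LinearMap.finrank_range_of_inj (f := (A t).toLinearMap) (hi t (hsub ht))
    exact h1.trans h2.symm

/-- A smooth curve `y ↦ τ t y + c t` of isometric embeddings of `ℝ^k` in `ℝ^m` whose velocities are
orthogonal to their images. -/
structure IsRollingOn {k m : ℕ} (τ : ℝ → Euc k →L[ℝ] Euc m) (c : ℝ → Euc m) (J : Set ℝ) :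
    Prop where
  smooth_linear : ContDiffOn ℝ ∞ τ J
  smooth_vector : ContDiffOn ℝ ∞ c J
  isometric : ∀ t ∈ J, ∀ v, ‖τ t v‖ = ‖v‖
  linear_perp : ∀ t ∈ J, ∀ v w, inner ℝ (deriv τ t v) (τ t w) = 0
  vector_perp : ∀ t ∈ J, ∀ w, inner ℝ (deriv c t) (τ t w) = 0

/-- The velocity of the point `y` under the motion `y ↦ τ t y + c t`. -/
noncomputable def velocity {k m : ℕ} (τ : ℝ → Euc k →L[ℝ] Euc m) (c : ℝ → Euc m) (y : Euc k)
    (t : ℝ) : Euc m :=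
  deriv τ t y + deriv c t

section Rolling

variable {k m : ℕ} {τ : ℝ → Euc k →L[ℝ] Euc m} {c : ℝ → Euc m} {J : Set ℝ}

theorem IsRollingOn.hasDerivAt_linear (h : IsRollingOn τ c J) (hJ : IsOpen J) {t : ℝ} (ht : t ∈ J) :
    HasDerivAt τ (deriv τ t) t :=
  ((h.smooth_linear.differentiableOn (by simp)).differentiableAt (hJ.mem_nhds ht)).hasDerivAt

theorem IsRollingOn.hasDerivAt_vector (h : IsRollingOn τ c J) (hJ : IsOpen J) {t : ℝ} (ht : t ∈ J) :
    HasDerivAt c (deriv c t) t :=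
  ((h.smooth_vector.differentiableOn (by simp)).differentiableAt (hJ.mem_nhds ht)).hasDerivAt

theorem IsRollingOn.velocity_perp (h : IsRollingOn τ c J) {t : ℝ} (ht : t ∈ J) (y w : Euc k) :
    inner ℝ (velocity τ c y t) (τ t w) = 0 := by
  rw [velocity, inner_add_left, h.linear_perp t ht, h.vector_perp t ht, add_zero]

theorem IsRollingOn.contDiffOn_velocity (h : IsRollingOn τ c J) (hJ : IsOpen J) :
    ContDiffOn ℝ ∞ (fun p : ℝ × Euc k ↦ velocity τ c p.2 p.1) (J ×ˢ univ) :=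
  (((h.smooth_linear.deriv_of_isOpen hJ (by simp)).comp contDiffOn_fst
    (fun _ hp ↦ hp.1)).clm_apply contDiffOn_snd).add
    ((h.smooth_vector.deriv_of_isOpen hJ (by simp)).comp contDiffOn_fst (fun _ hp ↦ hp.1))

theorem IsRollingOn.hasDerivAt_velocity (h : IsRollingOn τ c J) (hJ : IsOpen J) (y : Euc k)
    {t : ℝ} (ht : t ∈ J) : HasDerivAt (velocity τ c y) (deriv (velocity τ c y) t) t := by
  have := (h.contDiffOn_velocity hJ).comp (contDiffOn_id.prodMk contDiffOn_const)
    (s := J) (f := fun t ↦ (t, y)) (fun t ht ↦ ⟨ht, mem_univ _⟩)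
  exact ((this.differentiableOn (by simp)).differentiableAt (hJ.mem_nhds ht)).hasDerivAt

/-- The acceleration of a point of velocity zero is orthogonal to the image. -/
theorem IsRollingOn.acceleration_perp (h : IsRollingOn τ c J) (hJ : IsOpen J) {t₀ : ℝ}
    (ht₀ : t₀ ∈ J) {y₀ : Euc k} (h0 : velocity τ c y₀ t₀ = 0) (w : Euc k) :
    inner ℝ (deriv (velocity τ c y₀) t₀) (τ t₀ w) = 0 := by
  have h1 : HasDerivAt (fun t ↦ τ t w) (deriv τ t₀ w) t₀ := by
    simpa using (h.hasDerivAt_linear hJ ht₀).clm_apply (hasDerivAt_const t₀ w)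
  have h2 := (h.hasDerivAt_velocity hJ y₀ ht₀).inner ℝ h1
  have h3 : (fun t ↦ inner ℝ (velocity τ c y₀ t) (τ t w)) =ᶠ[𝓝 t₀] fun _ ↦ 0 := by
    filter_upwards [hJ.mem_nhds ht₀] with t ht using h.velocity_perp ht y₀ w
  have h4 := h2.unique ((hasDerivAt_const t₀ (0 : ℝ)).congr_of_eventuallyEq h3)
  simpa [h0] using h4

end Rolling

/-- In codimension one, a vector orthogonal to the image of an isometric embedding and to a nonzero
normal vector vanishes. -/
theorem eq_zero_of_perp_of_codim_one {k : ℕ} {τ : Euc k →L[ℝ] Euc (k + 1)}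
    (hτ : ∀ v, ‖τ v‖ = ‖v‖) {u v : Euc (k + 1)} (hu : ∀ w, inner ℝ u (τ w) = 0) (hu0 : u ≠ 0)
    (hv : ∀ w, inner ℝ v (τ w) = 0) (huv : inner ℝ u v = 0) : v = 0 := by
  have hmem : ∀ {x : Euc (k + 1)}, (∀ w, inner ℝ x (τ w) = 0) → x ∈ τ.rangeᗮ := fun hx ↦ by
    rw [Submodule.mem_orthogonal']
    rintro _ ⟨w, rfl⟩
    exact hx w
  have h1 : Module.finrank ℝ τ.range = k := by
    simpa using LinearMap.finrank_range_of_inj (f := τ.toLinearMap) (injective_of_norm_eq hτ)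
  have h2 : Module.finrank ℝ (τ.rangeᗮ : Submodule ℝ (Euc (k + 1))) = 1 := by
    have := Submodule.finrank_add_finrank_orthogonal τ.range
    rw [h1] at this
    simpa using this
  obtain ⟨a, ha⟩ := (finrank_eq_one_iff_of_nonzero' (⟨u, hmem hu⟩ : (τ.rangeᗮ : Submodule ℝ _))
    (by simpa using hu0)).1 h2 ⟨v, hmem hv⟩
  have ha' : a • u = v := congrArg Subtype.val ha
  rw [← ha', inner_smul_right, real_inner_self_eq_norm_sq] at huv
  have : a = 0 := by
    rcases mul_eq_zero.1 huv with h | h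
    · exact h
    · exact absurd (norm_eq_zero.1 (pow_eq_zero_iff two_ne_zero |>.1 h)) hu0
  rw [← ha', this, zero_smul]

/-- An isometric immersion near `y₀` that agrees with each of the motions `y ↦ τ t y + c t` where
the velocity vanishes. -/
def HasFlatExtension {k m : ℕ} (τ : ℝ → Euc k →L[ℝ] Euc m) (c : ℝ → Euc m) (J : Set ℝ) (t₀ : ℝ)
    (y₀ : Euc k) : Prop :=
  ∃ (W : Set (Euc k)) (J' : Set ℝ) (h : Euc k → Euc m), IsOpen W ∧ y₀ ∈ W ∧ IsOpen J' ∧ t₀ ∈ J' ∧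
    J' ⊆ J ∧ ContDiffOn ℝ ∞ h W ∧
    (∀ y ∈ W, ∀ v w : Euc k, inner ℝ (fderiv ℝ h y v) (fderiv ℝ h y w) = inner ℝ v w) ∧
    ∀ t ∈ J', ∀ y ∈ W, velocity τ c y t = 0 → h y = τ t y + c t

/-- The extension is an envelope. In codimension one the velocity lies in the normal line, so the
single equation ⟨e₀, velocity⟩ = 0 decides whether it vanishes. The nonzero acceleration lets this
be solved for t = T(y), and y ↦ τ(T(y))y + c(T(y)) then has derivative τ(T(y)), the term in dT being
a multiple of the velocity. -/
theorem IsRollingOn.hasFlatExtension_codim_one {k : ℕ} {τ : ℝ → Euc k →L[ℝ] Euc (k + 1)}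
    {c : ℝ → Euc (k + 1)} {J : Set ℝ} (h : IsRollingOn τ c J) (hJ : IsOpen J) {t₀ : ℝ}
    (ht₀ : t₀ ∈ J) {y₀ : Euc k} (h0 : velocity τ c y₀ t₀ = 0)
    (h1 : deriv (velocity τ c y₀) t₀ ≠ 0) : HasFlatExtension τ c J t₀ y₀ := by
  set e₀ := deriv (velocity τ c y₀) t₀ with he₀
  -- The first component is the scalar equation for the time, the second keeps y. At (t₀, y₀) the
  -- derivative of the first component in t is ‖e₀‖², so Ψ is locally invertible there.
  let Ψ : ℝ × Euc k → ℝ × Euc k := fun p ↦ (inner ℝ e₀ (velocity τ c p.2 p.1), p.2)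
  have hΨ : ContDiffOn ℝ ∞ Ψ (J ×ˢ univ) :=
    (contDiffOn_const.inner ℝ (h.contDiffOn_velocity hJ)).prodMk contDiffOn_snd
  have hopen : IsOpen (J ×ˢ (univ : Set (Euc k))) := hJ.prod isOpen_univ
  have hmem : (t₀, y₀) ∈ J ×ˢ (univ : Set (Euc k)) := ⟨ht₀, mem_univ _⟩
  have hd : HasFDerivAt Ψ (fderiv ℝ Ψ (t₀, y₀)) (t₀, y₀) :=
    ((hΨ.differentiableOn (by simp)).differentiableAt (hopen.mem_nhds hmem)).hasFDerivAt
  have hsnd : ∀ p, (fderiv ℝ Ψ (t₀, y₀) p).2 = p.2 := fun p ↦ by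
    have h2 : HasFDerivAt (Prod.snd ∘ Ψ)
        ((ContinuousLinearMap.snd ℝ ℝ (Euc k)).comp (fderiv ℝ Ψ (t₀, y₀))) (t₀, y₀) :=
      hasFDerivAt_snd.comp _ hd
    exact DFunLike.congr_fun (h2.unique hasFDerivAt_snd) p
  have hfst : ∀ s : ℝ, (fderiv ℝ Ψ (t₀, y₀) (s, 0)).1 = s * ‖e₀‖ ^ 2 := fun s ↦ by
    have h2 : HasDerivAt (fun t ↦ Ψ (t, y₀)) (fderiv ℝ Ψ (t₀, y₀) (1, 0)) t₀ :=
      hd.comp_hasDerivAt t₀ ((hasDerivAt_id t₀).prodMk (hasDerivAt_const t₀ y₀))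
    have h3 : HasDerivAt (fun t ↦ (Ψ (t, y₀)).1) (fderiv ℝ Ψ (t₀, y₀) (1, 0)).1 t₀ :=
      (ContinuousLinearMap.fst ℝ ℝ (Euc k)).hasFDerivAt.comp_hasDerivAt t₀ h2
    have h4 := (hasDerivAt_const t₀ e₀).inner ℝ (h.hasDerivAt_velocity hJ y₀ ht₀)
    have h5 := h3.unique h4
    rw [inner_zero_left, add_zero, ← he₀, real_inner_self_eq_norm_sq] at h5
    have : ((s, 0) : ℝ × Euc k) = s • (1, 0) := by simp
    rw [this, map_smul, Prod.smul_fst, h5, smul_eq_mul]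
  have hinj : Function.Injective (fderiv ℝ Ψ (t₀, y₀)) := by
    rw [injective_iff_map_eq_zero]
    rintro ⟨s, v⟩ hp
    have hv : v = 0 := (hsnd (s, v)).symm.trans (by rw [hp]; rfl)
    subst hv
    have := hfst s
    rw [hp] at this
    have hs : s = 0 := by simpa [h1] using this.symm
    rw [hs]; rfl
  obtain ⟨Ψ', hΨ'⟩ := isInvertible_of_injective hinj
  obtain ⟨e, hes, hesub, hee, hesymm⟩ := exists_smooth_local_inverse hopen hΨ hmem Ψ'
    (by rw [hΨ']; exact hd)
  obtain ⟨J₁, hJ₁, W₁, hW₁, hprod⟩ := mem_nhds_prod_iff.1 (e.open_source.mem_nhds hes)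
  -- The part of e₀ normal to the image at time t. It equals e₀ at t₀, and while it is nonzero it
  -- spans the normal line, so a velocity orthogonal to it vanishes.
  let q : ℝ → Euc (k + 1) := fun t ↦ e₀ - τ t (ContinuousLinearMap.adjoint (τ t) e₀)
  have hq : ContDiffOn ℝ ∞ q J := contDiffOn_const.sub
    (h.smooth_linear.clm_apply ((ContDiffOn.clm_adjoint h.smooth_linear).clm_apply contDiffOn_const))
  have hqperp : ∀ t ∈ J, ∀ w, inner ℝ (q t) (τ t w) = 0 := fun t ht w ↦ by
    simp only [q]
    rw [inner_sub_left, inner_map_of_norm_eq (h.isometric t ht),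
      ContinuousLinearMap.adjoint_inner_left, sub_self]
  have hq0 : q t₀ = e₀ := by
    have : ContinuousLinearMap.adjoint (τ t₀) e₀ = 0 := ext_inner_right ℝ fun w ↦ by
      rw [ContinuousLinearMap.adjoint_inner_left, h.acceleration_perp hJ ht₀ h0, inner_zero_left]
    simp [q, this]
  have hJ₂ : IsOpen (J ∩ q ⁻¹' {0}ᶜ) :=
    hq.continuousOn.isOpen_inter_preimage hJ isOpen_compl_singleton
  have hJ' : IsOpen (interior J₁ ∩ (J ∩ q ⁻¹' {0}ᶜ)) := isOpen_interior.inter hJ₂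
  have ht₀' : t₀ ∈ interior J₁ ∩ (J ∩ q ⁻¹' {0}ᶜ) :=
    ⟨mem_interior_iff_mem_nhds.2 hJ₁, ht₀, by simpa [hq0] using h1⟩
  -- The time T(y) is the first component of Ψ⁻¹(0, y).
  let S : Euc k → ℝ × Euc k := fun y ↦ (0, y)
  have hS : ContDiff ℝ ∞ S := contDiff_const.prodMk contDiff_id
  have hW₀ : IsOpen (S ⁻¹' e.target) := e.open_target.preimage hS.continuous
  have hT : ContDiffOn ℝ ∞ (fun y ↦ (e.symm (S y)).1) (S ⁻¹' e.target) :=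
    contDiff_fst.comp_contDiffOn (hesymm.comp hS.contDiffOn fun y hy ↦ hy)
  have hW₂ := hT.continuousOn.isOpen_inter_preimage hW₀ hJ'
  have heS : e (t₀, y₀) = S y₀ := by rw [hee]; simp [Ψ, S, h0]
  have hW : IsOpen (interior W₁ ∩
      (S ⁻¹' e.target ∩ (fun y ↦ (e.symm (S y)).1) ⁻¹' (interior J₁ ∩ (J ∩ q ⁻¹' {0}ᶜ)))) :=
    isOpen_interior.inter hW₂
  refine ⟨_, _, fun y ↦ τ (e.symm (S y)).1 y + c (e.symm (S y)).1, hW, ?_, hJ', ht₀',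
    fun t ht ↦ ht.2.1, ?_, ?_, ?_⟩
  · refine ⟨mem_interior_iff_mem_nhds.2 hW₁, ?_, ?_⟩
    · rw [mem_preimage, ← heS]
      exact e.map_source hes
    · rw [mem_preimage, ← heS, e.left_inv hes]
      exact ht₀'
  · have hmap : MapsTo (fun y ↦ (e.symm (S y)).1) (interior W₁ ∩ (S ⁻¹' e.target ∩
        (fun y ↦ (e.symm (S y)).1) ⁻¹' (interior J₁ ∩ (J ∩ q ⁻¹' {0}ᶜ)))) J :=
      fun y hy ↦ hy.2.2.2.1
    have hT' := hT.mono (t := interior W₁ ∩ (S ⁻¹' e.target ∩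
        (fun y ↦ (e.symm (S y)).1) ⁻¹' (interior J₁ ∩ (J ∩ q ⁻¹' {0}ᶜ)))) (fun y hy ↦ hy.2.1)
    exact ((h.smooth_linear.comp hT' hmap).clm_apply contDiffOn_id).add
      (h.smooth_vector.comp hT' hmap)
  · rintro y ⟨-, hyt, hyJ⟩ v w
    have hR : e (e.symm (S y)) = S y := e.right_inv hyt
    have hsymm : e.symm (S y) = ((e.symm (S y)).1, y) := by
      refine Prod.ext rfl ?_
      have := congrArg Prod.snd hR
      rwa [hee] at this
    have hvel0 : inner ℝ e₀ (velocity τ c y (e.symm (S y)).1) = 0 := by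
      have := congrArg Prod.fst hR
      rw [hee, hsymm] at this
      exact this
    set T := (e.symm (S y)).1 with hTdef
    have hTJ : T ∈ J := hyJ.2.1
    have hvel : velocity τ c y T = 0 := by
      refine eq_zero_of_perp_of_codim_one (h.isometric T hTJ) (hqperp T hTJ) hyJ.2.2
        (h.velocity_perp hTJ y) ?_
      simp only [q]
      rw [inner_sub_left, hvel0, real_inner_comm, h.velocity_perp hTJ, sub_zero]
    have hTd : HasFDerivAt (fun y ↦ (e.symm (S y)).1)
        (fderiv ℝ (fun y ↦ (e.symm (S y)).1) y) y :=
      ((hT.differentiableOn (by simp)).differentiableAt (hW₀.mem_nhds hyt)).hasFDerivAt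
    have hd1 := ((h.hasDerivAt_linear hJ hTJ).hasFDerivAt.comp y hTd).clm_apply (hasFDerivAt_id y)
    have hd2 := hd1.add ((h.hasDerivAt_vector hJ hTJ).hasFDerivAt.comp y hTd)
    have hfd : ∀ v, fderiv ℝ (fun y ↦ τ (e.symm (S y)).1 y + c (e.symm (S y)).1) y v = τ T v := by
      intro v
      have h6 : fderiv ℝ (fun y ↦ τ (e.symm (S y)).1 y + c (e.symm (S y)).1) y = _ := hd2.fderiv
      rw [h6]
      set r := fderiv ℝ (fun y ↦ (e.symm (S y)).1) y v
      -- All terms of the derivative that come from the variation of T add up to this multiple of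
      -- the velocity.
      have h7 : r • velocity τ c y T = 0 := by rw [hvel, smul_zero]
      rw [velocity, smul_add] at h7
      simpa [add_assoc, ← hTdef, r] using h7
    rw [hfd, hfd, inner_map_of_norm_eq (h.isometric T hTJ)]
  · rintro t ht y hy hvel
    have hmem' : (t, y) ∈ e.source := hprod ⟨interior_subset ht.1, interior_subset hy.1⟩
    have : e (t, y) = S y := by rw [hee]; simp [Ψ, S, hvel]
    simp only [← this, e.left_inv hmem']

end RuledComposition

namespace RuledComposition

open Set Filter Topology

/-! ### Flat extension in arbitrary codimension -/

/-- A hyperplane field with smooth nonzero normal vector field has a parallel orthonormal frame. -/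
theorem exists_parallel_hyperplane_frame {m : ℕ} {q : ℝ → Euc (m + 1)} {J : Set ℝ} (hJ : IsOpen J)
    (hq : ContDiffOn ℝ ∞ q J) {t₀ : ℝ} (ht₀ : t₀ ∈ J) (hq0 : q t₀ ≠ 0) :
    ∃ ε > (0 : ℝ), Ioo (t₀ - ε) (t₀ + ε) ⊆ J ∧ ∃ τ : ℝ → Euc m →L[ℝ] Euc (m + 1),
      ContDiffOn ℝ ∞ τ (Ioo (t₀ - ε) (t₀ + ε)) ∧ ∀ t ∈ Ioo (t₀ - ε) (t₀ + ε),
        (∀ v, ‖τ t v‖ = ‖v‖) ∧ (∀ x, inner ℝ (q t) x = 0 ↔ x ∈ (τ t).range) ∧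
        ∀ v w, inner ℝ (deriv τ t v) (τ t w) = 0 := by
  have hfr : ∀ x : Euc (m + 1), x ≠ 0 →
      Module.finrank ℝ ((ℝ ∙ x)ᗮ : Submodule ℝ (Euc (m + 1))) = m := fun x hx ↦ by
    have h1 := Submodule.finrank_add_finrank_orthogonal (ℝ ∙ x)
    rw [finrank_span_singleton hx, finrank_euclideanSpace, Fintype.card_fin] at h1
    omega
  let b := (stdOrthonormalBasis ℝ ((ℝ ∙ q t₀)ᗮ : Submodule ℝ (Euc (m + 1)))).reindex
    (finCongr (hfr _ hq0))
  let ι : Euc m →L[ℝ] Euc (m + 1) := (Submodule.subtypeL _).comp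
    (b.repr.symm.toContinuousLinearEquiv :
      Euc m →L[ℝ] ((ℝ ∙ q t₀)ᗮ : Submodule ℝ (Euc (m + 1))))
  have hι : ∀ v, inner ℝ (q t₀) (ι v) = 0 := fun v ↦
    Submodule.mem_orthogonal_singleton_iff_inner_right.1 (b.repr.symm v).2
  have hιi : Function.Injective ι := Subtype.val_injective.comp b.repr.symm.injective
  let g : ℝ → ℝ := fun t ↦ inner ℝ (q t₀) (q t)
  have hg : ContDiffOn ℝ ∞ g J := contDiffOn_const.inner ℝ hq
  have hJ₁ : IsOpen (J ∩ g ⁻¹' {0}ᶜ) :=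
    hg.continuousOn.isOpen_inter_preimage hJ isOpen_compl_singleton
  -- The fixed hyperplane orthogonal to q(t₀), projected orthogonally to the one orthogonal to q(t);
  -- this is injective while ⟨q(t₀), q(t)⟩ ≠ 0.
  let A : ℝ → Euc m →L[ℝ] Euc (m + 1) := fun t ↦
    ι - (‖q t‖ ^ 2)⁻¹ • ((innerSL ℝ (q t)).comp ι).smulRight (q t)
  have hqne : ∀ t ∈ J ∩ g ⁻¹' {0}ᶜ, q t ≠ 0 := fun t ht h ↦ ht.2 (by simp [g, h])
  have hA : ContDiffOn ℝ ∞ A (J ∩ g ⁻¹' {0}ᶜ) := by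
    have hq' := hq.mono (t := J ∩ g ⁻¹' {0}ᶜ) inter_subset_left
    refine contDiffOn_const.sub (ContDiffOn.smul ((hq'.norm_sq ℝ).inv fun t ht ↦ ?_) ?_)
    · simpa using hqne t ht
    · exact ContDiffOn.smulRight
        (((innerSL ℝ).contDiff.comp_contDiffOn hq').clm_comp contDiffOn_const) hq'
  have hAv : ∀ t v, A t v = ι v - (‖q t‖ ^ 2)⁻¹ • (inner ℝ (q t) (ι v) : ℝ) • q t := fun t v ↦ by
    simp [A]
  have hAi : ∀ t ∈ J ∩ g ⁻¹' {0}ᶜ, Function.Injective (A t) := fun t ht ↦ by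
    rw [injective_iff_map_eq_zero]
    intro v hv
    rw [hAv, sub_eq_zero, smul_smul] at hv
    have h1 := hι v
    rw [hv, inner_smul_right] at h1
    rcases mul_eq_zero.1 h1 with h2 | h2
    · rw [h2, zero_smul] at hv
      exact (injective_iff_map_eq_zero ι).1 hιi v hv
    · exact absurd h2 ht.2
  have hAq : ∀ t ∈ J ∩ g ⁻¹' {0}ᶜ, ∀ v, inner ℝ (q t) (A t v) = 0 := fun t ht v ↦ by
    have : ‖q t‖ ^ 2 ≠ 0 := by simpa using hqne t ht
    rw [hAv, inner_sub_right, inner_smul_right, inner_smul_right, real_inner_self_eq_norm_sq]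
    rw [mul_left_comm, inv_mul_cancel₀ this, mul_one, sub_self]
  obtain ⟨ε, hε, hsub, τ, hτ, h⟩ := exists_parallel_frame hJ₁ hA hAi (t₀ := t₀)
    ⟨ht₀, by simpa [g] using hq0⟩
  refine ⟨ε, hε, hsub.trans inter_subset_left, τ, hτ, fun t ht ↦ ?_⟩
  obtain ⟨hiso, hran, hperp⟩ := h t ht
  have hsubq : (τ t).range ≤ ((ℝ ∙ q t)ᗮ : Submodule ℝ (Euc (m + 1))) := by
    rw [hran]
    rintro _ ⟨v, rfl⟩
    exact Submodule.mem_orthogonal_singleton_iff_inner_right.2 (hAq t (hsub ht) v)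
  have heq := Submodule.eq_of_le_of_finrank_eq hsubq (by
    rw [hfr _ (hqne t (hsub ht))]
    simpa using LinearMap.finrank_range_of_inj (f := (τ t).toLinearMap) (injective_of_norm_eq hiso))
  refine ⟨hiso, fun x ↦ ?_, fun v w ↦ ?_⟩
  · rw [heq, Submodule.mem_orthogonal_singleton_iff_inner_right]
  · obtain ⟨u, hu⟩ : τ t w ∈ (A t).range := hran ▸ ⟨w, rfl⟩
    have hu' : A t u = τ t w := hu
    rw [← hu', hperp]

/-- Factorization of a motion through a parallel family of larger subspaces. -/
theorem IsRollingOn.exists_factorization {k l m : ℕ} {τ : ℝ → Euc k →L[ℝ] Euc m} {c : ℝ → Euc m}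
    {J : Set ℝ} (h : IsRollingOn τ c J) (hJ : IsOpen J) (hJc : J.OrdConnected)
    {τ₁ : ℝ → Euc l →L[ℝ] Euc m} (hτ₁ : ContDiffOn ℝ ∞ τ₁ J)
    (hiso : ∀ t ∈ J, ∀ v, ‖τ₁ t v‖ = ‖v‖)
    (hperp : ∀ t ∈ J, ∀ v w, inner ℝ (deriv τ₁ t v) (τ₁ t w) = 0)
    (hle : ∀ t ∈ J, (τ t).range ≤ (τ₁ t).range) :
    ∃ (c₁ : ℝ → Euc m) (τ₂ : ℝ → Euc k →L[ℝ] Euc l) (c₂ : ℝ → Euc l),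
      IsRollingOn τ₁ c₁ J ∧ IsRollingOn τ₂ c₂ J ∧
      (∀ t ∈ J, ∀ y, τ₁ t (τ₂ t y + c₂ t) + c₁ t = τ t y + c t) ∧
      (∀ t ∈ J, ∀ y, velocity τ₂ c₂ y t = ContinuousLinearMap.adjoint (τ₁ t) (velocity τ c y t)) ∧
      (∀ t ∈ J, ∀ z y, velocity τ₁ c₁ z t = velocity τ c y t -
        τ₁ t (ContinuousLinearMap.adjoint (τ₁ t) (velocity τ c y t)) +
        deriv τ₁ t (z - (τ₂ t y + c₂ t))) := by
  have hadj : ContDiffOn ℝ ∞ (fun t ↦ ContinuousLinearMap.adjoint (τ₁ t)) J :=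
    ContDiffOn.clm_adjoint hτ₁
  have hτ₁d : ∀ t ∈ J, HasDerivAt τ₁ (deriv τ₁ t) t := fun t ht ↦
    ((hτ₁.differentiableOn (by simp)).differentiableAt (hJ.mem_nhds ht)).hasDerivAt
  have hadjd : ∀ t ∈ J, HasDerivAt (fun t ↦ ContinuousLinearMap.adjoint (τ₁ t))
      (ContinuousLinearMap.adjoint (deriv τ₁ t)) t := fun t ht ↦
    HasDerivAt.clm_adjoint (hτ₁d t ht)
  have hself : ∀ t ∈ J, ∀ y, τ₁ t (ContinuousLinearMap.adjoint (τ₁ t) (τ t y)) = τ t y := by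
    intro t ht y
    obtain ⟨u, hu⟩ := hle t ht ⟨y, rfl⟩
    have hu' : τ₁ t u = τ t y := hu
    rw [← hu', adjoint_apply_of_norm_eq (hiso t ht)]
  -- The derivative of τ₁ is orthogonal to its range, so the derivative of the adjoint kills that
  -- range, which contains the image of τ.
  have hkill : ∀ t ∈ J, ∀ y, ContinuousLinearMap.adjoint (deriv τ₁ t) (τ t y) = 0 := by
    intro t ht y
    refine ext_inner_right ℝ fun w ↦ ?_
    rw [ContinuousLinearMap.adjoint_inner_left, ← hself t ht, real_inner_comm, hperp t ht,
      inner_zero_left]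
  -- With τ₂ = τ₁*τ and c₂' = τ₁*c', the velocity of the inner motion is τ₁* applied to the original
  -- velocity; c₁ is then forced by the factorization.
  obtain ⟨c₂, hc₂, hc₂d⟩ := exists_smooth_antiderivative hJ hJc
    (hadj.clm_apply (h.smooth_vector.deriv_of_isOpen hJ (by simp)))
  set τ₂ : ℝ → Euc k →L[ℝ] Euc l := fun t ↦ (ContinuousLinearMap.adjoint (τ₁ t)).comp (τ t) with hτ₂
  have hτ₂d : ∀ t ∈ J, ∀ y, deriv τ₂ t y = ContinuousLinearMap.adjoint (τ₁ t) (deriv τ t y) := by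
    intro t ht y
    have := ((hadjd t ht).clm_comp (h.hasDerivAt_linear hJ ht)).deriv
    have h2 : deriv τ₂ t = _ := this
    rw [h2]
    simp [hkill t ht]
  have hvel₂ : ∀ t ∈ J, ∀ y, velocity τ₂ c₂ y t =
      ContinuousLinearMap.adjoint (τ₁ t) (velocity τ c y t) := fun t ht y ↦ by
    rw [velocity, velocity, hτ₂d t ht, (hc₂d t ht).deriv, map_add]
  set c₁ : ℝ → Euc m := fun t ↦ c t - τ₁ t (c₂ t) with hc₁
  have hc₁d : ∀ t ∈ J, HasDerivAt c₁ (deriv c t - (deriv τ₁ t (c₂ t) +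
      τ₁ t (ContinuousLinearMap.adjoint (τ₁ t) (deriv c t)))) t := fun t ht ↦
    (h.hasDerivAt_vector hJ ht).sub ((hτ₁d t ht).clm_apply (hc₂d t ht))
  have hτd : ∀ t ∈ J, ∀ y, deriv τ t y = deriv τ₁ t (τ₂ t y) +
      τ₁ t (ContinuousLinearMap.adjoint (τ₁ t) (deriv τ t y)) := fun t ht y ↦ by
    have h1 : HasDerivAt (fun t ↦ (τ₁ t).comp (τ₂ t)) _ t := (hτ₁d t ht).clm_comp
      ((hadjd t ht).clm_comp (h.hasDerivAt_linear hJ ht))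
    have h2 : τ =ᶠ[𝓝 t] fun t ↦ (τ₁ t).comp (τ₂ t) := by
      filter_upwards [hJ.mem_nhds ht] with s hs
      ext1 y
      exact (hself s hs y).symm
    have h3 := DFunLike.congr_fun (h2.deriv_eq.trans h1.deriv) y
    simpa [hkill t ht, τ₂] using h3
  refine ⟨c₁, τ₂, c₂, ⟨hτ₁, h.smooth_vector.sub (hτ₁.clm_apply hc₂), hiso, hperp, ?_⟩,
    ⟨hadj.clm_comp h.smooth_linear, hc₂, ?_, ?_, ?_⟩, ?_, hvel₂, ?_⟩
  · intro t ht w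
    rw [(hc₁d t ht).deriv, inner_sub_left, inner_add_left, hperp t ht,
      inner_map_of_norm_eq (hiso t ht), ContinuousLinearMap.adjoint_inner_left]
    ring
  · intro t ht v
    rw [← hiso t ht, hτ₂, ContinuousLinearMap.comp_apply, hself t ht, h.isometric t ht]
  · intro t ht v w
    rw [hτ₂d t ht, ContinuousLinearMap.adjoint_inner_left, hτ₂, ContinuousLinearMap.comp_apply,
      hself t ht, h.linear_perp t ht]
  · intro t ht w
    rw [(hc₂d t ht).deriv, ContinuousLinearMap.adjoint_inner_left, hτ₂,
      ContinuousLinearMap.comp_apply, hself t ht, h.vector_perp t ht]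
  · intro t ht y
    simp only [hτ₂, hc₁, ContinuousLinearMap.comp_apply, map_add, hself t ht]
    abel
  · intro t ht z y
    have h4 := hτd t ht y
    rw [velocity, velocity, (hc₁d t ht).deriv]
    simp only [map_add, map_sub]
    generalize τ₁ t (ContinuousLinearMap.adjoint (τ₁ t) (deriv τ t y)) = w at h4 ⊢
    rw [h4]
    abel

/-- Motions with nonzero acceleration extend to flat submanifolds. -/
theorem IsRollingOn.hasFlatExtension (d : ℕ) : ∀ {k m : ℕ} (_ : m = k + d)
    {τ : ℝ → Euc k →L[ℝ] Euc m} {c : ℝ → Euc m} {J : Set ℝ}, IsRollingOn τ c J → IsOpen J →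
    ∀ {t₀ : ℝ}, t₀ ∈ J → ∀ {y₀ : Euc k}, velocity τ c y₀ t₀ = 0 →
    deriv (velocity τ c y₀) t₀ ≠ 0 → HasFlatExtension τ c J t₀ y₀ := by
  induction d with
  | zero =>
    rintro k m rfl τ c J h hJ t₀ ht₀ y₀ h0 h1
    -- In codimension zero the acceleration is orthogonal to the whole space, so it cannot be
    -- nonzero.
    exfalso
    have hsurj : Function.Surjective (τ t₀) :=
      LinearMap.injective_iff_surjective.1 (injective_of_norm_eq (h.isometric t₀ ht₀))
    obtain ⟨w, hw⟩ := hsurj (deriv (velocity τ c y₀) t₀)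
    have := h.acceleration_perp hJ ht₀ h0 w
    rw [hw] at this
    exact h1 (inner_self_eq_zero.1 this)
  | succ d ih =>
    rintro k m rfl τ c J h hJ t₀ ht₀ y₀ h0 h1
    rcases d.eq_zero_or_pos with rfl | hd
    · exact h.hasFlatExtension_codim_one hJ ht₀ h0 h1
    set e₀ := deriv (velocity τ c y₀) t₀ with he₀
    have hperp₀ : ∀ w, inner ℝ e₀ (τ t₀ w) = 0 := h.acceleration_perp hJ ht₀ h0
    -- Here the codimension is at least two, which leaves room for a second normal direction
    -- orthogonal to the acceleration.
    obtain ⟨e₁, he₁, he₁0⟩ : ∃ e₁ ∈ ((τ t₀).range ⊔ (ℝ ∙ e₀))ᗮ, e₁ ≠ 0 := by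
      refine Submodule.exists_mem_ne_zero_of_ne_bot fun hbot ↦ ?_
      rw [Submodule.orthogonal_eq_bot_iff] at hbot
      have h2 := Submodule.finrank_add_le_finrank_add_finrank (τ t₀).range (ℝ ∙ e₀)
      rw [hbot, finrank_top, finrank_span_singleton h1] at h2
      have h3 : Module.finrank ℝ (τ t₀).range = k := by
        simpa using LinearMap.finrank_range_of_inj (f := (τ t₀).toLinearMap)
          (injective_of_norm_eq (h.isometric t₀ ht₀))
      rw [h3, finrank_euclideanSpace, Fintype.card_fin] at h2
      omega
    have he₁τ : ∀ w, inner ℝ e₁ (τ t₀ w) = 0 := fun w ↦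
      (Submodule.mem_orthogonal' _ _).1 he₁ _ (Submodule.mem_sup_left ⟨w, rfl⟩)
    have he₁e₀ : inner ℝ e₁ e₀ = 0 :=
      (Submodule.mem_orthogonal' _ _).1 he₁ _
        (Submodule.mem_sup_right (Submodule.mem_span_singleton_self e₀))
    -- The normal of the intermediate hyperplane must be neither parallel nor orthogonal to e₀: the
    -- acceleration of the inner motion is the component of e₀ in the hyperplane, that of the outer
    -- motion the component along its normal, and both must be nonzero. Hence e₀ + e₁ at t₀, made
    -- orthogonal to the image of τ at the other times.
    let q : ℝ → Euc (k + (d + 1)) := fun t ↦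
      (e₀ + e₁) - τ t (ContinuousLinearMap.adjoint (τ t) (e₀ + e₁))
    have hq : ContDiffOn ℝ ∞ q J := contDiffOn_const.sub (h.smooth_linear.clm_apply
      ((ContDiffOn.clm_adjoint h.smooth_linear).clm_apply contDiffOn_const))
    have hqperp : ∀ t ∈ J, ∀ w, inner ℝ (q t) (τ t w) = 0 := fun t ht w ↦ by
      simp only [q]
      rw [inner_sub_left, inner_map_of_norm_eq (h.isometric t ht),
        ContinuousLinearMap.adjoint_inner_left, sub_self]
    have hqt₀ : q t₀ = e₀ + e₁ := by
      have : ContinuousLinearMap.adjoint (τ t₀) (e₀ + e₁) = 0 := ext_inner_right ℝ fun w ↦ by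
        rw [ContinuousLinearMap.adjoint_inner_left, inner_add_left, hperp₀, he₁τ, add_zero,
          inner_zero_left]
      simp only [q, this, map_zero, sub_zero]
    have he₀sq : inner ℝ e₀ e₀ ≠ 0 := fun h ↦ h1 (inner_self_eq_zero.1 h)
    have hq0 : q t₀ ≠ 0 := fun hz ↦ he₀sq (by
      rw [hqt₀] at hz
      have : inner ℝ (e₀ + e₁) e₀ = 0 := by rw [hz, inner_zero_left]
      rwa [inner_add_left, he₁e₀, add_zero] at this)
    obtain ⟨ε, hε, hsub, τ₁, hτ₁, hfr⟩ := exists_parallel_hyperplane_frame (m := k + d) hJ hq ht₀ hq0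
    set I := Ioo (t₀ - ε) (t₀ + ε)
    have hI : IsOpen I := isOpen_Ioo
    have ht₀I : t₀ ∈ I := ⟨by linarith, by linarith⟩
    have hI' : IsRollingOn τ c I := ⟨h.smooth_linear.mono hsub, h.smooth_vector.mono hsub,
      fun t ht ↦ h.isometric t (hsub ht), fun t ht ↦ h.linear_perp t (hsub ht),
      fun t ht ↦ h.vector_perp t (hsub ht)⟩
    obtain ⟨c₁, τ₂, c₂, hr₁, hr₂, hfac, hv₂, hv₁⟩ := hI'.exists_factorization hI ordConnected_Ioo
      hτ₁ (fun t ht ↦ (hfr t ht).1) (fun t ht ↦ (hfr t ht).2.2) (by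
        rintro t ht _ ⟨w, rfl⟩
        exact ((hfr t ht).2.1 _).1 (hqperp t (hsub ht) w))
    set z₀ := τ₂ t₀ y₀ + c₂ t₀ with hz₀
    have hvd : HasDerivAt (velocity τ c y₀) e₀ t₀ := h.hasDerivAt_velocity hJ y₀ ht₀
    have hτ₁d := hr₁.hasDerivAt_linear hI ht₀I
    have hadjd : HasDerivAt (fun t ↦ ContinuousLinearMap.adjoint (τ₁ t))
        (ContinuousLinearMap.adjoint (deriv τ₁ t₀)) t₀ :=
      HasDerivAt.clm_adjoint hτ₁d
    have hvz₂ : velocity τ₂ c₂ y₀ t₀ = 0 := by rw [hv₂ t₀ ht₀I, h0, map_zero]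
    have hacc₂ : deriv (velocity τ₂ c₂ y₀) t₀ = ContinuousLinearMap.adjoint (τ₁ t₀) e₀ := by
      have h2 : velocity τ₂ c₂ y₀ =ᶠ[𝓝 t₀]
          fun t ↦ ContinuousLinearMap.adjoint (τ₁ t) (velocity τ c y₀ t) := by
        filter_upwards [hI.mem_nhds ht₀I] with t ht using hv₂ t ht y₀
      rw [h2.deriv_eq, (hadjd.clm_apply hvd).deriv, h0, map_zero, zero_add]
    have hvz₁ : velocity τ₁ c₁ z₀ t₀ = 0 := by
      rw [hv₁ t₀ ht₀I z₀ y₀, h0, hz₀, sub_self]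
      simp
    have hacc₁ : deriv (velocity τ₁ c₁ z₀) t₀ =
        e₀ - τ₁ t₀ (ContinuousLinearMap.adjoint (τ₁ t₀) e₀) := by
      have h2 : velocity τ₁ c₁ z₀ =ᶠ[𝓝 t₀] fun t ↦ velocity τ c y₀ t -
          τ₁ t (ContinuousLinearMap.adjoint (τ₁ t) (velocity τ c y₀ t)) +
          deriv τ₁ t (z₀ - (τ₂ t y₀ + c₂ t)) := by
        filter_upwards [hI.mem_nhds ht₀I] with t ht using hv₁ t ht z₀ y₀
      have hd₁ : HasDerivAt (deriv τ₁) (deriv (deriv τ₁) t₀) t₀ :=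
        (((hτ₁.deriv_of_isOpen hI (m := ∞) (by simp)).differentiableOn (by simp)).differentiableAt
          (hI.mem_nhds ht₀I)).hasDerivAt
      have hin : HasDerivAt (fun t ↦ z₀ - (τ₂ t y₀ + c₂ t)) (-velocity τ₂ c₂ y₀ t₀) t₀ := by
        have := (((hr₂.hasDerivAt_linear hI ht₀I).clm_apply (hasDerivAt_const t₀ y₀)).add
          (hr₂.hasDerivAt_vector hI ht₀I)).const_sub z₀
        simpa [velocity] using! this
      have h3 := (hvd.sub (hτ₁d.clm_apply (hadjd.clm_apply hvd))).add (hd₁.clm_apply hin)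
      rw [h2.deriv_eq]
      have h4 : deriv (fun t ↦ velocity τ c y₀ t -
          τ₁ t (ContinuousLinearMap.adjoint (τ₁ t) (velocity τ c y₀ t)) +
          deriv τ₁ t (z₀ - (τ₂ t y₀ + c₂ t))) t₀ = _ := h3.deriv
      rw [h4, h0, hvz₂, ← hz₀]
      simp
    obtain ⟨W₂, J₂, h₂, hW₂, hy₂, hJ₂, htJ₂, hJ₂I, hs₂, hi₂, he₂⟩ :=
      ih (k := k) rfl hr₂ hI ht₀I hvz₂ (by
        rw [hacc₂]
        intro hz
        have h5 : ∀ w, inner ℝ e₀ (τ₁ t₀ w) = 0 := fun w ↦ by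
          rw [← ContinuousLinearMap.adjoint_inner_left, hz, inner_zero_left]
        -- This vector lies in the hyperplane, and its inner product with e₀ is ‖e₁‖²‖e₀‖² ≠ 0, so
        -- e₀ is not normal to the hyperplane.
        have h6 : inner ℝ (q t₀) ((inner ℝ e₁ e₁ : ℝ) • e₀ - (inner ℝ e₀ e₀ : ℝ) • e₁) = 0 := by
          rw [hqt₀, inner_sub_right, inner_smul_right, inner_smul_right, inner_add_left,
            inner_add_left, he₁e₀, real_inner_comm e₁ e₀, he₁e₀]
          ring
        obtain ⟨w, hw⟩ := ((hfr t₀ ht₀I).2.1 _).1 h6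
        have h7 := h5 w
        have hw' : τ₁ t₀ w = (inner ℝ e₁ e₁ : ℝ) • e₀ - (inner ℝ e₀ e₀ : ℝ) • e₁ := hw
        rw [hw', inner_sub_right, inner_smul_right, inner_smul_right, real_inner_comm e₁ e₀, he₁e₀,
          mul_zero, sub_zero] at h7
        rcases mul_eq_zero.1 h7 with h8 | h8
        · exact he₁0 (inner_self_eq_zero.1 h8)
        · exact he₀sq h8)
    obtain ⟨W₁, J₁, h₁, hW₁, hy₁, hJ₁, htJ₁, hJ₁I, hs₁, hi₁, he₁'⟩ :=
      hr₁.hasFlatExtension_codim_one hI ht₀I hvz₁ (by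
        rw [hacc₁]
        intro hz
        -- Vanishing would put e₀ in the hyperplane, while ⟨q(t₀), e₀⟩ = ‖e₀‖².
        have h5 : inner ℝ (q t₀) (e₀ - τ₁ t₀ (ContinuousLinearMap.adjoint (τ₁ t₀) e₀)) = 0 := by
          rw [hz, inner_zero_right]
        have h6 : inner ℝ (q t₀) (τ₁ t₀ (ContinuousLinearMap.adjoint (τ₁ t₀) e₀)) = 0 :=
          ((hfr t₀ ht₀I).2.1 _).2 ⟨_, rfl⟩
        rw [inner_sub_right, h6, sub_zero, hqt₀, inner_add_left,
          he₁e₀, add_zero] at h5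
        exact he₀sq h5)
    have hW := hs₂.continuousOn.isOpen_inter_preimage hW₂ hW₁
    have hh₂ : h₂ y₀ = z₀ := he₂ t₀ htJ₂ y₀ hy₂ hvz₂
    refine ⟨W₂ ∩ h₂ ⁻¹' W₁, J₁ ∩ J₂, h₁ ∘ h₂, hW, ⟨hy₂, by rw [mem_preimage, hh₂]; exact hy₁⟩,
      hJ₁.inter hJ₂, ⟨htJ₁, htJ₂⟩, fun t ht ↦ hsub (hJ₁I ht.1), ?_, ?_, ?_⟩
    · exact hs₁.comp (hs₂.mono inter_subset_left) fun y hy ↦ hy.2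
    · rintro y ⟨hyW₂, hyW₁⟩ v w
      have hd₂ := (hs₂.differentiableOn (by simp)).differentiableAt (hW₂.mem_nhds hyW₂)
      have hd₁ := (hs₁.differentiableOn (by simp)).differentiableAt (hW₁.mem_nhds hyW₁)
      rw [fderiv_comp y hd₁ hd₂]
      simp only [ContinuousLinearMap.comp_apply]
      rw [hi₁ _ hyW₁, hi₂ _ hyW₂]
    · rintro t ⟨ht₁, ht₂⟩ y ⟨hyW₂, hyW₁⟩ hvel
      have htI := hJ₁I ht₁
      have h5 : h₂ y = τ₂ t y + c₂ t := he₂ t ht₂ y hyW₂ (by rw [hv₂ t htI, hvel, map_zero])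
      have h6 : h₁ (h₂ y) = τ₁ t (h₂ y) + c₁ t := he₁' t ht₁ _ hyW₁ (by
        rw [hv₁ t htI _ y, hvel, h5, sub_self]
        simp)
      rw [Function.comp_apply, h6, h5, hfac t htI]

end RuledComposition

namespace RuledComposition

open Set Filter Topology

/-! ### Derivatives, second fundamental form and normal connection in a parametrization -/

theorem fderiv_fderiv_comp {P E V : Type*} [NormedAddCommGroup P] [NormedSpace ℝ P]
    [NormedAddCommGroup E] [NormedSpace ℝ E] [NormedAddCommGroup V] [NormedSpace ℝ V]
    {h : E → V} {g : P → E} {p : P} (hh : ContDiffAt ℝ 2 h (g p)) (hg : ContDiffAt ℝ 2 g p)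
    (a b : P) :
    fderiv ℝ (fderiv ℝ (h ∘ g)) p a b =
      fderiv ℝ (fderiv ℝ h) (g p) (fderiv ℝ g p a) (fderiv ℝ g p b) +
        fderiv ℝ h (g p) (fderiv ℝ (fderiv ℝ g) p a b) := by
  have h1 : fderiv ℝ (h ∘ g) =ᶠ[𝓝 p] fun q ↦ (fderiv ℝ h (g q)).comp (fderiv ℝ g q) := by
    have e1 : ∀ᶠ q in 𝓝 p, ContDiffAt ℝ 2 h (g q) :=
      hg.continuousAt.eventually (hh.eventually (by simp))
    have e2 : ∀ᶠ q in 𝓝 p, ContDiffAt ℝ 2 g q := hg.eventually (by simp)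
    filter_upwards [e1, e2] with q hq1 hq2
    exact fderiv_comp q (hq1.differentiableAt (by simp)) (hq2.differentiableAt (by simp))
  have d1 : DifferentiableAt ℝ (fderiv ℝ h) (g p) :=
    (hh.fderiv_right (m := 1) (by norm_num)).differentiableAt (by simp)
  have d2 : DifferentiableAt ℝ (fderiv ℝ g) p :=
    (hg.fderiv_right (m := 1) (by norm_num)).differentiableAt (by simp)
  have d3 := (d1.hasFDerivAt.comp p (hg.differentiableAt (by simp)).hasFDerivAt).clm_comp
    d2.hasFDerivAt
  rw [h1.fderiv_eq]
  have d4 : fderiv ℝ (fun q ↦ (fderiv ℝ h (g q)).comp (fderiv ℝ g q)) p = _ := d3.fderiv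
  rw [d4]
  simp [add_comm]

section Pullback

variable {n : ℕ} {M : Type*} [TopologicalSpace M] [ChartedSpace (Euc n) M]
  [IsManifold (𝓡 n) ∞ M]
variable {P V : Type*} [NormedAddCommGroup P] [NormedSpace ℝ P]
  [NormedAddCommGroup V] [NormedSpace ℝ V]

theorem fderiv_comp_param {h : M → V} {G : P → M} {p : P}
    (hh : MDifferentiableAt (𝓡 n) 𝓘(ℝ, V) h (G p)) (hG : MDifferentiableAt 𝓘(ℝ, P) (𝓡 n) G p)
    (a : P) :
    fderiv ℝ (h ∘ G) p a = mvfderiv (𝓡 n) h (G p) (mfderiv 𝓘(ℝ, P) (𝓡 n) G p a) := by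
  have h1 := mfderiv_comp p hh hG
  rw [mfderiv_eq_fderiv] at h1
  exact DFunLike.congr_fun h1 a

theorem contMDiffAt_extChartAt_symm (x : M) :
    ContMDiffAt 𝓘(ℝ, Euc n) (𝓡 n) ∞ (extChartAt (𝓡 n) x).symm (extChartAt (𝓡 n) x x) :=
  (contMDiffOn_extChartAt_symm x).contMDiffAt (extChartAt_target_mem_nhds x)

theorem mfderiv_extChartAt_symm_self (x : M) (v : Euc n) :
    mfderiv 𝓘(ℝ, Euc n) (𝓡 n) (extChartAt (𝓡 n) x).symm (extChartAt (𝓡 n) x x) v = v := by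
  have h := mfderivWithin_range_extChartAt_symm (I := 𝓡 n) (x := x)
  rw [ModelWithCorners.range_eq_univ, mfderivWithin_univ] at h
  exact DFunLike.congr_fun h v

theorem fderiv_comp_extChartAt_symm {h : M → V} {x : M}
    (hh : MDifferentiableAt (𝓡 n) 𝓘(ℝ, V) h x) (v : Euc n) :
    fderiv ℝ (h ∘ (extChartAt (𝓡 n) x).symm) (extChartAt (𝓡 n) x x) v =
      mvfderiv (𝓡 n) h x v := by
  have hx : (extChartAt (𝓡 n) x).symm (extChartAt (𝓡 n) x x) = x := extChartAt_to_inv x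
  have h1 := fderiv_comp_param (h := h) (G := (extChartAt (𝓡 n) x).symm)
    (p := extChartAt (𝓡 n) x x) (by rwa [hx])
    ((contMDiffAt_extChartAt_symm x).mdifferentiableAt (by simp)) v
  rw [h1, mfderiv_extChartAt_symm_self]
  congr 1
  rw [hx]

theorem contDiffAt_comp_extChartAt_symm {h : M → V} {x : M} {r : ℕ∞}
    (hh : ContMDiffAt (𝓡 n) 𝓘(ℝ, V) r h x) :
    ContDiffAt ℝ r (h ∘ (extChartAt (𝓡 n) x).symm) (extChartAt (𝓡 n) x x) := by
  rw [← contMDiffAt_iff_contDiffAt]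
  exact hh.comp_of_eq ((contMDiffAt_extChartAt_symm x).of_le (by exact_mod_cast le_top))
    (extChartAt_to_inv x)

variable {m : ℕ}

set_option linter.unusedSectionVars false in
theorem starProjection_normalSpace_mvfderiv (f : M → Euc m) (x : M) (v : TangentSpace (𝓡 n) x) :
    (normalSpace n f x).starProjection (mvfderiv (𝓡 n) f x v) = 0 := by
  rw [Submodule.starProjection_apply_eq_zero_iff]
  exact Submodule.le_orthogonal_orthogonal _ ⟨v, rfl⟩

/-- The second fundamental form in a parametrization. -/
theorem secondFundamentalForm_param {f : M → Euc m} {G : P → M} {p : P}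
    (hf : ContMDiffAt (𝓡 n) 𝓘(ℝ, Euc m) 2 f (G p)) (hG : ContMDiffAt 𝓘(ℝ, P) (𝓡 n) 2 G p)
    (a b : P) :
    secondFundamentalForm f (G p) (mfderiv 𝓘(ℝ, P) (𝓡 n) G p a) (mfderiv 𝓘(ℝ, P) (𝓡 n) G p b) =
      (normalSpace n f (G p)).starProjection (fderiv ℝ (fderiv ℝ (f ∘ G)) p a b) := by
  set φ := extChartAt (𝓡 n) (G p) with hφ
  have hφG : ContMDiffAt 𝓘(ℝ, P) 𝓘(ℝ, Euc n) 2 (φ ∘ G) p :=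
    (contMDiffAt_extChartAt (I := 𝓡 n)).comp p hG
  have hg : ContDiffAt ℝ 2 (φ ∘ G) p := contMDiffAt_iff_contDiffAt.1 hφG
  have hfφ : ContDiffAt ℝ 2 (f ∘ φ.symm) ((φ ∘ G) p) :=
    contDiffAt_comp_extChartAt_symm (r := 2) hf
  have heq : f ∘ G =ᶠ[𝓝 p] (f ∘ φ.symm) ∘ (φ ∘ G) := by
    have := hG.continuousAt.eventually (extChartAt_source_mem_nhds (I := 𝓡 n) (G p))
    filter_upwards [this] with q hq
    simp only [Function.comp_apply, hφ]
    rw [(extChartAt (𝓡 n) (G p)).left_inv hq]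
  have hd : ∀ c, fderiv ℝ (φ ∘ G) p c = mfderiv 𝓘(ℝ, P) (𝓡 n) G p c := fun c ↦ by
    have h1 := fderiv_comp_param (h := (φ : M → Euc n)) (G := G) (p := p)
      ((contMDiffAt_extChartAt (n := 2)).mdifferentiableAt (by simp))
      (hG.mdifferentiableAt (by simp)) c
    rw [h1, mvfderiv, mfderiv_extChartAt_self]
    rfl
  rw [heq.fderiv.fderiv_eq, fderiv_fderiv_comp hfφ hg, map_add]
  -- The first-order term of the second-order chain rule is tangent to f and disappears in the
  -- normal projection.
  have h0 : ∀ v : Euc n, (normalSpace n f (G p)).starProjection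
      (fderiv ℝ (f ∘ φ.symm) ((φ ∘ G) p) v) = 0 := fun v ↦ by
    have h2 := fderiv_comp_extChartAt_symm (h := f) (x := G p) (hf.mdifferentiableAt (by simp)) v
    rw [Function.comp_apply, hφ, h2]
    exact starProjection_normalSpace_mvfderiv f (G p) v
  rw [h0, add_zero, hd, hd]
  rfl

theorem normalDeriv_param {f ξ : M → Euc m} {G : P → M} {p : P}
    (hξ : MDifferentiableAt (𝓡 n) 𝓘(ℝ, Euc m) ξ (G p))
    (hG : MDifferentiableAt 𝓘(ℝ, P) (𝓡 n) G p) (a : P) :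
    normalDeriv f ξ (G p) (mfderiv 𝓘(ℝ, P) (𝓡 n) G p a) =
      (normalSpace n f (G p)).starProjection (fderiv ℝ (ξ ∘ G) p a) := by
  rw [fderiv_comp_param hξ hG, normalDeriv]

theorem normalSpace_param {f : M → Euc m} {G : P → M} {p : P}
    (hf : MDifferentiableAt (𝓡 n) 𝓘(ℝ, Euc m) f (G p))
    (hG : MDifferentiableAt 𝓘(ℝ, P) (𝓡 n) G p)
    (hs : Function.Surjective (mfderiv 𝓘(ℝ, P) (𝓡 n) G p)) :
    normalSpace n f (G p) = (fderiv ℝ (f ∘ G) p).rangeᗮ := by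
  rw [normalSpace]
  congr 1
  ext y
  constructor
  · rintro ⟨v, rfl⟩
    obtain ⟨a, rfl⟩ := hs v
    exact ⟨a, fderiv_comp_param hf hG a⟩
  · rintro ⟨a, rfl⟩
    exact ⟨_, (fderiv_comp_param hf hG a).symm⟩

theorem IsIsometricImmersionOn.contMDiffAt {g : SmoothMetric n M} {f : M → Euc m} {U : Set M}
    (hf : IsIsometricImmersionOn g f U) (hU : IsOpen U) {x : M} (hx : x ∈ U) :
    ContMDiffAt (𝓡 n) 𝓘(ℝ, Euc m) ∞ f x :=
  hf.smooth.contMDiffAt (hU.mem_nhds hx)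

theorem IsIsometricImmersionOn.injective {g : SmoothMetric n M} {f : M → Euc m} {U : Set M}
    (hf : IsIsometricImmersionOn g f U) {x : M} (hx : x ∈ U) :
    Function.Injective (mvfderiv (𝓡 n) f x) := by
  rw [injective_iff_map_eq_zero]
  intro v hv
  by_contra hne
  have h1 := hf.isometric x hx v v
  rw [hv, inner_zero_left] at h1
  exact (g.pos x v hne).ne h1

end Pullback

end RuledComposition

namespace RuledComposition

open Set Filter Topology

/-! ### Curves tangent to the distribution and its leaves -/

section Leaves

variable {n : ℕ} {M : Type*} [TopologicalSpace M] [ChartedSpace (Euc n) M]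
  [IsManifold (𝓡 n) ∞ M]

set_option linter.unusedSectionVars false

theorem IsSmoothFieldOn.mvfderiv_apply {V : Type*} [NormedAddCommGroup V] [NormedSpace ℝ V]
    {h : M → V} {U : Set M} (hU : IsOpen U) (hh : ContMDiffOn (𝓡 n) 𝓘(ℝ, V) ∞ h U)
    {Y : ∀ z : M, TangentSpace (𝓡 n) z} (hY : IsSmoothFieldOn Y U) :
    ContMDiffOn (𝓡 n) 𝓘(ℝ, V) ∞ (fun z ↦ mvfderiv (𝓡 n) h z (Y z)) U := by
  have h1 := hh.contMDiffOn_tangentMapWithin (m := ∞) (by simp) hU.uniqueMDiffOn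
  have h2 := (contMDiff_snd_tangentBundle_modelSpace V 𝓘(ℝ, V) (n := ∞)).comp_contMDiffOn
    (h1.comp hY fun z hz ↦ hz)
  refine h2.congr fun z hz ↦ ?_
  change mvfderiv (𝓡 n) h z (Y z) = mfderivWithin (𝓡 n) 𝓘(ℝ, V) h U z (Y z)
  rw [mfderivWithin_of_isOpen hU hz]
  rfl

/-- A smooth curve in `U` that is everywhere tangent to `D`. -/
def IsTangentCurve (D : TangentSubspaces n M) (U : Set M) (γ : ℝ → M) : Prop :=
  ContMDiff 𝓘(ℝ, ℝ) (𝓡 n) ∞ γ ∧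
    ∀ t : ℝ, γ t ∈ U ∧ mfderiv 𝓘(ℝ, ℝ) (𝓡 n) γ t (1 : ℝ) ∈ D (γ t)

theorem mfderiv_comp_real {γ : ℝ → M} {ψ : ℝ → ℝ} {t : ℝ}
    (hγ : MDifferentiableAt 𝓘(ℝ, ℝ) (𝓡 n) γ (ψ t)) (hψ : DifferentiableAt ℝ ψ t) :
    mfderiv 𝓘(ℝ, ℝ) (𝓡 n) (γ ∘ ψ) t (1 : ℝ) =
      deriv ψ t • (mfderiv 𝓘(ℝ, ℝ) (𝓡 n) γ (ψ t) (1 : ℝ) : Euc n) := by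
  have h1 := mfderiv_comp t hγ hψ.mdifferentiableAt
  rw [mfderiv_eq_fderiv] at h1
  have h2 := DFunLike.congr_fun h1 (1 : ℝ)
  refine h2.trans ?_
  have h3 : fderiv ℝ ψ t 1 = deriv ψ t • (1 : ℝ) := by simp
  have h4 : (mfderiv 𝓘(ℝ, ℝ) (𝓡 n) γ (ψ t)) (fderiv ℝ ψ t 1) =
      mfderiv 𝓘(ℝ, ℝ) (𝓡 n) γ (ψ t) (deriv ψ t • (1 : ℝ)) := by rw [h3]
  refine Eq.trans h4 ?_
  exact (mfderiv 𝓘(ℝ, ℝ) (𝓡 n) γ (ψ t)).map_smul (deriv ψ t) (1 : ℝ)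

/-- Reparametrizations of tangent curves defined on an open set of times. -/
theorem isTangentCurve_comp {D : TangentSubspaces n M} {U : Set M} {γ : ℝ → M} {I : Set ℝ}
    (hI : IsOpen I) (hγ : ContMDiffOn 𝓘(ℝ, ℝ) (𝓡 n) ∞ γ I)
    (hD : ∀ t ∈ I, γ t ∈ U ∧ mfderiv 𝓘(ℝ, ℝ) (𝓡 n) γ t (1 : ℝ) ∈ D (γ t))
    {ψ : ℝ → ℝ} (hψ : ContDiff ℝ ∞ ψ) (hψI : ∀ t, ψ t ∈ I) : IsTangentCurve D U (γ ∘ ψ) := by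
  refine ⟨fun t ↦ ((hγ.contMDiffAt (hI.mem_nhds (hψI t))).comp t hψ.contMDiff.contMDiffAt),
    fun t ↦ ⟨(hD _ (hψI t)).1, ?_⟩⟩
  rw [mfderiv_comp_real ((hγ.contMDiffAt (hI.mem_nhds (hψI t))).mdifferentiableAt (by simp))
    (hψ.differentiable (by simp) t)]
  exact (D (γ (ψ t))).smul_mem _ (hD _ (hψI t)).2

theorem IsTangentCurve.comp {D : TangentSubspaces n M} {U : Set M} {γ : ℝ → M}
    (hγ : IsTangentCurve D U γ) {ψ : ℝ → ℝ} (hψ : ContDiff ℝ ∞ ψ) :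
    IsTangentCurve D U (γ ∘ ψ) :=
  isTangentCurve_comp isOpen_univ hγ.1.contMDiffOn (fun t _ ↦ hγ.2 t) hψ fun _ ↦ mem_univ _

theorem IsTangentCurve.mem_leafOn {D : TangentSubspaces n M} {U : Set M} {γ : ℝ → M}
    (hγ : IsTangentCurve D U γ) (t : ℝ) : γ t ∈ leafOn D U (γ 0) := by
  have h := hγ.comp (ψ := fun s ↦ t * s) (contDiff_const.mul contDiff_id)
  exact ⟨_, h.1, by simp, by simp, h.2⟩

/-- The two curves are reparametrized by smooth transitions, so that both formulas are constant and
agree on the overlap (1/3, 2/3); this makes the concatenation smooth. -/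
theorem mem_leafOn_trans {D : TangentSubspaces n M} {U : Set M} {x y z : M}
    (hy : y ∈ leafOn D U x) (hz : z ∈ leafOn D U y) : z ∈ leafOn D U x := by
  obtain ⟨γ₁, hs₁, h₁0, h₁1, ht₁⟩ := hy
  obtain ⟨γ₂, hs₂, h₂0, h₂1, ht₂⟩ := hz
  have c₁ := IsTangentCurve.comp (γ := γ₁) ⟨hs₁, ht₁⟩ (ψ := fun t ↦ Real.smoothTransition (3 * t))
    (Real.smoothTransition.contDiff.comp (contDiff_const.mul contDiff_id))
  have c₂ := IsTangentCurve.comp (γ := γ₂) ⟨hs₂, ht₂⟩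
    (ψ := fun t ↦ Real.smoothTransition (3 * t - 2))
    (Real.smoothTransition.contDiff.comp ((contDiff_const.mul contDiff_id).sub contDiff_const))
  let γ : ℝ → M := fun t ↦ if t < 1 / 2 then γ₁ (Real.smoothTransition (3 * t)) else
    γ₂ (Real.smoothTransition (3 * t - 2))
  have e₁ : ∀ t < (2 / 3 : ℝ), γ t = γ₁ (Real.smoothTransition (3 * t)) := fun t ht ↦ by
    by_cases h : t < 1 / 2
    · simp only [γ, if_pos h]
    · simp only [γ, if_neg h]
      rw [Real.smoothTransition.one_of_one_le (by linarith : (1 : ℝ) ≤ 3 * t),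
        Real.smoothTransition.zero_of_nonpos (by linarith), h₁1, h₂0]
  have e₂ : ∀ t > (1 / 3 : ℝ), γ t = γ₂ (Real.smoothTransition (3 * t - 2)) := fun t ht ↦ by
    by_cases h : t < 1 / 2
    · simp only [γ, if_pos h]
      rw [Real.smoothTransition.one_of_one_le (by linarith : (1 : ℝ) ≤ 3 * t),
        Real.smoothTransition.zero_of_nonpos (by linarith), h₁1, h₂0]
    · simp only [γ, if_neg h]
  have hloc : ∀ t, ∃ η : ℝ → M, IsTangentCurve D U η ∧ γ =ᶠ[𝓝 t] η := fun t ↦ by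
    rcases lt_or_ge t (1 / 2) with h | h
    · refine ⟨_, c₁, ?_⟩
      filter_upwards [Iio_mem_nhds (show t < 2 / 3 by linarith)] with s hs using e₁ s hs
    · refine ⟨_, c₂, ?_⟩
      filter_upwards [Ioi_mem_nhds (show 1 / 3 < t by linarith)] with s hs using e₂ s hs
  refine ⟨γ, fun t ↦ ?_, ?_, ?_, fun t ↦ ?_⟩
  · obtain ⟨η, hη, he⟩ := hloc t
    exact hη.1.contMDiffAt.congr_of_eventuallyEq he
  · rw [e₁ 0 (by norm_num), mul_zero, Real.smoothTransition.zero, h₁0]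
  · rw [e₂ 1 (by norm_num), Real.smoothTransition.one_of_one_le (by norm_num), h₂1]
  · obtain ⟨η, hη, he⟩ := hloc t
    have h1 := hη.2 t
    rw [← he.eq_of_nhds] at h1
    refine ⟨h1.1, ?_⟩
    rw [he.mfderiv_eq]
    exact h1.2

/-- Difference quotients lie in the direction of S, which is closed because it is
finite-dimensional. -/
theorem mem_direction_of_hasDerivAt {E : Type*} [NormedAddCommGroup E] [InnerProductSpace ℝ E]
    [FiniteDimensional ℝ E] {S : AffineSubspace ℝ E} {u : ℝ → E} {u' : E} {t : ℝ}
    (hu : ∀ s, u s ∈ S) (h : HasDerivAt u u' t) : u' ∈ S.direction := by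
  have hc : IsClosed (S.direction : Set E) := S.direction.closed_of_finiteDimensional
  refine hc.mem_of_tendsto (hasDerivAt_iff_tendsto_slope.1 h) (Eventually.of_forall fun s ↦ ?_)
  rw [slope_def_module]
  exact S.direction.smul_mem _ (AffineSubspace.vsub_mem_direction (hu s) (hu t))

theorem IsSmoothDistributionOn.finrank_eq {D : TangentSubspaces n M} {d : ℕ} {U : Set M}
    (hD : IsSmoothDistributionOn D d U) {x : M} (hx : x ∈ U) : Module.finrank ℝ (D x) = d := by
  obtain ⟨V, -, hxV, -, Y, -, h⟩ := hD x hx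
  obtain ⟨hli, hsp⟩ := h x hxV
  rw [← hsp, finrank_span_eq_card hli, Fintype.card_fin]

/-- A smooth distribution is, in a chart, locally the image of a smooth family of injective linear
maps. -/
theorem IsSmoothDistributionOn.exists_frame_in_chart {D : TangentSubspaces n M} {d : ℕ}
    (hD : IsSmoothDistributionOn D d univ) (x : M) {O : Set M} (hO : IsOpen O) (hx : x ∈ O) :
    ∃ (Ω : Set (Euc n)) (B : Euc n → Euc d →L[ℝ] Euc n), IsOpen Ω ∧ extChartAt (𝓡 n) x x ∈ Ω ∧
      Ω ⊆ (extChartAt (𝓡 n) x).target ∧ (∀ y ∈ Ω, (extChartAt (𝓡 n) x).symm y ∈ O) ∧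
      ContDiffOn ℝ ∞ B Ω ∧ ∀ y ∈ Ω, Function.Injective (B y) ∧
        D ((extChartAt (𝓡 n) x).symm y) = (B y).range.map
          (mfderiv 𝓘(ℝ, Euc n) (𝓡 n) (extChartAt (𝓡 n) x).symm y).toLinearMap := by
  obtain ⟨V, hV, hxV, -, Y, hY, h⟩ := hD x (mem_univ x)
  set φ := extChartAt (𝓡 n) x with hφ
  have hopen : IsOpen (φ.target ∩ φ.symm ⁻¹' (V ∩ O)) :=
    (continuousOn_extChartAt_symm x).isOpen_inter_preimage (isOpen_extChartAt_target x)
      (hV.inter hO)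
  have hsymm : ContMDiffOn 𝓘(ℝ, Euc n) (𝓡 n) ∞ φ.symm φ.target := contMDiffOn_extChartAt_symm x
  have hYs : ∀ i, ContDiffOn ℝ ∞ (fieldInChart (Y i) x) (φ.target ∩ φ.symm ⁻¹' (V ∩ O)) := by
    intro i
    rw [← contMDiffOn_iff_contDiffOn]
    have h1 := IsSmoothFieldOn.mvfderiv_apply (h := (φ : M → Euc n)) (U := φ.source ∩ V)
      ((isOpen_extChartAt_source x).inter hV)
      ((contMDiffOn_extChartAt (I := 𝓡 n) (x := x)).mono (by
        rw [← extChartAt_source (𝓡 n)]; exact inter_subset_left))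
      (ContMDiffOn.mono (hY i) inter_subset_right)
    exact h1.comp (hsymm.mono inter_subset_left) fun y hy ↦ ⟨φ.map_target hy.1, hy.2.1⟩
  let B : Euc n → Euc d →L[ℝ] Euc n := fun y ↦
    ∑ i, (EuclideanSpace.proj i : Euc d →L[ℝ] ℝ).smulRight (fieldInChart (Y i) x y)
  have hBv : ∀ y a, B y a = ∑ i, a i • fieldInChart (Y i) x y := fun y a ↦ by
    simp [B]
  have hback : ∀ y ∈ φ.target, ∀ v : TangentSpace (𝓡 n) (φ.symm y),
      mfderiv 𝓘(ℝ, Euc n) (𝓡 n) φ.symm y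
        (mfderiv (𝓡 n) 𝓘(ℝ, Euc n) φ (φ.symm y) v) = v := by
    intro y hy v
    have h1 := mfderivWithin_extChartAt_symm_comp_mfderiv_extChartAt (I := 𝓡 n) hy
    rw [ModelWithCorners.range_eq_univ, mfderivWithin_univ] at h1
    exact DFunLike.congr_fun h1 v
  have happly : ∀ y ∈ φ.target, ∀ a, mfderiv 𝓘(ℝ, Euc n) (𝓡 n) φ.symm y (B y a) =
      ∑ i, a i • Y i (φ.symm y) := by
    intro y hy a
    have h2 : mfderiv 𝓘(ℝ, Euc n) (𝓡 n) φ.symm y (B y a) =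
      mfderiv 𝓘(ℝ, Euc n) (𝓡 n) φ.symm y (∑ i, a i • fieldInChart (Y i) x y) := by rw [hBv]; rfl
    refine h2.trans ?_
    refine (map_sum (mfderiv 𝓘(ℝ, Euc n) (𝓡 n) φ.symm y) _ _).trans
      (Finset.sum_congr rfl fun i _ ↦ ?_)
    refine ((mfderiv 𝓘(ℝ, Euc n) (𝓡 n) φ.symm y).map_smul _ _).trans ?_
    congr 1
    exact hback y hy _
  refine ⟨φ.target ∩ φ.symm ⁻¹' (V ∩ O), B, hopen, ⟨mem_extChartAt_target x, ?_⟩,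
    inter_subset_left, fun y hy ↦ hy.2.2, ?_, fun y hy ↦ ⟨?_, ?_⟩⟩
  · rw [mem_preimage, hφ, extChartAt_to_inv]
    exact ⟨hxV, hx⟩
  · exact ContDiffOn.sum fun i _ ↦ contDiffOn_const.smulRight (hYs i)
  · rw [injective_iff_map_eq_zero]
    intro a ha
    have h1 := happly y hy.1 a
    rw [ha] at h1
    have h2 : ∑ i, a i • Y i (φ.symm y) = 0 :=
      h1.symm.trans (map_zero (mfderiv 𝓘(ℝ, Euc n) (𝓡 n) φ.symm y))
    have h3 := Fintype.linearIndependent_iff.1 (h _ hy.2.1).1 _ h2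
    ext i
    exact h3 i
  · rw [← (h _ hy.2.1).2]
    apply le_antisymm
    · rw [Submodule.span_le]
      rintro _ ⟨i, rfl⟩
      refine ⟨B y (EuclideanSpace.single i 1), ⟨_, rfl⟩, ?_⟩
      refine (happly y hy.1 _).trans ?_
      simp
    · rintro _ ⟨_, ⟨a, rfl⟩, rfl⟩
      have := happly y hy.1 a
      refine Eq.mpr (congrArg (· ∈ _) this) ?_
      exact Submodule.sum_mem _ fun i _ ↦
        Submodule.smul_mem _ _ (Submodule.subset_span ⟨i, rfl⟩)

end Leaves

end RuledComposition

namespace RuledComposition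

open Set Filter Topology

/-! ### Constancy of the tangent spaces of the rulings -/

section Boxes

variable {n : ℕ} {M : Type*} [TopologicalSpace M] [ChartedSpace (Euc n) M]
  [IsManifold (𝓡 n) ∞ M]

theorem tangent_of_chart {D : TangentSubspaces n M} {d : ℕ} {x : M} {Ω : Set (Euc n)}
    {B : Euc n → Euc d →L[ℝ] Euc n} (hΩ : Ω ⊆ (extChartAt (𝓡 n) x).target)
    (hB : ∀ y ∈ Ω, D ((extChartAt (𝓡 n) x).symm y) = (B y).range.map
      (mfderiv 𝓘(ℝ, Euc n) (𝓡 n) (extChartAt (𝓡 n) x).symm y).toLinearMap)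
    {α : ℝ → Euc n} {I : Set ℝ} (hI : IsOpen I) (hα : ContDiffOn ℝ ∞ α I)
    (hαΩ : ∀ t ∈ I, α t ∈ Ω) (hα' : ∀ t ∈ I, deriv α t ∈ (B (α t)).range) :
    ContMDiffOn 𝓘(ℝ, ℝ) (𝓡 n) ∞ ((extChartAt (𝓡 n) x).symm ∘ α) I ∧
    ∀ t ∈ I, ((extChartAt (𝓡 n) x).symm ∘ α) t ∈ univ ∧
      mfderiv 𝓘(ℝ, ℝ) (𝓡 n) ((extChartAt (𝓡 n) x).symm ∘ α) t (1 : ℝ) ∈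
        D (((extChartAt (𝓡 n) x).symm ∘ α) t) := by
  have hsymm : ContMDiffOn 𝓘(ℝ, Euc n) (𝓡 n) ∞ (extChartAt (𝓡 n) x).symm
    (extChartAt (𝓡 n) x).target := contMDiffOn_extChartAt_symm x
  refine ⟨hsymm.comp hα.contMDiffOn fun t ht ↦ hΩ (hαΩ t ht), fun t ht ↦ ⟨mem_univ _, ?_⟩⟩
  have h1 : MDifferentiableAt 𝓘(ℝ, Euc n) (𝓡 n) (extChartAt (𝓡 n) x).symm (α t) :=
    (hsymm.contMDiffAt ((isOpen_extChartAt_target x).mem_nhds (hΩ (hαΩ t ht)))).mdifferentiableAt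
      (by simp)
  have h2 : DifferentiableAt ℝ α t := (hα.differentiableOn (by simp)).differentiableAt
    (hI.mem_nhds ht)
  have h3 := mfderiv_comp t h1 h2.mdifferentiableAt
  rw [mfderiv_eq_fderiv] at h3
  have h4 := DFunLike.congr_fun h3 (1 : ℝ)
  rw [Function.comp_apply, hB _ (hαΩ t ht)]
  exact ⟨deriv α t, hα' t ht, h4.symm⟩

/-- Curves in the definition of a leaf are defined on all of ℝ, whereas an integral curve exists
only on (-ε, ε). Reparametrizing by (ε/2) sin t keeps it in that interval, and multiplies the
initial velocity by r = ε/2. -/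
theorem IsSmoothDistributionOn.exists_tangentCurve {D : TangentSubspaces n M} {d : ℕ}
    (hD : IsSmoothDistributionOn D d univ) (x : M) {v : TangentSpace (𝓡 n) x} (hv : v ∈ D x) :
    ∃ (γ : ℝ → M) (r : ℝ), IsTangentCurve D univ γ ∧ γ 0 = x ∧ r ≠ 0 ∧
      mfderiv 𝓘(ℝ, ℝ) (𝓡 n) γ 0 (1 : ℝ) = r • (v : Euc n) := by
  obtain ⟨Ω, B, hΩ, hx, hΩt, -, hB, hBD⟩ := hD.exists_frame_in_chart x isOpen_univ (mem_univ x)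
  set φ := extChartAt (𝓡 n) x with hφ
  have hsx : φ.symm (φ x) = x := extChartAt_to_inv x
  obtain ⟨a, ha⟩ : ∃ a, B (φ x) a = (v : Euc n) := by
    have h1 := (hBD _ hx).2
    rw [hsx] at h1
    rw [h1] at hv
    obtain ⟨_, ⟨a, rfl⟩, hw⟩ := hv
    exact ⟨a, (mfderiv_extChartAt_symm_self x (B (φ x) a)).symm.trans hw⟩
  obtain ⟨r, hr, ε, hε, h⟩ := exists_integral_curves hΩ
    (hB.clm_apply (contDiffOn_const (c := a))) hx
  obtain ⟨α, hα0, hαs, hα⟩ := h (φ x) (Metric.mem_ball_self hr)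
  obtain ⟨hs, ht⟩ := tangent_of_chart (D := D) hΩt (fun y hy ↦ (hBD y hy).2) isOpen_Ioo hαs
    (fun t ht ↦ (hα t ht).1) (fun t ht ↦ by rw [(hα t ht).2.deriv]; exact ⟨a, rfl⟩)
  have hψ : ∀ t, ε / 2 * Real.sin t ∈ Ioo (-ε) ε := fun t ↦ by
    have h1 := Real.sin_le_one t
    have h2 := Real.neg_one_le_sin t
    constructor <;> nlinarith
  have h0 : (0 : ℝ) ∈ Ioo (-ε) ε := ⟨by linarith, by linarith⟩
  refine ⟨_, ε / 2, isTangentCurve_comp isOpen_Ioo hs ht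
    (ψ := fun t ↦ ε / 2 * Real.sin t) (contDiff_const.mul Real.contDiff_sin) hψ, ?_, by positivity,
    ?_⟩
  · change φ.symm (α (ε / 2 * Real.sin 0)) = x
    rw [Real.sin_zero, mul_zero, hα0, hsx]
  · have hz : ε / 2 * Real.sin 0 = 0 := by simp
    have hd0 : MDifferentiableAt 𝓘(ℝ, ℝ) (𝓡 n) (φ.symm ∘ α) 0 :=
      (hs.contMDiffAt (isOpen_Ioo.mem_nhds h0)).mdifferentiableAt (by simp)
    have hψd : HasDerivAt (fun t ↦ ε / 2 * Real.sin t) (ε / 2) 0 := by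
      simpa using (Real.hasDerivAt_sin 0).const_mul (ε / 2)
    rw [mfderiv_comp_real (by rwa [hz]) hψd.differentiableAt, hψd.deriv]
    congr 1
    have h3 := mfderiv_comp (0 : ℝ) (I := 𝓘(ℝ, ℝ)) (I' := 𝓘(ℝ, Euc n)) (I'' := 𝓡 n) (f := α)
      (g := φ.symm) (by
        rw [hα0]; exact (contMDiffAt_extChartAt_symm x).mdifferentiableAt (by simp))
      ((hα 0 h0).2.differentiableAt.mdifferentiableAt)
    rw [mfderiv_eq_fderiv, hα0] at h3
    have h4 := DFunLike.congr_fun h3 (1 : ℝ)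
    rw [hz]
    refine h4.trans ?_
    refine (mfderiv_extChartAt_symm_self x _).trans ?_
    have h5 : fderiv ℝ α 0 1 = B (φ x) a := by
      have := (hα 0 h0).2
      rw [hα0] at this
      simpa using this.deriv
    exact h5.trans ha

variable {m d : ℕ} {g : SmoothMetric n M} {D : TangentSubspaces n M} {f : M → Euc m}

/-- The images of the tangent spaces of a ruling are constant along the leaf. -/
theorem IsRuledOn.map_eq_of_mem_leafOn (hf : IsIsometricImmersionOn g f univ)
    (hD : IsRuledOn g D d f univ) {x y : M} (hy : y ∈ leafOn D univ x) :
    (D y).map (mvfderiv (𝓡 n) f y).toLinearMap = (D x).map (mvfderiv (𝓡 n) f x).toLinearMap := by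
  obtain ⟨S, hS, O, -, hO⟩ := hD.ruled x (mem_univ x)
  -- Tangent curves starting at a point of the leaf stay in the leaf, hence their images stay in S
  -- and have velocities in its direction. The dimensions agree, so this inclusion is an equality.
  have key : ∀ z ∈ leafOn D univ x,
      (D z).map (mvfderiv (𝓡 n) f z).toLinearMap = S.direction := by
    intro z hz
    apply Submodule.eq_of_le_of_finrank_eq
    · rintro _ ⟨v, hv, rfl⟩
      obtain ⟨γ, r, hγ, rfl, hr, hγ'⟩ := hD.smooth.exists_tangentCurve z hv
      have hfγ : ∀ t, (f ∘ γ) t ∈ S := fun t ↦ by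
        have h1 : f (γ t) ∈ f '' leafOn D univ x := ⟨_, mem_leafOn_trans hz (hγ.mem_leafOn t), rfl⟩
        rw [hO] at h1
        exact h1.2
      have hfm : MDifferentiableAt (𝓡 n) 𝓘(ℝ, Euc m) f (γ 0) :=
        (hf.contMDiffAt isOpen_univ (mem_univ _)).mdifferentiableAt (by simp)
      have hγm : MDifferentiableAt 𝓘(ℝ, ℝ) (𝓡 n) γ 0 := hγ.1.contMDiffAt.mdifferentiableAt (by simp)
      have h2 := fderiv_comp_param hfm hγm (1 : ℝ)
      have h3 : DifferentiableAt ℝ (f ∘ γ) 0 :=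
        mdifferentiableAt_iff_differentiableAt.1 (hfm.comp 0 hγm)
      have h4 := mem_direction_of_hasDerivAt hfγ h3.hasDerivAt
      rw [← fderiv_apply_one_eq_deriv, h2] at h4
      have h5 : mvfderiv (𝓡 n) f (γ 0) (mfderiv 𝓘(ℝ, ℝ) (𝓡 n) γ 0 (1 : ℝ)) =
          r • mvfderiv (𝓡 n) f (γ 0) v :=
        (congrArg (mvfderiv (𝓡 n) f (γ 0)) hγ').trans ((mvfderiv (𝓡 n) f (γ 0)).map_smul r v)
      rw [h5] at h4
      exact (Submodule.smul_mem_iff _ hr).1 h4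
    · rw [hS]
      refine (LinearEquiv.finrank_eq (Submodule.equivMapOfInjective _
        (hf.injective (mem_univ z)) (D z))).symm.trans ?_
      exact hD.smooth.finrank_eq (mem_univ z)
  rw [key y hy, key x]
  obtain ⟨γ, hγ, h0, -, hγD⟩ := hy
  have h1 := IsTangentCurve.mem_leafOn (γ := γ) ⟨hγ, hγD⟩ 0
  rwa [h0] at h1

/-- A parametrization `G` of an open subset of `M`, with inverse `κ`, for which `D` is spanned by
the last `d` coordinate directions and the immersion is affine along them. -/
structure IsRuledBox (D : TangentSubspaces n M) (f : M → Euc m) (J : Set ℝ) (B : Set (Euc d))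
    (G : ℝ × Euc d → M) (κ : M → ℝ × Euc d) (c : ℝ → Euc m) (W : ℝ → Euc d →L[ℝ] Euc m) :
    Prop where
  isOpen_time : IsOpen J
  convex_time : Convex ℝ J
  isOpen_space : IsOpen B
  convex_space : Convex ℝ B
  smooth_param : ContMDiffOn 𝓘(ℝ, ℝ × Euc d) (𝓡 n) ∞ G (J ×ˢ B)
  isOpen_image : IsOpen (G '' (J ×ˢ B))
  smooth_inv : ContMDiffOn (𝓡 n) 𝓘(ℝ, ℝ × Euc d) ∞ κ (G '' (J ×ˢ B))
  left_inv : ∀ p ∈ J ×ˢ B, κ (G p) = p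
  distribution : ∀ p ∈ J ×ˢ B, ∀ v : TangentSpace (𝓡 n) (G p),
    v ∈ D (G p) ↔ ∃ s : Euc d, mfderiv 𝓘(ℝ, ℝ × Euc d) (𝓡 n) G p ((0 : ℝ), s) = v
  smooth_base : ContDiffOn ℝ ∞ c J
  smooth_ruling : ContDiffOn ℝ ∞ W J
  ruled : ∀ p ∈ J ×ˢ B, f (G p) = c p.1 + W p.1 p.2

/-- Smooth local left inverses of immersions. -/
theorem exists_smooth_left_inverse {E F : Type*} [NormedAddCommGroup E] [InnerProductSpace ℝ E]
    [FiniteDimensional ℝ E] [NormedAddCommGroup F] [InnerProductSpace ℝ F] [CompleteSpace F]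
    {f : E → F} {Ω : Set E} (hΩ : IsOpen Ω) (hf : ContDiffOn ℝ ∞ f Ω) {x : E} (hx : x ∈ Ω)
    (hi : Function.Injective (fderiv ℝ f x)) :
    ∃ (Ω' : Set E) (Z : Set F) (ρ : F → E), IsOpen Ω' ∧ x ∈ Ω' ∧ Ω' ⊆ Ω ∧ IsOpen Z ∧
      ContDiffOn ℝ ∞ ρ Z ∧ ∀ y ∈ Ω', f y ∈ Z ∧ ρ (f y) = y := by
  -- Composing f with a left inverse of its derivative at x gives a map with derivative the
  -- identity, to which the inverse function theorem applies.
  have h1 : HasFDerivAt ((leftInv (fderiv ℝ f x)) ∘ f)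
      ((ContinuousLinearEquiv.refl ℝ E : E ≃L[ℝ] E) : E →L[ℝ] E) x := by
    have h2 := (leftInv (fderiv ℝ f x)).hasFDerivAt.comp x
      ((hf.differentiableOn (by simp)).differentiableAt (hΩ.mem_nhds hx)).hasFDerivAt
    convert h2
    ext v
    simp [leftInv_apply hi]
  obtain ⟨e, he, hes, hec, hesymm⟩ := exists_smooth_local_inverse hΩ
    ((leftInv (fderiv ℝ f x)).contDiff.comp_contDiffOn hf) hx _ h1
  refine ⟨e.source, leftInv (fderiv ℝ f x) ⁻¹' e.target, e.symm ∘ leftInv (fderiv ℝ f x),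
    e.open_source, he, hes, e.open_target.preimage (leftInv (fderiv ℝ f x)).continuous,
    hesymm.comp (leftInv (fderiv ℝ f x)).contDiff.contDiffOn fun y hy ↦ hy, fun y hy ↦ ?_⟩
  have h3 : e y = leftInv (fderiv ℝ f x) (f y) := by rw [hec]; rfl
  constructor
  · rw [mem_preimage, ← h3]
    exact e.map_source hy
  · rw [Function.comp_apply, ← h3, e.left_inv hy]

end Boxes

end RuledComposition

namespace RuledComposition

open Set Filter Topology

/-! ### Existence of ruled boxes -/

section BoxExistence

variable {n : ℕ} {M : Type*} [TopologicalSpace M] [ChartedSpace (Euc n) M]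
  [IsManifold (𝓡 n) ∞ M]
variable {m d : ℕ} {g : SmoothMetric n M} {D : TangentSubspaces n M} {f : M → Euc m}

/-- The local frame `A` of the image of the ruling in a chart. -/
noncomputable def rulingFrame (f : M → Euc m) (x : M) (B : Euc n → Euc d →L[ℝ] Euc n)
    (y : Euc n) : Euc d →L[ℝ] Euc m :=
  (fderiv ℝ (f ∘ (extChartAt (𝓡 n) x).symm) y).comp (B y)

theorem fderiv_chart {x : M} (hf : IsIsometricImmersionOn g f univ) {y : Euc n}
    (hy : y ∈ (extChartAt (𝓡 n) x).target) (v : Euc n) :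
    fderiv ℝ (f ∘ (extChartAt (𝓡 n) x).symm) y v =
      mvfderiv (𝓡 n) f ((extChartAt (𝓡 n) x).symm y)
        (mfderiv 𝓘(ℝ, Euc n) (𝓡 n) (extChartAt (𝓡 n) x).symm y v) :=
  fderiv_comp_param ((hf.contMDiffAt isOpen_univ (mem_univ _)).mdifferentiableAt (by simp))
    (((contMDiffOn_extChartAt_symm (n := ∞) x).contMDiffAt
      ((isOpen_extChartAt_target x).mem_nhds hy)).mdifferentiableAt (by simp)) v

theorem fderiv_chart_injective {x : M} (hf : IsIsometricImmersionOn g f univ) {y : Euc n}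
    (hy : y ∈ (extChartAt (𝓡 n) x).target) :
    Function.Injective (fderiv ℝ (f ∘ (extChartAt (𝓡 n) x).symm) y) := by
  have h1 := isInvertible_mfderivWithin_extChartAt_symm (I := 𝓡 n) hy
  rw [ModelWithCorners.range_eq_univ, mfderivWithin_univ] at h1
  intro v w hvw
  rw [fderiv_chart hf hy, fderiv_chart hf hy] at hvw
  exact h1.injective (hf.injective (mem_univ _) hvw)

theorem contDiffOn_chart {x : M} (hf : IsIsometricImmersionOn g f univ) :
    ContDiffOn ℝ ∞ (f ∘ (extChartAt (𝓡 n) x).symm) (extChartAt (𝓡 n) x).target :=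
  contMDiffOn_iff_contDiffOn.1 (hf.smooth.comp (contMDiffOn_extChartAt_symm x)
    fun _ _ ↦ mem_univ _)

/-- Near a point, the images of the leaves contain balls of uniform radius. -/
theorem IsRuledOn.exists_plaques (hf : IsIsometricImmersionOn g f univ)
    (hD : IsRuledOn g D d f univ) {x : M} {Ω : Set (Euc n)} (hΩ : IsOpen Ω)
    {B : Euc n → Euc d →L[ℝ] Euc n} (hΩt : Ω ⊆ (extChartAt (𝓡 n) x).target)
    (hB : ContDiffOn ℝ ∞ B Ω) (hBD : ∀ y ∈ Ω, Function.Injective (B y) ∧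
      D ((extChartAt (𝓡 n) x).symm y) = (B y).range.map
        (mfderiv 𝓘(ℝ, Euc n) (𝓡 n) (extChartAt (𝓡 n) x).symm y).toLinearMap)
    {y₀ : Euc n} (hy₀ : y₀ ∈ Ω) :
    ∃ r > (0 : ℝ), ∀ y ∈ Metric.ball y₀ r, ∀ w ∈ (rulingFrame f x B y).range, ‖w‖ < r →
      ∃ y' ∈ Ω, f ((extChartAt (𝓡 n) x).symm y') = f ((extChartAt (𝓡 n) x).symm y) + w ∧
        (rulingFrame f x B y').range = (rulingFrame f x B y).range := by
  set φ := extChartAt (𝓡 n) x with hφ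
  set A := rulingFrame f x B with hA
  have hfφ : ContDiffOn ℝ ∞ (f ∘ φ.symm) Ω := (contDiffOn_chart hf).mono hΩt
  have hAs : ContDiffOn ℝ ∞ A Ω := (hfφ.fderiv_of_isOpen hΩ (by simp)).clm_comp hB
  have hAi : ∀ y ∈ Ω, Function.Injective (A y) := fun y hy ↦
    (fderiv_chart_injective hf (hΩt hy)).comp (hBD y hy).1
  have hAr : ∀ y ∈ Ω, (A y).range =
      (D (φ.symm y)).map (mvfderiv (𝓡 n) f (φ.symm y)).toLinearMap := by
    intro y hy
    rw [(hBD y hy).2]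
    ext z
    constructor
    · rintro ⟨a, rfl⟩
      exact ⟨_, ⟨B y a, ⟨a, rfl⟩, rfl⟩, (fderiv_chart hf (hΩt hy) (B y a)).symm⟩
    · rintro ⟨_, ⟨_, ⟨a, rfl⟩, rfl⟩, rfl⟩
      exact ⟨a, fderiv_chart hf (hΩt hy) (B y a)⟩
  -- The field lifts a vector w tangent to the image of the leaf to the chart, with w carried along
  -- as a constant second component. One local existence theorem then covers all base points and all
  -- directions with a uniform time.
  let v : Euc n × Euc m → Euc n × Euc m := fun p ↦ (B p.1 (leftInv (A p.1) p.2), 0)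
  have hΩ' : IsOpen (Ω ×ˢ (univ : Set (Euc m))) := hΩ.prod isOpen_univ
  have hfst : ContDiffOn ℝ ∞ (fun p : Euc n × Euc m ↦ p.1) (Ω ×ˢ univ) := contDiffOn_fst
  have hv : ContDiffOn ℝ ∞ v (Ω ×ˢ univ) :=
    ((hB.comp hfst fun p hp ↦ hp.1).clm_apply
      (((ContDiffOn.leftInv hAs hAi).comp hfst fun p hp ↦ hp.1).clm_apply
        contDiffOn_snd)).prodMk contDiffOn_const
  obtain ⟨r, hr, ε, hε, h⟩ := exists_integral_curves hΩ' hv (x₀ := (y₀, 0)) ⟨hy₀, mem_univ _⟩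
  refine ⟨min r (r * (ε / 2)), by positivity, fun y hy w hw hwr ↦ ?_⟩
  have hyr : y ∈ Metric.ball y₀ r := Metric.ball_subset_ball (min_le_left _ _) hy
  -- Moving with velocity w' for the time ε/2 produces the displacement w.
  set w' := (ε / 2)⁻¹ • w with hw'
  have hw'A : w' ∈ (A y).range := Submodule.smul_mem _ _ hw
  have hmem : (y, w') ∈ Metric.ball ((y₀, 0) : Euc n × Euc m) r := by
    rw [← ball_prod_same]
    refine ⟨hyr, ?_⟩
    rw [mem_ball_zero_iff, hw', norm_smul, Real.norm_eq_abs, abs_of_pos (by positivity),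
      inv_mul_lt_iff₀ (by positivity), mul_comm]
    exact lt_of_lt_of_le hwr (min_le_right _ _)
  obtain ⟨α, hα0, hαs, hα⟩ := h _ hmem
  have h0 : (0 : ℝ) ∈ Ioo (-ε) ε := ⟨by linarith, by linarith⟩
  have hd1 : ∀ t ∈ Ioo (-ε) ε, HasDerivAt (fun t ↦ (α t).1)
      (B (α t).1 (leftInv (A (α t).1) (α t).2)) t := fun t ht ↦
    (ContinuousLinearMap.fst ℝ (Euc n) (Euc m)).hasFDerivAt.comp_hasDerivAt t (hα t ht).2
  have hd2 : ∀ t ∈ Ioo (-ε) ε, HasDerivAt (fun t ↦ (α t).2) 0 t := fun t ht ↦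
    (ContinuousLinearMap.snd ℝ (Euc n) (Euc m)).hasFDerivAt.comp_hasDerivAt t (hα t ht).2
  have hsnd : ∀ t ∈ Ioo (-ε) ε, (α t).2 = w' := fun t ht ↦ by
    have := eq_of_hasFDerivAt_zero isOpen_Ioo (convex_Ioo _ _)
      (fun s hs ↦ by simpa using (hd2 s hs).hasFDerivAt) ht h0
    rw [this, hα0]
  have hα1 : ContDiffOn ℝ ∞ (fun t ↦ (α t).1) (Ioo (-ε) ε) := contDiff_fst.comp_contDiffOn hαs
  obtain ⟨hs, ht⟩ := tangent_of_chart (D := D) hΩt (fun y hy ↦ (hBD y hy).2) isOpen_Ioo hα1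
    (fun t ht ↦ (hα t ht).1.1) (fun t ht ↦ by rw [(hd1 t ht).deriv]; exact ⟨_, rfl⟩)
  have hy1 : (α 0).1 = y := by rw [hα0]
  -- The integral curve stays in one leaf, along which the image of the ruling is constant; the
  -- smooth transition only extends the curve to all of ℝ.
  have hran : ∀ t ∈ Ioo (-ε) ε, (A (α t).1).range = (A y).range := fun t htI ↦ by
    have hc := isTangentCurve_comp isOpen_Ioo hs ht
      (ψ := fun s ↦ t * Real.smoothTransition s)
      (contDiff_const.mul Real.smoothTransition.contDiff) (fun s ↦ by
        have h1 := Real.smoothTransition.nonneg s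
        have h2 := Real.smoothTransition.le_one s
        constructor <;> nlinarith [htI.1, htI.2])
    have hl := hc.mem_leafOn 1
    have e1 : ((φ.symm ∘ fun t ↦ (α t).1) ∘ fun s ↦ t * Real.smoothTransition s) 1 =
        φ.symm (α t).1 := by simp
    have e0 : ((φ.symm ∘ fun t ↦ (α t).1) ∘ fun s ↦ t * Real.smoothTransition s) 0 =
        φ.symm y := by
      change φ.symm (α (t * Real.smoothTransition 0)).1 = φ.symm y
      rw [Real.smoothTransition.zero, mul_zero, hy1]
    rw [← hφ, e1, e0] at hl
    have hyΩ : y ∈ Ω := by rw [← hy1]; exact (hα 0 h0).1.1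
    rw [hAr _ (hα t htI).1.1, hAr y hyΩ]
    exact hD.map_eq_of_mem_leafOn hf hl
  -- Since w' stays in the image of the ruling, its lift is exact: f moves along the curve with
  -- constant velocity w', that is, on a straight line.
  have hfd : ∀ t ∈ Ioo (-ε) ε, HasDerivAt (fun t ↦ f (φ.symm (α t).1) - t • w') 0 t := fun t ht ↦ by
    have h1 : HasFDerivAt (f ∘ φ.symm) (fderiv ℝ (f ∘ φ.symm) (α t).1) (α t).1 :=
      ((hfφ.differentiableOn (by simp)).differentiableAt
        (hΩ.mem_nhds (hα t ht).1.1)).hasFDerivAt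
    have h2 := h1.comp_hasDerivAt t (hd1 t ht)
    have h3 : fderiv ℝ (f ∘ φ.symm) (α t).1 (B (α t).1 (leftInv (A (α t).1) (α t).2)) = w' := by
      have hw'' : w' ∈ (A (α t).1).range := by rw [hran t ht]; exact hw'A
      obtain ⟨a, ha⟩ := hw''
      have ha' : A (α t).1 a = w' := ha
      rw [hsnd t ht, ← ha', leftInv_apply (hAi _ (hα t ht).1.1)]
      rfl
    rw [h3] at h2
    have h4 := h2.sub ((hasDerivAt_id' t).smul_const w')
    rw [one_smul, sub_self] at h4
    exact h4
  have ht2 : ε / 2 ∈ Ioo (-ε) ε := ⟨by linarith, by linarith⟩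
  refine ⟨(α (ε / 2)).1, (hα _ ht2).1.1, ?_, hran _ ht2⟩
  have hconst := eq_of_hasFDerivAt_zero isOpen_Ioo (convex_Ioo _ _)
      (fun s hs ↦ by simpa using (hfd s hs).hasFDerivAt) ht2 h0
  simp only [hy1, zero_smul, sub_zero] at hconst
  rw [← hconst, hw', smul_smul, mul_inv_cancel₀ (by positivity), one_smul, sub_add_cancel]

/-- Every point has arbitrarily small ruled boxes. -/
theorem IsRuledOn.exists_box (hn : d + 1 = n) (hf : IsIsometricImmersionOn g f univ)
    (hD : IsRuledOn g D d f univ) (x : M) {U : Set M} (hU : IsOpen U) (hx : x ∈ U) :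
    ∃ (J : Set ℝ) (B : Set (Euc d)) (G : ℝ × Euc d → M) (κ : M → ℝ × Euc d) (c : ℝ → Euc m)
      (W : ℝ → Euc d →L[ℝ] Euc m), IsRuledBox D f J B G κ c W ∧ (0 : ℝ) ∈ J ∧ (0 : Euc d) ∈ B ∧
      G 0 = x ∧ G '' (J ×ˢ B) ⊆ U := by
  obtain ⟨Ω₀, B, hΩ₀, hx₀, hΩ₀t, hΩ₀U, hB₀, hBD₀⟩ := hD.smooth.exists_frame_in_chart x hU hx
  set φ := extChartAt (𝓡 n) x with hφ
  have hfφ₀ : ContDiffOn ℝ ∞ (f ∘ φ.symm) Ω₀ := (contDiffOn_chart hf).mono hΩ₀t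
  obtain ⟨Ω, Z, ρ, hΩ, hx₁, hΩsub, hZ, hρ, hρf⟩ := exists_smooth_left_inverse hΩ₀ hfφ₀ hx₀
    (fderiv_chart_injective hf (hΩ₀t hx₀))
  have hfφ := hfφ₀.mono hΩsub
  have hΩt := hΩsub.trans hΩ₀t
  have hB := hB₀.mono hΩsub
  have hBD : ∀ y ∈ Ω, _ := fun y hy ↦ hBD₀ y (hΩsub hy)
  set A := rulingFrame f x B with hA
  have hAs : ContDiffOn ℝ ∞ A Ω := (hfφ.fderiv_of_isOpen hΩ (by simp)).clm_comp hB
  have hAr : ∀ y ∈ Ω, (A y).range =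
      (D (φ.symm y)).map (mvfderiv (𝓡 n) f (φ.symm y)).toLinearMap := by
    intro y hy
    rw [(hBD y hy).2]
    ext z
    constructor
    · rintro ⟨a, rfl⟩
      exact ⟨_, ⟨B y a, ⟨a, rfl⟩, rfl⟩, (fderiv_chart hf (hΩt hy) (B y a)).symm⟩
    · rintro ⟨_, ⟨_, ⟨a, rfl⟩, rfl⟩, rfl⟩
      exact ⟨a, fderiv_chart hf (hΩt hy) (B y a)⟩
  obtain ⟨r, hr, hpl⟩ := hD.exists_plaques hf hΩ hΩt hB hBD hx₁
  -- A direction in the chart transversal to D, available because d < n; the base curve c is the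
  -- image of the line through x in this direction.
  obtain ⟨ν, hν⟩ : ∃ ν, ν ∉ (B (φ x)).range := by
    by_contra! hall
    have htop : (B (φ x)).range = ⊤ := Submodule.eq_top_iff'.2 hall
    have h1 := LinearMap.finrank_range_le (B (φ x)).toLinearMap
    rw [show LinearMap.range (B (φ x)).toLinearMap = ⊤ from htop, finrank_top,
      finrank_euclideanSpace, finrank_euclideanSpace, Fintype.card_fin, Fintype.card_fin] at h1
    omega
  let l : ℝ → Euc n := fun t ↦ φ x + t • ν
  have hl : ContDiff ℝ ∞ l := contDiff_const.add (contDiff_id.smul contDiff_const)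
  have hl0 : l 0 = φ x := by simp [l]
  let J₀ : Set ℝ := l ⁻¹' (Ω ∩ Metric.ball (φ x) r)
  have hJ₀ : IsOpen J₀ := (hΩ.inter Metric.isOpen_ball).preimage hl.continuous
  have h0J₀ : (0 : ℝ) ∈ J₀ := by
    rw [mem_preimage, hl0]
    exact ⟨hx₁, Metric.mem_ball_self hr⟩
  let c : ℝ → Euc m := fun t ↦ f (φ.symm (l t))
  have hc : ContDiffOn ℝ ∞ c J₀ := hfφ.comp hl.contDiffOn fun t ht ↦ ht.1
  let W : ℝ → Euc d →L[ℝ] Euc m := fun t ↦ A (l t)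
  have hW : ContDiffOn ℝ ∞ W J₀ := hAs.comp hl.contDiffOn fun t ht ↦ ht.1
  let H : ℝ × Euc d → Euc m := fun p ↦ c p.1 + W p.1 p.2
  have hJ₀u : IsOpen (J₀ ×ˢ (univ : Set (Euc d))) := hJ₀.prod isOpen_univ
  have hfst : ContDiffOn ℝ ∞ (fun p : ℝ × Euc d ↦ p.1) (J₀ ×ˢ univ) := contDiffOn_fst
  have hWs : ContDiffOn ℝ ∞ (fun p : ℝ × Euc d ↦ W p.1 p.2) (J₀ ×ˢ univ) :=
    (hW.comp hfst fun p hp ↦ hp.1).clm_apply contDiffOn_snd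
  have hH : ContDiffOn ℝ ∞ H (J₀ ×ˢ univ) := (hc.comp hfst fun p hp ↦ hp.1).add hWs
  let N : Set (ℝ × Euc d) := (J₀ ×ˢ univ) ∩ (fun p : ℝ × Euc d ↦ W p.1 p.2) ⁻¹' Metric.ball 0 r
  have hN : IsOpen N := hWs.continuousOn.isOpen_inter_preimage hJ₀u Metric.isOpen_ball
  have h0N : (0 : ℝ × Euc d) ∈ N := ⟨⟨h0J₀, mem_univ _⟩, by simpa using hr⟩
  -- The local left inverse ρ of f brings H back to the chart. By `hkey`, H takes values in the
  -- image of f as long as W(t)s is short, so f recovers H from this lift.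
  let Ĝ : ℝ × Euc d → Euc n := ρ ∘ H
  have hkey : ∀ p ∈ N, H p ∈ Z ∧ Ĝ p ∈ Ω ∧ f (φ.symm (Ĝ p)) = H p ∧
      (A (Ĝ p)).range = (W p.1).range := by
    rintro ⟨t, s⟩ ⟨⟨htJ, -⟩, hts⟩
    obtain ⟨y', hy', hfy, hry⟩ := hpl (l t) htJ.2 (W t s) ⟨s, rfl⟩ (by simpa using hts)
    have h1 : H (t, s) = (f ∘ φ.symm) y' := hfy.symm
    have h2 : Ĝ (t, s) = y' := by
      simp only [Ĝ, Function.comp_apply]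
      rw [h1, (hρf y' hy').2]
    refine ⟨by rw [h1]; exact (hρf y' hy').1, by rwa [h2], by rw [h2, h1]; rfl, by rw [h2]; exact hry⟩
  have hĜ : ContDiffOn ℝ ∞ Ĝ N := hρ.comp (hH.mono inter_subset_left) fun p hp ↦ (hkey p hp).1
  have hĜ0 : Ĝ 0 = φ x := by
    have h1 : H 0 = (f ∘ φ.symm) (φ x) := by simp [H, c, hl0]
    simp only [Ĝ, Function.comp_apply]
    rw [h1, (hρf _ hx₁).2]
  have hĜd : ∀ p ∈ N, HasFDerivAt Ĝ (fderiv ℝ Ĝ p) p := fun p hp ↦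
    ((hĜ.differentiableOn (by simp)).differentiableAt (hN.mem_nhds hp)).hasFDerivAt
  have hHG : ∀ p ∈ N, ∀ v, fderiv ℝ H p v =
      fderiv ℝ (f ∘ φ.symm) (Ĝ p) (fderiv ℝ Ĝ p v) := fun p hp v ↦ by
    have h1 : H =ᶠ[𝓝 p] (f ∘ φ.symm) ∘ Ĝ := by
      filter_upwards [hN.mem_nhds hp] with q hq using (hkey q hq).2.2.1.symm
    rw [h1.fderiv_eq, fderiv_comp p ((hfφ.differentiableOn (by simp)).differentiableAt
      (hΩ.mem_nhds (hkey p hp).2.1)) (hĜd p hp).differentiableAt]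
    rfl
  have hHs : ∀ p ∈ N, ∀ s, fderiv ℝ H p (0, s) = W p.1 s := fun p hp s ↦ by
    have h1 : HasFDerivAt H (fderiv ℝ H p) p :=
      ((hH.differentiableOn (by simp)).differentiableAt (hJ₀u.mem_nhds hp.1)).hasFDerivAt
    have h3 : HasDerivAt (fun u : ℝ ↦ p + u • ((0 : ℝ), s)) ((0 : ℝ), s) 0 := by
      simpa using ((hasDerivAt_id (0 : ℝ)).smul_const ((0 : ℝ), s)).const_add p
    have h4 : HasDerivAt (H ∘ fun u : ℝ ↦ p + u • ((0 : ℝ), s)) (fderiv ℝ H p (0, s)) 0 :=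
      HasFDerivAt.comp_hasDerivAt (0 : ℝ) (by simpa using h1) h3
    have h5 : (H ∘ fun u : ℝ ↦ p + u • ((0 : ℝ), s)) = fun u ↦ H p + u • W p.1 s := by
      ext1 u
      simp [H, add_assoc]
    rw [h5] at h4
    have h6 : HasDerivAt (fun u : ℝ ↦ H p + u • W p.1 s) (W p.1 s) 0 := by
      simpa using ((hasDerivAt_id (0 : ℝ)).smul_const (W p.1 s)).const_add (H p)
    exact h4.unique h6
  have hHt : fderiv ℝ H 0 (1, 0) = fderiv ℝ (f ∘ φ.symm) (φ x) ν := by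
    have h1 : HasFDerivAt H (fderiv ℝ H 0) 0 :=
      ((hH.differentiableOn (by simp)).differentiableAt (hJ₀u.mem_nhds h0N.1)).hasFDerivAt
    have h2 : HasDerivAt (fun t : ℝ ↦ H (t, 0)) (fderiv ℝ H 0 (1, 0)) 0 :=
      HasFDerivAt.comp_hasDerivAt (f := fun t : ℝ ↦ (t, (0 : Euc d))) (0 : ℝ) h1
        ((hasDerivAt_id' (0 : ℝ)).prodMk (hasDerivAt_const 0 (0 : Euc d)))
    have h3 : HasDerivAt l ν 0 := by
      have h3 := ((hasDerivAt_id' (0 : ℝ)).smul_const ν).const_add (φ x)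
      rw [one_smul] at h3
      exact h3
    have h4 : HasFDerivAt (f ∘ φ.symm) (fderiv ℝ (f ∘ φ.symm) (φ x)) (l 0) := by
      rw [hl0]
      exact ((hfφ.differentiableOn (by simp)).differentiableAt (hΩ.mem_nhds hx₁)).hasFDerivAt
    have h5 := h4.comp_hasDerivAt (0 : ℝ) h3
    have h6 : (fun t : ℝ ↦ H (t, 0)) = (f ∘ φ.symm) ∘ l := by
      ext1 t
      simp [H, c]
    rw [h6] at h2
    exact h2.unique h5
  -- At the origin the derivative is (t, s) ↦ tν + Bs, with ν outside the range of B.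
  have hinj : Function.Injective (fderiv ℝ Ĝ 0) := by
    rw [injective_iff_map_eq_zero]
    rintro ⟨t, s⟩ hts
    have h1 := hHG 0 h0N (t, s)
    have h2 : ((t, s) : ℝ × Euc d) = t • (1, 0) + (0, s) := by simp
    have h3 : W (0 : ℝ × Euc d).1 s = fderiv ℝ (f ∘ φ.symm) (φ x) (B (φ x) s) := by
      simp only [W, Prod.fst_zero, hl0]
      rfl
    rw [hts, map_zero, h2, map_add, map_smul, hHt, hHs 0 h0N, h3, ← map_smul, ← map_add] at h1
    have h4 := (injective_iff_map_eq_zero _).1 (fderiv_chart_injective hf (hΩt hx₁)) _ h1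
    have ht : t = 0 := by
      by_contra htne
      refine hν ⟨-(t⁻¹ • s), ?_⟩
      have h5 : B (φ x) s = -(t • ν) := by rw [eq_neg_iff_add_eq_zero, add_comm, h4]
      change B (φ x) (-(t⁻¹ • s)) = ν
      rw [map_neg, map_smul, h5, smul_neg, neg_neg, smul_smul, inv_mul_cancel₀ htne, one_smul]
    subst ht
    rw [zero_smul, zero_add] at h4
    rw [(injective_iff_map_eq_zero _).1 (hBD _ hx₁).1 s h4]
    rfl
  let E₀ : (ℝ × Euc d) ≃L[ℝ] Euc n := (LinearMap.linearEquivOfInjective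
    (fderiv ℝ Ĝ 0).toLinearMap hinj (by simp; omega)).toContinuousLinearEquiv
  have hE₀ : (E₀ : ℝ × Euc d →L[ℝ] Euc n) = fderiv ℝ Ĝ 0 := ContinuousLinearMap.ext fun v ↦ rfl
  obtain ⟨e, he0, heN, hee, hesymm⟩ := exists_smooth_local_inverse hN hĜ h0N E₀
    (by rw [hE₀]; exact hĜd 0 h0N)
  obtain ⟨δ, hδ, hball⟩ := Metric.isOpen_iff.1 e.open_source 0 he0
  have hprod : Metric.ball (0 : ℝ) δ ×ˢ Metric.ball (0 : Euc d) δ ⊆ e.source := by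
    rw [ball_prod_same]; exact hball
  have hGm : ∀ p ∈ N, Ĝ p ∈ φ.target := fun p hp ↦ hΩt (hkey p hp).2.1
  -- Writing the image as a preimage under the chart gives its openness and the domain of the
  -- inverse.
  have himg : φ.symm ∘ Ĝ '' (Metric.ball (0 : ℝ) δ ×ˢ Metric.ball (0 : Euc d) δ) =
      φ.source ∩ φ ⁻¹' (Ĝ '' (Metric.ball (0 : ℝ) δ ×ˢ Metric.ball (0 : Euc d) δ)) := by
    ext z
    constructor
    · rintro ⟨p, hp, rfl⟩
      have hpt := hGm p (heN (hprod hp))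
      exact ⟨φ.map_target hpt, p, hp, by simp [φ.right_inv hpt]⟩
    · rintro ⟨hz, p, hp, hpz⟩
      exact ⟨p, hp, by simp [hpz, φ.left_inv hz]⟩
  have hsymm : ContMDiffOn 𝓘(ℝ, Euc n) (𝓡 n) ∞ φ.symm φ.target := contMDiffOn_extChartAt_symm x
  have hφs : ContMDiffOn (𝓡 n) 𝓘(ℝ, Euc n) ∞ φ φ.source := by
    rw [hφ, extChartAt_source]; exact contMDiffOn_extChartAt
  refine ⟨Metric.ball 0 δ, Metric.ball 0 δ, φ.symm ∘ Ĝ, e.symm ∘ φ, c, W,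
    ⟨Metric.isOpen_ball, convex_ball _ _, Metric.isOpen_ball, convex_ball _ _, ?_, ?_, ?_, ?_, ?_,
      ?_, ?_, ?_⟩, Metric.mem_ball_self hδ, Metric.mem_ball_self hδ, ?_, ?_⟩
  · exact hsymm.comp (hĜ.mono (hprod.trans heN)).contMDiffOn fun p hp ↦ hGm p (heN (hprod hp))
  · rw [himg]
    refine (continuousOn_extChartAt x).isOpen_inter_preimage (isOpen_extChartAt_source x) ?_
    rw [← hee]
    exact e.isOpen_image_of_subset_source (Metric.isOpen_ball.prod Metric.isOpen_ball) hprod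
  · rw [himg]
    refine hesymm.contMDiffOn.comp (hφs.mono inter_subset_left) ?_
    rintro z ⟨-, p, hp, hpz⟩
    rw [mem_preimage, ← hpz, ← hee]
    exact e.map_source (hprod hp)
  · intro p hp
    have hpt := hGm p (heN (hprod hp))
    simp only [Function.comp_apply]
    rw [φ.right_inv hpt, ← hee, e.left_inv (hprod hp)]
  · intro p hp v
    have hpN := heN (hprod hp)
    have hGd : MDifferentiableAt 𝓘(ℝ, ℝ × Euc d) (𝓡 n) (φ.symm ∘ Ĝ) p :=
      ((hsymm.comp hĜ.contMDiffOn hGm).contMDiffAt (hN.mem_nhds hpN)).mdifferentiableAt (by simp)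
    have hfd : MDifferentiableAt (𝓡 n) 𝓘(ℝ, Euc m) f ((φ.symm ∘ Ĝ) p) :=
      (hf.contMDiffAt isOpen_univ (mem_univ _)).mdifferentiableAt (by simp)
    have h1 : ∀ s : Euc d, mvfderiv (𝓡 n) f ((φ.symm ∘ Ĝ) p)
        (mfderiv 𝓘(ℝ, ℝ × Euc d) (𝓡 n) (φ.symm ∘ Ĝ) p ((0 : ℝ), s)) = W p.1 s := fun s ↦ by
      rw [← hHs p hpN s]
      refine (fderiv_comp_param hfd hGd ((0 : ℝ), s)).symm.trans ?_
      have h2 : f ∘ (φ.symm ∘ Ĝ) =ᶠ[𝓝 p] H := by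
        filter_upwards [hN.mem_nhds hpN] with q hq using (hkey q hq).2.2.1
      rw [h2.fderiv_eq]
    have h3 := hAr _ (hkey p hpN).2.1
    rw [(hkey p hpN).2.2.2] at h3
    constructor
    · intro hv
      have h4 : mvfderiv (𝓡 n) f ((φ.symm ∘ Ĝ) p) v ∈ (W p.1).range := by
        rw [h3]; exact ⟨v, hv, rfl⟩
      obtain ⟨s, hs⟩ := h4
      exact ⟨s, hf.injective (mem_univ _) ((h1 s).trans hs)⟩
    · rintro ⟨s, rfl⟩
      have h4 : W p.1 s ∈ (W p.1).range := ⟨s, rfl⟩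
      rw [h3] at h4
      obtain ⟨u, hu, huW⟩ := h4
      have h5 := hf.injective (mem_univ _) (huW.trans (h1 s).symm)
      rw [← h5]
      exact hu
  · exact hc.mono fun t ht ↦ (heN (hprod (show ((t, 0) : ℝ × Euc d) ∈ _ from ⟨ht, Metric.mem_ball_self hδ⟩))).1.1
  · exact hW.mono fun t ht ↦ (heN (hprod (show ((t, 0) : ℝ × Euc d) ∈ _ from ⟨ht, Metric.mem_ball_self hδ⟩))).1.1
  · intro p hp
    exact (hkey p (heN (hprod hp))).2.2.1
  · rw [Function.comp_apply, hĜ0]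
    exact extChartAt_to_inv x
  · rintro _ ⟨p, hp, rfl⟩
    exact hΩ₀U _ (hΩsub (hkey p (heN (hprod hp))).2.1)

end BoxExistence

end RuledComposition

namespace RuledComposition

open Set Filter Topology

/-! ### Properties of ruled boxes -/

section BoxGeometry

variable {n : ℕ} {M : Type*} [TopologicalSpace M] [ChartedSpace (Euc n) M]
  [IsManifold (𝓡 n) ∞ M]
variable {m d : ℕ} {D : TangentSubspaces n M} {f : M → Euc m} {J : Set ℝ} {B : Set (Euc d)}
  {G : ℝ × Euc d → M} {κ : M → ℝ × Euc d} {c : ℝ → Euc m} {W : ℝ → Euc d →L[ℝ] Euc m}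

set_option linter.unusedSectionVars false

theorem IsRuledBox.isOpen_domain (h : IsRuledBox D f J B G κ c W) : IsOpen (J ×ˢ B) :=
  h.isOpen_time.prod h.isOpen_space

theorem IsRuledBox.convex_domain (h : IsRuledBox D f J B G κ c W) : Convex ℝ (J ×ˢ B) :=
  h.convex_time.prod h.convex_space

theorem IsRuledBox.contMDiffAt_param (h : IsRuledBox D f J B G κ c W) {p : ℝ × Euc d}
    (hp : p ∈ J ×ˢ B) : ContMDiffAt 𝓘(ℝ, ℝ × Euc d) (𝓡 n) ∞ G p :=
  h.smooth_param.contMDiffAt (h.isOpen_domain.mem_nhds hp)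

theorem IsRuledBox.mdifferentiableAt_param (h : IsRuledBox D f J B G κ c W) {p : ℝ × Euc d}
    (hp : p ∈ J ×ˢ B) : MDifferentiableAt 𝓘(ℝ, ℝ × Euc d) (𝓡 n) G p :=
  (h.contMDiffAt_param hp).mdifferentiableAt (by simp)

theorem IsRuledBox.contMDiffAt_inv (h : IsRuledBox D f J B G κ c W) {z : M}
    (hz : z ∈ G '' (J ×ˢ B)) : ContMDiffAt (𝓡 n) 𝓘(ℝ, ℝ × Euc d) ∞ κ z :=
  h.smooth_inv.contMDiffAt (h.isOpen_image.mem_nhds hz)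

theorem IsRuledBox.right_inv (h : IsRuledBox D f J B G κ c W) {z : M}
    (hz : z ∈ G '' (J ×ˢ B)) : G (κ z) = z := by
  obtain ⟨p, hp, rfl⟩ := hz
  rw [h.left_inv p hp]

theorem IsRuledBox.inv_mem (h : IsRuledBox D f J B G κ c W) {z : M}
    (hz : z ∈ G '' (J ×ˢ B)) : κ z ∈ J ×ˢ B := by
  obtain ⟨p, hp, rfl⟩ := hz
  rwa [h.left_inv p hp]

theorem IsRuledBox.mfderiv_inv (h : IsRuledBox D f J B G κ c W) {p : ℝ × Euc d}
    (hp : p ∈ J ×ˢ B) (a : ℝ × Euc d) :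
    mvfderiv (𝓡 n) κ (G p) (mfderiv 𝓘(ℝ, ℝ × Euc d) (𝓡 n) G p a) = a := by
  have h1 : κ ∘ G =ᶠ[𝓝 p] id := by
    filter_upwards [h.isOpen_domain.mem_nhds hp] with q hq using h.left_inv q hq
  rw [← fderiv_comp_param ((h.contMDiffAt_inv ⟨p, hp, rfl⟩).mdifferentiableAt (by simp))
    (h.mdifferentiableAt_param hp), h1.fderiv_eq, fderiv_id]
  rfl

theorem IsRuledBox.bijective_mfderiv (h : IsRuledBox D f J B G κ c W) (hn : d + 1 = n)
    {p : ℝ × Euc d} (hp : p ∈ J ×ˢ B) :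
    Function.Bijective (mfderiv 𝓘(ℝ, ℝ × Euc d) (𝓡 n) G p) := by
  let A : (ℝ × Euc d) →L[ℝ] Euc n := mfderiv 𝓘(ℝ, ℝ × Euc d) (𝓡 n) G p
  have hi : Function.Injective A := fun a b hab ↦ by
    rw [← h.mfderiv_inv hp a, ← h.mfderiv_inv hp b]
    exact congrArg (mvfderiv (𝓡 n) κ (G p)) hab
  exact ⟨hi, (LinearMap.injective_iff_surjective_of_finrank_eq_finrank (f := A.toLinearMap)
    (by simp; omega)).1 hi⟩

theorem IsRuledBox.isOpen_image_of_isOpen (h : IsRuledBox D f J B G κ c W) {Ω : Set (ℝ × Euc d)}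
    (hΩ : IsOpen Ω) (hs : Ω ⊆ J ×ˢ B) : IsOpen (G '' Ω) := by
  have h1 : G '' Ω = G '' (J ×ˢ B) ∩ κ ⁻¹' Ω := by
    ext z
    constructor
    · rintro ⟨p, hp, rfl⟩
      exact ⟨⟨p, hs hp, rfl⟩, by rwa [mem_preimage, h.left_inv p (hs hp)]⟩
    · rintro ⟨⟨p, hp, rfl⟩, hz⟩
      rw [mem_preimage, h.left_inv p hp] at hz
      exact ⟨p, hz, rfl⟩
  rw [h1]
  exact h.smooth_inv.continuousOn.isOpen_inter_preimage h.isOpen_image hΩ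

theorem IsRuledBox.mono (h : IsRuledBox D f J B G κ c W) {J' : Set ℝ} {B' : Set (Euc d)}
    (hJ' : IsOpen J') (hJc : Convex ℝ J') (hB' : IsOpen B') (hBc : Convex ℝ B') (hJ : J' ⊆ J)
    (hB : B' ⊆ B) : IsRuledBox D f J' B' G κ c W where
  isOpen_time := hJ'
  convex_time := hJc
  isOpen_space := hB'
  convex_space := hBc
  smooth_param := h.smooth_param.mono (prod_mono hJ hB)
  isOpen_image := h.isOpen_image_of_isOpen (hJ'.prod hB') (prod_mono hJ hB)
  smooth_inv := h.smooth_inv.mono (image_mono (prod_mono hJ hB))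
  left_inv := fun p hp ↦ h.left_inv p (prod_mono hJ hB hp)
  distribution := fun p hp ↦ h.distribution p (prod_mono hJ hB hp)
  smooth_base := h.smooth_base.mono hJ
  smooth_ruling := h.smooth_ruling.mono hJ
  ruled := fun p hp ↦ h.ruled p (prod_mono hJ hB hp)

/-- Every neighborhood of a point of a box contains a smaller box. -/
theorem IsRuledBox.exists_subbox (h : IsRuledBox D f J B G κ c W) {p : ℝ × Euc d}
    (hp : p ∈ J ×ˢ B) {N : Set (ℝ × Euc d)} (hN : N ∈ 𝓝 p) :
    ∃ J' B', IsRuledBox D f J' B' G κ c W ∧ p ∈ J' ×ˢ B' ∧ J' ⊆ J ∧ B' ⊆ B ∧ J' ×ˢ B' ⊆ N := by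
  obtain ⟨δ, hδ, hb⟩ := Metric.mem_nhds_iff.1 (inter_mem (h.isOpen_domain.mem_nhds hp) hN)
  rw [← Prod.mk.eta (p := p), ← ball_prod_same] at hb
  have hJ : Metric.ball p.1 δ ⊆ J := fun t ht ↦
    (hb (show (t, p.2) ∈ _ from ⟨ht, Metric.mem_ball_self hδ⟩)).1.1
  have hB : Metric.ball p.2 δ ⊆ B := fun s hs ↦
    (hb (show (p.1, s) ∈ _ from ⟨Metric.mem_ball_self hδ, hs⟩)).1.2
  exact ⟨_, _, h.mono Metric.isOpen_ball (convex_ball _ _) Metric.isOpen_ball (convex_ball _ _)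
    hJ hB, ⟨Metric.mem_ball_self hδ, Metric.mem_ball_self hδ⟩, hJ, hB, fun q hq ↦ (hb hq).2⟩

theorem IsRuledBox.isPreconnected_image (h : IsRuledBox D f J B G κ c W) :
    IsPreconnected (G '' (J ×ˢ B)) :=
  h.convex_domain.isPreconnected.image _ h.smooth_param.continuousOn

variable {V : Type*} [NormedAddCommGroup V] [NormedSpace ℝ V]

theorem IsRuledBox.contDiffOn_comp (h : IsRuledBox D f J B G κ c W) {u : M → V}
    (hu : ContMDiffOn (𝓡 n) 𝓘(ℝ, V) ∞ u (G '' (J ×ˢ B))) : ContDiffOn ℝ ∞ (u ∘ G) (J ×ˢ B) :=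
  contMDiffOn_iff_contDiffOn.1 (hu.comp h.smooth_param fun p hp ↦ ⟨p, hp, rfl⟩)

theorem IsRuledBox.contMDiffOn_comp (h : IsRuledBox D f J B G κ c W) {u : ℝ × Euc d → V}
    (hu : ContDiffOn ℝ ∞ u (J ×ˢ B)) : ContMDiffOn (𝓡 n) 𝓘(ℝ, V) ∞ (u ∘ κ) (G '' (J ×ˢ B)) :=
  hu.contMDiffOn.comp h.smooth_inv fun _ hz ↦ h.inv_mem hz

/-- The leaves of the restriction of the ruling to a box. -/
theorem IsRuledBox.leafOn_eq (h : IsRuledBox D f J B G κ c W) {p : ℝ × Euc d}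
    (hp : p ∈ J ×ˢ B) : leafOn D (G '' (J ×ˢ B)) (G p) = (fun s ↦ G (p.1, s)) '' B := by
  ext y
  constructor
  · rintro ⟨γ, hγ, h0, rfl, hγD⟩
    -- In the box, vectors of D have zero time component, so the time coordinate is constant along
    -- curves tangent to D.
    have hκγ : ∀ t, HasDerivAt (fun t ↦ (κ (γ t)).1) 0 t := fun t ↦ by
      have hγt := (hγD t).1
      have hm := (h.contMDiffAt_inv hγt).mdifferentiableAt (by simp)
      have hγm : MDifferentiableAt 𝓘(ℝ, ℝ) (𝓡 n) γ t := hγ.contMDiffAt.mdifferentiableAt (by simp)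
      have h1 := fderiv_comp_param hm hγm (1 : ℝ)
      have h2 : DifferentiableAt ℝ (κ ∘ γ) t :=
        mdifferentiableAt_iff_differentiableAt.1 (hm.comp t hγm)
      have h3 : (deriv (κ ∘ γ) t).1 = 0 := by
        rw [← fderiv_apply_one_eq_deriv, h1]
        obtain ⟨q, hq, hqt⟩ := hγt
        have h4 := (hγD t).2
        revert h4
        generalize mfderiv 𝓘(ℝ, ℝ) (𝓡 n) γ t (1 : ℝ) = v
        revert v
        change ∀ v : Euc n, v ∈ D (γ t) → (mvfderiv (𝓡 n) κ (γ t) v).1 = 0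
        rw [← hqt]
        intro v hv
        obtain ⟨s, rfl⟩ := (h.distribution q hq v).1 hv
        have h5 := h.mfderiv_inv hq ((0 : ℝ), s)
        exact congrArg Prod.fst h5
      have h6 := (hasFDerivAt_fst (𝕜 := ℝ) (p := (κ ∘ γ) t)).comp_hasDerivAt t h2.hasDerivAt
      rw [← h3]
      exact h6
    have h1 : (κ (γ 1)).1 = p.1 := by
      have h2 := is_const_of_deriv_eq_zero (fun t ↦ (hκγ t).differentiableAt)
        (fun t ↦ (hκγ t).deriv) 1 0
      simp only [h0, h.left_inv p hp] at h2
      exact h2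
    have h3 := (hγD 1).1
    refine ⟨(κ (γ 1)).2, (h.inv_mem h3).2, ?_⟩
    simp only [← h1, Prod.mk.eta]
    exact h.right_inv h3
  · rintro ⟨s, hs, rfl⟩
    -- A segment of the convex set B, run through by a smooth transition so that the curve stays in
    -- the box for all real times.
    let l : ℝ → ℝ × Euc d := fun t ↦ (p.1, p.2 + Real.smoothTransition t • (s - p.2))
    have hl : ContDiff ℝ ∞ l := contDiff_const.prodMk
      (contDiff_const.add (Real.smoothTransition.contDiff.smul contDiff_const))
    have hlm : ∀ t, l t ∈ J ×ˢ B := fun t ↦ ⟨hp.1, h.convex_space.add_smul_sub_mem hp.2 hs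
      ⟨Real.smoothTransition.nonneg t, Real.smoothTransition.le_one t⟩⟩
    refine ⟨G ∘ l, fun t ↦ (h.contMDiffAt_param (hlm t)).comp t hl.contMDiff.contMDiffAt,
      by simp [l], by simp [l], fun t ↦ ⟨⟨_, hlm t, rfl⟩, ?_⟩⟩
    refine (h.distribution (l t) (hlm t) _).2 ⟨(deriv l t).2, ?_⟩
    have hd : DifferentiableAt ℝ l t := hl.differentiable (by simp) t
    have h1 := mfderiv_comp t (h.mdifferentiableAt_param (hlm t)) hd.mdifferentiableAt
    rw [mfderiv_eq_fderiv] at h1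
    refine Eq.trans ?_ (DFunLike.congr_fun h1 (1 : ℝ)).symm
    change _ = mfderiv 𝓘(ℝ, ℝ × Euc d) (𝓡 n) G (l t) (fderiv ℝ l t 1)
    have h2 := (hasFDerivAt_fst (𝕜 := ℝ) (p := l t)).comp_hasDerivAt t hd.hasDerivAt
    have h3 : fderiv ℝ l t 1 = ((0 : ℝ), (deriv l t).2) := by
      rw [fderiv_apply_one_eq_deriv]
      exact Prod.ext (h2.unique (hasDerivAt_const t p.1)) rfl
    exact congrArg (mfderiv 𝓘(ℝ, ℝ × Euc d) (𝓡 n) G (l t)) h3.symm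

end BoxGeometry

end RuledComposition

namespace RuledComposition

open Set Filter Topology

/-! ### Curvature: the Gauss equation and the rank of the curvature operator -/

section PullbackMetric

set_option linter.unusedSectionVars false

variable {E V : Type*} [NormedAddCommGroup E] [NormedSpace ℝ E] [NormedAddCommGroup V] [InnerProductSpace ℝ V] [FiniteDimensional ℝ V]

theorem hasFDerivAt_inner_fderiv {f : E → V} {y : E} (hf : ContDiffAt ℝ 2 f y) (v w : E) :
    HasFDerivAt (fun z ↦ inner ℝ (fderiv ℝ f z v) (fderiv ℝ f z w))
      ((fderivInnerCLM ℝ (fderiv ℝ f y v, fderiv ℝ f y w)).comp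
        (((fderiv ℝ (fderiv ℝ f) y).flip v).prod ((fderiv ℝ (fderiv ℝ f) y).flip w))) y := by
  have d1 : HasFDerivAt (fderiv ℝ f) (fderiv ℝ (fderiv ℝ f) y) y :=
    ((hf.fderiv_right (m := 1) (by norm_num)).differentiableAt (by simp)).hasFDerivAt
  have d2 : ∀ v, HasFDerivAt (fun z ↦ fderiv ℝ f z v) ((fderiv ℝ (fderiv ℝ f) y).flip v) y :=
    fun v ↦ (ContinuousLinearMap.apply ℝ V v).hasFDerivAt.comp y d1
  exact (d2 v).inner ℝ (d2 w)

/-- The metric induced by `f`, near a point. -/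
def IsPullbackMetricNear (G : E → E →L[ℝ] E →L[ℝ] ℝ) (f : E → V) (y₀ : E) : Prop :=
  ∀ᶠ y in 𝓝 y₀, ∀ u v, G y u v = inner ℝ (fderiv ℝ f y u) (fderiv ℝ f y v)

theorem IsPullbackMetricNear.fderiv_apply {G : E → E →L[ℝ] E →L[ℝ] ℝ} {f : E → V} {y : E}
    (hG : IsPullbackMetricNear G f y) (hf : ContDiffAt ℝ 2 f y) (u v w : E) :
    fderiv ℝ G y u v w = inner ℝ (fderiv ℝ (fderiv ℝ f) y u v) (fderiv ℝ f y w) +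
      inner ℝ (fderiv ℝ f y v) (fderiv ℝ (fderiv ℝ f) y u w) := by
  let G₀ : E → E →L[ℝ] E →L[ℝ] ℝ := fun z ↦ (innerSL ℝ (E := V)).bilinearComp (fderiv ℝ f z)
    (fderiv ℝ f z)
  have h0 : G =ᶠ[𝓝 y] G₀ := by
    filter_upwards [hG] with z hz
    ext u v
    simp [hz, G₀]
  have d1 : DifferentiableAt ℝ (fderiv ℝ f) y :=
    (hf.fderiv_right (m := 1) (by norm_num)).differentiableAt (by simp)
  have hG₀ : DifferentiableAt ℝ G₀ y := by
    have h1 : G₀ = fun z ↦ ((ContinuousLinearMap.compL ℝ E V ℝ).flip (fderiv ℝ f z)).comp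
        ((innerSL ℝ).comp (fderiv ℝ f z)) := by
      ext z u v
      simp [G₀]
    rw [h1]
    exact (((ContinuousLinearMap.compL ℝ E V ℝ).flip.differentiableAt).comp y d1).clm_comp
      ((differentiableAt_const _).clm_comp d1)
  have hGd : HasFDerivAt G (fderiv ℝ G y) y :=
    (hG₀.congr_of_eventuallyEq h0).hasFDerivAt
  have h2 : HasFDerivAt (fun z ↦ G z v w) (((fderiv ℝ G y).flip v).flip w) y :=
    (ContinuousLinearMap.apply ℝ ℝ w).hasFDerivAt.comp y
      ((ContinuousLinearMap.apply ℝ (E →L[ℝ] ℝ) v).hasFDerivAt.comp y hGd)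
  have h3 : HasFDerivAt (fun z ↦ G z v w) _ y :=
    (hasFDerivAt_inner_fderiv hf v w).congr_of_eventuallyEq
      (by filter_upwards [hG] with z hz using hz v w)
  have h4 := DFunLike.congr_fun (h2.unique h3) u
  simp only [ContinuousLinearMap.flip_apply, ContinuousLinearMap.comp_apply,
    ContinuousLinearMap.prod_apply, fderivInnerCLM_apply] at h4
  rw [h4, add_comm]

theorem ContDiffAt.fderiv_fderiv_comm {f : E → V} {y : E} (hf : ContDiffAt ℝ 2 f y) (u v : E) :
    fderiv ℝ (fderiv ℝ f) y u v = fderiv ℝ (fderiv ℝ f) y v u :=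
  (hf.isSymmSndFDerivAt (by simp)).eq u v

/-- The first Christoffel symbols are the tangential components of the second derivatives. -/
theorem IsPullbackMetricNear.christoffelFirst {G : E → E →L[ℝ] E →L[ℝ] ℝ} {f : E → V} {y : E}
    (hG : IsPullbackMetricNear G f y) (hf : ContDiffAt ℝ 2 f y) (u v w : E) :
    christoffelFirst G y u v w = inner ℝ (fderiv ℝ (fderiv ℝ f) y u v) (fderiv ℝ f y w) := by
  rw [christoffelFirst_apply, hG.fderiv_apply hf, hG.fderiv_apply hf, hG.fderiv_apply hf,
    ContDiffAt.fderiv_fderiv_comm hf v u, ContDiffAt.fderiv_fderiv_comm hf w u,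
    ContDiffAt.fderiv_fderiv_comm hf w v,
    real_inner_comm (fderiv ℝ (fderiv ℝ f) y u w), real_inner_comm (fderiv ℝ (fderiv ℝ f) y v w)]
  ring

end PullbackMetric

section Gauss

set_option linter.unusedSectionVars false

variable {E V : Type*} [NormedAddCommGroup E] [InnerProductSpace ℝ E] [FiniteDimensional ℝ E]
  [NormedAddCommGroup V] [InnerProductSpace ℝ V] [FiniteDimensional ℝ V]

theorem isInvertible_of_inner_map {A : E →L[ℝ] V} (hA : Function.Injective A)
    {G : E →L[ℝ] E →L[ℝ] ℝ} (hG : ∀ u v, G u v = inner ℝ (A u) (A v)) : G.IsInvertible := by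
  have hi : Function.Injective G.toLinearMap := by
    rw [injective_iff_map_eq_zero]
    intro u hu
    have h1 : G u u = 0 := by
      have h2 : G u = 0 := hu
      rw [h2]; rfl
    rw [hG, inner_self_eq_zero] at h1
    exact (injective_iff_map_eq_zero A).1 hA u h1
  have hd : Module.finrank ℝ E = Module.finrank ℝ (E →L[ℝ] ℝ) := by
    rw [← (LinearMap.toContinuousLinearMap : (E →ₗ[ℝ] ℝ) ≃ₗ[ℝ] _).finrank_eq]
    exact Subspace.dual_finrank_eq.symm
  exact ⟨(LinearMap.linearEquivOfInjective G.toLinearMap hi hd).toContinuousLinearEquiv,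
    ContinuousLinearMap.ext fun v ↦ rfl⟩

theorem inner_map_leftInv {A : E →L[ℝ] V} (hA : Function.Injective A) (y : V) (x : E) :
    inner ℝ (A (leftInv A y)) (A x) = inner ℝ y (A x) := by
  have := inner_sub_leftInv hA y x
  rw [inner_sub_left] at this
  linarith

/-- The Christoffel symbols and the least-squares solution satisfy the same normal equations:
pairing with any w gives ⟨∂²f(u, v), df(w)⟩. -/
theorem IsPullbackMetricNear.christoffel {G : E → E →L[ℝ] E →L[ℝ] ℝ} {f : E → V} {y : E}
    (hG : IsPullbackMetricNear G f y) (hf : ContDiffAt ℝ 2 f y)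
    (hi : Function.Injective (fderiv ℝ f y)) (u v : E) :
    christoffel G y u v = leftInv (fderiv ℝ f y) (fderiv ℝ (fderiv ℝ f) y u v) := by
  change (G y).inverse (RuledComposition.christoffelFirst G y u v) = _
  rw [(isInvertible_of_inner_map hi hG.self_of_nhds).inverse_apply_eq]
  ext w
  rw [hG.christoffelFirst hf, hG.self_of_nhds, inner_map_leftInv hi]

theorem starProjection_congr {K L : Submodule ℝ V} (h : K = L) (v : V) :
    K.starProjection v = L.starProjection v := by
  subst h
  rfl

/-- The normal component of the second derivative. -/
noncomputable def normalHessian (f : E → V) (y : E) : E →L[ℝ] E →L[ℝ] V :=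
  (ContinuousLinearMap.compL ℝ E V V (fderiv ℝ f y).rangeᗮ.starProjection).comp
    (fderiv ℝ (fderiv ℝ f) y)

theorem normalHessian_apply (f : E → V) (y u v : E) : normalHessian f y u v =
    (fderiv ℝ f y).rangeᗮ.starProjection (fderiv ℝ (fderiv ℝ f) y u v) := rfl

theorem starProjection_range_orthogonal {A : E →L[ℝ] V} (hA : Function.Injective A) (y : V) :
    A.rangeᗮ.starProjection y = y - A (leftInv A y) := by
  refine Submodule.eq_starProjection_of_mem_orthogonal (K := A.rangeᗮ) ?_ ?_
  · rw [Submodule.mem_orthogonal]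
    rintro _ ⟨x, rfl⟩
    rw [real_inner_comm]
    exact inner_sub_leftInv hA y x
  · rw [sub_sub_cancel]
    exact Submodule.le_orthogonal_orthogonal _ ⟨_, rfl⟩

/-- The Gauss equation. -/
theorem IsPullbackMetricNear.gauss {G : E → E →L[ℝ] E →L[ℝ] ℝ} {f : E → V} {y : E}
    (hG : IsPullbackMetricNear G f y) (hf : ContDiffAt ℝ 3 f y)
    (hi : Function.Injective (fderiv ℝ f y)) (u v w z : E) :
    inner ℝ (fderiv ℝ f y (curvatureTensor G y u v w)) (fderiv ℝ f y z) =
      inner ℝ (normalHessian f y v w) (normalHessian f y u z) -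
        inner ℝ (normalHessian f y u w) (normalHessian f y v z) := by
  have hf2 : ContDiffAt ℝ 2 f y := hf.of_le (by norm_num)
  have hf' : ContDiffAt ℝ 2 (fderiv ℝ f) y := hf.fderiv_right (by norm_num)
  have hopen : ∀ᶠ x in 𝓝 y, Function.Injective (fderiv ℝ f x) := by
    have h1 : ContinuousAt (fderiv ℝ f) y := hf'.continuousAt
    exact h1.eventually (ContinuousLinearMap.isOpen_injective.mem_nhds hi)
  have hev : ∀ᶠ x in 𝓝 y, IsPullbackMetricNear G f x ∧ ContDiffAt ℝ 2 f x ∧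
      Function.Injective (fderiv ℝ f x) :=
    hG.eventually_nhds.and ((hf2.eventually (by simp)).and hopen)
  obtain ⟨Ω, hΩ, hΩo, hy⟩ := eventually_nhds_iff.1 (hev.and (hf.eventually (by simp)))
  have hfs : ContDiffOn ℝ 3 f Ω := fun x hx ↦ (hΩ x hx).2.contDiffWithinAt
  have hdf : ContDiffOn ℝ 2 (fderiv ℝ f) Ω := hfs.fderiv_of_isOpen hΩo (by norm_num)
  have hΓ : DifferentiableAt ℝ (RuledComposition.christoffel G) y := by
    have h1 : ContDiffOn ℝ 1 (fun x ↦ (ContinuousLinearMap.compL ℝ E V E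
        (leftInv (fderiv ℝ f x))).comp (fderiv ℝ (fderiv ℝ f) x)) Ω :=
      ((ContinuousLinearMap.compL ℝ E V E).contDiff.comp_contDiffOn
        (ContDiffOn.leftInv (hdf.of_le (by norm_num)) fun x hx ↦ (hΩ x hx).1.2.2)).clm_comp
        (hdf.fderiv_of_isOpen hΩo (by norm_num))
    refine ((h1.differentiableOn (by simp)).differentiableAt
      (hΩo.mem_nhds hy)).congr_of_eventuallyEq ?_
    filter_upwards [hev] with x hx
    ext1 u
    ext1 v
    exact hx.1.christoffel hx.2.1 hx.2.2 u v
  have hN : ∀ u v, normalHessian f y u v = fderiv ℝ (fderiv ℝ f) y u v -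
      fderiv ℝ f y (RuledComposition.christoffel G y u v) := fun u v ↦ by
    rw [normalHessian_apply, starProjection_range_orthogonal hi, hG.christoffel hf2 hi]
  have hNT : ∀ u v z, inner ℝ (normalHessian f y u v) (fderiv ℝ f y z) = 0 := fun u v z ↦ by
    rw [hN, hG.christoffel hf2 hi, inner_sub_leftInv hi]
  have d1 : HasFDerivAt (fderiv ℝ f) (fderiv ℝ (fderiv ℝ f) y) y :=
    (hf'.differentiableAt (by simp)).hasFDerivAt
  have d2 : HasFDerivAt (fderiv ℝ (fderiv ℝ f)) (fderiv ℝ (fderiv ℝ (fderiv ℝ f)) y) y :=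
    ((hf'.fderiv_right (m := 1) (by norm_num)).differentiableAt (by simp)).hasFDerivAt
  -- This comes from differentiating ⟨df(Γ(v, w)), df(z)⟩ = ⟨∂²f(v, w), df(z)⟩ in the direction u.
  -- The third derivative is symmetric in u and v, so it cancels in the curvature.
  have key : ∀ u v w z, inner ℝ (fderiv ℝ f y (fderiv ℝ (RuledComposition.christoffel G) y u v w +
      RuledComposition.christoffel G y u (RuledComposition.christoffel G y v w)))
      (fderiv ℝ f y z) = inner ℝ (fderiv ℝ (fderiv ℝ (fderiv ℝ f)) y u v w) (fderiv ℝ f y z) +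
        inner ℝ (normalHessian f y v w) (normalHessian f y u z) := by
    intro u v w z
    have e1 : HasFDerivAt (fun x ↦ RuledComposition.christoffel G x v w)
        (((fderiv ℝ (RuledComposition.christoffel G) y).flip v).flip w) y :=
      (ContinuousLinearMap.apply ℝ E w).hasFDerivAt.comp y
        ((ContinuousLinearMap.apply ℝ (E →L[ℝ] E) v).hasFDerivAt.comp y hΓ.hasFDerivAt)
    have e2 : HasFDerivAt (fun x ↦ fderiv ℝ (fderiv ℝ f) x v w)
        (((fderiv ℝ (fderiv ℝ (fderiv ℝ f)) y).flip v).flip w) y :=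
      (ContinuousLinearMap.apply ℝ V w).hasFDerivAt.comp y
        ((ContinuousLinearMap.apply ℝ (E →L[ℝ] V) v).hasFDerivAt.comp y d2)
    have e3 : HasFDerivAt (fun x ↦ fderiv ℝ f x z) ((fderiv ℝ (fderiv ℝ f) y).flip z) y :=
      (ContinuousLinearMap.apply ℝ V z).hasFDerivAt.comp y d1
    have e4 := (d1.clm_apply e1).inner ℝ e3
    have e5 := e2.inner ℝ e3
    have e6 : (fun x ↦ inner ℝ (fderiv ℝ f x (RuledComposition.christoffel G x v w))
        (fderiv ℝ f x z)) =ᶠ[𝓝 y]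
        fun x ↦ inner ℝ (fderiv ℝ (fderiv ℝ f) x v w) (fderiv ℝ f x z) := by
      filter_upwards [hev] with x hx
      rw [hx.1.christoffel hx.2.1 hx.2.2, inner_map_leftInv hx.2.2]
    have e7 := DFunLike.congr_fun (e4.unique (e5.congr_of_eventuallyEq e6)) u
    simp only [ContinuousLinearMap.flip_apply, ContinuousLinearMap.comp_apply,
      ContinuousLinearMap.prod_apply, fderivInnerCLM_apply, add_apply] at e7
    have e8 : inner ℝ (normalHessian f y v w) (normalHessian f y u z) =
        inner ℝ (normalHessian f y v w) (fderiv ℝ (fderiv ℝ f) y u z) := by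
      conv_lhs => rw [hN u z, inner_sub_right, hNT, sub_zero]
    have e9 : inner ℝ (fderiv ℝ f y (RuledComposition.christoffel G y u
        (RuledComposition.christoffel G y v w))) (fderiv ℝ f y z) =
        inner ℝ (fderiv ℝ (fderiv ℝ f) y u (RuledComposition.christoffel G y v w))
          (fderiv ℝ f y z) := by
      rw [hG.christoffel hf2 hi u, inner_map_leftInv hi]
    rw [e8, map_add, inner_add_left, e9, hN v w, inner_sub_left]
    rw [inner_add_left] at e7
    linarith
  have h3 : fderiv ℝ (fderiv ℝ (fderiv ℝ f)) y u v w = fderiv ℝ (fderiv ℝ (fderiv ℝ f)) y v u w :=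
    DFunLike.congr_fun ((hf'.isSymmSndFDerivAt (by simp)).eq u v) w
  have h4 : curvatureTensor G y u v w =
      (fderiv ℝ (RuledComposition.christoffel G) y u v w +
        RuledComposition.christoffel G y u (RuledComposition.christoffel G y v w)) -
      (fderiv ℝ (RuledComposition.christoffel G) y v u w +
        RuledComposition.christoffel G y v (RuledComposition.christoffel G y u w)) := by
    simp only [curvatureTensor, sub_apply, add_apply,
      ContinuousLinearMap.comp_apply]
    abel
  rw [h4, map_sub, inner_sub_left, key, key, h3]
  ring

/-- If the second fundamental form vanishes on a hyperplane, the rank of the curvature operator is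
the dimension of the span of its values on that hyperplane. -/
theorem finrank_range_alternating {R : E [⋀^Fin 2]→ₗ[ℝ] (E →L[ℝ] E)} {T : E →L[ℝ] V}
    (hT : Function.Injective T) {N : E →L[ℝ] E →L[ℝ] V} (hN : ∀ u v, N u v = N v u)
    (hR : ∀ u v w z, inner ℝ (T (R ![u, v] w)) (T z) =
      inner ℝ (N v w) (N u z) - inner ℝ (N u w) (N v z))
    {D : Submodule ℝ E} (hD : Module.finrank ℝ D + 1 = Module.finrank ℝ E)
    (hND : ∀ u ∈ D, ∀ v ∈ D, N u v = 0) :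
    Module.finrank ℝ (LinearMap.range (exteriorPower.alternatingMapLinearEquiv R)) =
      Module.finrank ℝ (Submodule.span ℝ {ξ | ∃ v, ∃ w ∈ D, ξ = N v w}) := by
  obtain ⟨t, ht⟩ : ∃ t, t ∉ D := by
    by_contra! h
    rw [(Submodule.eq_top_iff'.2 h : D = ⊤), finrank_top] at hD
    omega
  have hdec : ∀ v, ∃ (a : ℝ) (x : E), x ∈ D ∧ v = a • t + x := by
    have h1 : D ⊔ Submodule.span ℝ {t} = ⊤ := by
      apply Submodule.eq_top_of_finrank_eq
      refine le_antisymm (Submodule.finrank_le _) ?_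
      rw [← hD]
      have h2 : D < D ⊔ Submodule.span ℝ {t} := by
        refine lt_of_le_of_ne le_sup_left fun h ↦ ht ?_
        rw [h]
        exact Submodule.mem_sup_right (Submodule.mem_span_singleton_self t)
      exact Submodule.finrank_lt_finrank_of_lt h2
    intro v
    have h2 : v ∈ D ⊔ Submodule.span ℝ {t} := h1 ▸ Submodule.mem_top
    obtain ⟨x, hx, y, hy, rfl⟩ := Submodule.mem_sup.1 h2
    obtain ⟨a, rfl⟩ := Submodule.mem_span_singleton.1 hy
    exact ⟨a, x, hx, add_comm _ _⟩
  have hzero : ∀ A : E →L[ℝ] E, (∀ w z, inner ℝ (T (A w)) (T z) = 0) → A = 0 := by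
    intro A hA
    ext1 w
    have h1 := hA w (A w)
    rw [inner_self_eq_zero] at h1
    exact (injective_iff_map_eq_zero T).1 hT _ h1
  -- With t transversal to D, curvature operator and second fundamental form are compared through
  -- their restrictions R(t, ·) and N(t, ·) to D.
  let ρ : D →ₗ[ℝ] (E →L[ℝ] E) := (R.toMultilinearMap.toLinearMap ![t, 0] 1).comp D.subtype
  have hρ : ∀ x : D, ρ x = R ![t, x] := fun x ↦ by
    have h1 : Function.update ![t, 0] 1 (x : E) = ![t, (x : E)] := by
      ext i; fin_cases i <;> simp
    simp only [ρ, LinearMap.comp_apply, MultilinearMap.toLinearMap_apply, Submodule.subtype_apply,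
      h1]
    rfl
  let ν : D →ₗ[ℝ] V := (N t).toLinearMap.comp D.subtype
  -- As N(x, x) = 0 on D, one has ⟨R(t, x)t, x⟩ = ‖N(t, x)‖². Conversely N(t, x) = 0 makes N(x, ·)
  -- vanish, and with it R(t, x).
  have hker : LinearMap.ker ρ = LinearMap.ker ν := by
    ext x
    rw [LinearMap.mem_ker, LinearMap.mem_ker, hρ]
    change _ ↔ N t x = 0
    constructor
    · intro h
      have h1 := hR t x t x
      rw [h, hND x x.2 x x.2, inner_zero_right, sub_zero, hN x t] at h1
      simpa [inner_self_eq_zero] using h1.symm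
    · intro h
      have h1 : ∀ w, N x w = 0 := fun w ↦ by
        obtain ⟨a, y, hy, rfl⟩ := hdec w
        rw [map_add, map_smul, hN x t, h, hND x x.2 y hy, smul_zero, add_zero]
      refine hzero _ fun w z ↦ ?_
      rw [hR, h1, h1, inner_zero_left, inner_zero_right, sub_zero]
  -- R vanishes on pairs from D: there only the t-components of w and z contribute, and the two
  -- terms cancel by symmetry of the inner product. Hence R(at + x, bt + y) = R(t, ay - bx).
  have hrR : LinearMap.range (exteriorPower.alternatingMapLinearEquiv R) = LinearMap.range ρ := by
    apply le_antisymm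
    · rw [LinearMap.range_eq_map, ← exteriorPower.ιMulti_span, Submodule.map_span, Submodule.span_le]
      rintro _ ⟨_, ⟨u, rfl⟩, rfl⟩
      rw [exteriorPower.alternatingMapLinearEquiv_apply_ιMulti]
      obtain ⟨a, x, hx, hu⟩ := hdec (u 0)
      obtain ⟨b, y, hy, hv⟩ := hdec (u 1)
      have hu' : u = ![u 0, u 1] := by ext i; fin_cases i <;> rfl
      refine ⟨⟨a • y - b • x, D.sub_mem (D.smul_mem a hy) (D.smul_mem b hx)⟩, ?_⟩
      rw [hρ, hu', ← sub_eq_zero]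
      refine hzero _ fun w z ↦ ?_
      obtain ⟨p, w', hw', rfl⟩ := hdec w
      obtain ⟨q, z', hz', rfl⟩ := hdec z
      rw [sub_apply, map_sub, inner_sub_left, hR, hR, hu, hv]
      simp only [map_add, map_smul, map_sub, add_apply,
        smul_apply, sub_apply, hND x hx _ hw',
        hND x hx _ hz', hND y hy _ hw', hND y hy _ hz', hN _ t, smul_zero, add_zero,
        sub_zero, inner_add_left, inner_add_right, inner_sub_left, inner_sub_right,
        inner_smul_left, inner_smul_right]
      have hc := real_inner_comm (N t x) (N t y)
      simp only [conj_trivial]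
      linear_combination (-q * p) * hc
    · rintro _ ⟨x, rfl⟩
      rw [hρ, ← exteriorPower.alternatingMapLinearEquiv_apply_ιMulti]
      exact ⟨_, rfl⟩
  have hrN : Submodule.span ℝ {ξ | ∃ v, ∃ w ∈ D, ξ = N v w} = LinearMap.range ν := by
    apply le_antisymm
    · rw [Submodule.span_le]
      rintro _ ⟨v, w, hw, rfl⟩
      obtain ⟨a, x, hx, rfl⟩ := hdec v
      refine ⟨a • ⟨w, hw⟩, ?_⟩
      rw [map_smul, map_add, map_smul, add_apply, hND x hx w hw, add_zero]
      rfl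
    · rintro _ ⟨x, rfl⟩
      exact Submodule.subset_span ⟨t, x, x.2, rfl⟩
  rw [hrR, hrN]
  have h1 := LinearMap.finrank_range_add_finrank_ker ρ
  have h2 := LinearMap.finrank_range_add_finrank_ker ν
  rw [hker] at h1
  omega

end Gauss

section Curvature

variable {n : ℕ} {M : Type*} [TopologicalSpace M] [ChartedSpace (Euc n) M]
  [IsManifold (𝓡 n) ∞ M]
variable {m d : ℕ} {g : SmoothMetric n M} {D : TangentSubspaces n M} {f : M → Euc m}

theorem IsIsometricImmersionOn.isPullbackMetricNear (hf : IsIsometricImmersionOn g f univ) (x : M) :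
    IsPullbackMetricNear (metricInChart g x) (f ∘ (extChartAt (𝓡 n) x).symm)
      (extChartAt (𝓡 n) x x) := by
  filter_upwards [extChartAt_target_mem_nhds x] with y hy u v
  rw [fderiv_chart hf hy, fderiv_chart hf hy, hf.isometric _ (mem_univ _)]
  rfl

/-- In the preferred chart the metric is induced by f, so the Gauss equation reduces the claim to
`finrank_range_alternating`. -/
theorem curvatureRank_eq (hf : IsIsometricImmersionOn g f univ) (x : M)
    (hD : Module.finrank ℝ (D x) + 1 = n)
    (hα : ∀ u ∈ D x, ∀ v ∈ D x, secondFundamentalForm f x u v = 0) :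
    curvatureRank g x = Module.finrank ℝ (rulingNormalSpace D f x) := by
  set φ := extChartAt (𝓡 n) x with hφ
  have hfx : ContMDiffAt (𝓡 n) 𝓘(ℝ, Euc m) ∞ f x := hf.contMDiffAt isOpen_univ (mem_univ _)
  have hs : ContDiffAt ℝ 3 (f ∘ φ.symm) (φ x) :=
    contDiffAt_comp_extChartAt_symm (r := 3) (hfx.of_le (by exact_mod_cast le_top))
  have hi : Function.Injective (fderiv ℝ (f ∘ φ.symm) (φ x)) :=
    fderiv_chart_injective hf (mem_extChartAt_target x)
  have hd : ∀ v : Euc n, fderiv ℝ (f ∘ φ.symm) (φ x) v = mvfderiv (𝓡 n) f x v := fun v ↦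
    fderiv_comp_extChartAt_symm (hfx.mdifferentiableAt (by simp)) v
  have hr : (fderiv ℝ (f ∘ φ.symm) (φ x)).rangeᗮ = normalSpace n f x := by
    rw [normalSpace]
    congr 1
    ext y
    exact ⟨fun ⟨v, hv⟩ ↦ ⟨v, (hd v).symm.trans hv⟩, fun ⟨v, hv⟩ ↦ ⟨v, (hd v).trans hv⟩⟩
  have hN : ∀ u v : Euc n, normalHessian (f ∘ φ.symm) (φ x) u v =
      secondFundamentalForm f x u v := fun u v ↦ by
    exact starProjection_congr hr _
  have h1 := finrank_range_alternating (R := curvatureAlternating (metricInChart g x) (φ x))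
    (D := D x) hi (N := normalHessian (f ∘ φ.symm) (φ x))
    (fun u v ↦ by
      rw [normalHessian_apply, normalHessian_apply, ContDiffAt.fderiv_fderiv_comm
        (hs.of_le (by norm_num))])
    (fun u v w z ↦ (hf.isPullbackMetricNear x).gauss hs hi u v w z)
    (by rw [finrank_euclideanSpace_fin]; exact hD)
    (fun u hu v hv ↦ (hN u v).trans (hα u hu v hv))
  have h2 : Submodule.span ℝ {ξ | ∃ v, ∃ w ∈ D x, ξ = normalHessian (f ∘ φ.symm) (φ x) v w} =
      rulingNormalSpace D f x := congrArg (Submodule.span ℝ) (Set.ext fun ξ ↦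
    ⟨fun ⟨v, w, hw, h⟩ ↦ ⟨v, w, hw, h.trans (hN v w)⟩,
      fun ⟨v, w, hw, h⟩ ↦ ⟨v, w, hw, h.trans (hN v w).symm⟩⟩)
  exact h1.trans (congrArg (fun K : Submodule ℝ (Euc m) ↦ Module.finrank ℝ K) h2)

end Curvature

end RuledComposition

namespace RuledComposition

open Set Filter Topology

/-! ### Congruent frames and rolling motions -/

section FrameComparison

variable {P X : Type*} [NormedAddCommGroup P] [NormedSpace ℝ P]
  [NormedAddCommGroup X] [NormedSpace ℝ X] [FiniteDimensional ℝ X] {k m : ℕ}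

/-- Two frames `A` and `A'` with the same inner products and the same connection coefficients; the
second one is a frame of the whole space. -/
structure AreCongruentFramesOn (A : P → X →L[ℝ] Euc m) (A' : P → X →L[ℝ] Euc k) (Ω : Set P) :
    Prop where
  smooth : ContDiffOn ℝ ∞ A Ω
  smooth' : ContDiffOn ℝ ∞ A' Ω
  surjective : ∀ p ∈ Ω, Function.Surjective (A' p)
  injective : ∀ p ∈ Ω, Function.Injective (A p)
  norm_eq : ∀ p ∈ Ω, ∀ v, ‖A p v‖ = ‖A' p v‖
  connection : ∀ p ∈ Ω, ∀ a v w,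
    inner ℝ (fderiv ℝ A p a v) (A p w) = inner ℝ (fderiv ℝ A' p a v) (A' p w)

variable {A : P → X →L[ℝ] Euc m} {A' : P → X →L[ℝ] Euc k} {Ω : Set P}

set_option linter.unusedSectionVars false in
theorem AreCongruentFramesOn.injective' (h : AreCongruentFramesOn A A' Ω) {p : P} (hp : p ∈ Ω) :
    Function.Injective (A' p) := by
  rw [injective_iff_map_eq_zero]
  intro v hv
  have h1 := h.norm_eq p hp v
  rw [hv, norm_zero, norm_eq_zero] at h1
  exact (injective_iff_map_eq_zero (A p)).1 (h.injective p hp) v h1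

theorem AreCongruentFramesOn.isInvertible (h : AreCongruentFramesOn A A' Ω) {p : P} (hp : p ∈ Ω) :
    (A' p).IsInvertible :=
  ⟨(LinearEquiv.ofBijective (A' p).toLinearMap
    ⟨h.injective' hp, h.surjective p hp⟩).toContinuousLinearEquiv,
    ContinuousLinearMap.ext fun _ ↦ rfl⟩

/-- The isometry carrying the frame `A'` to `A`, whose derivatives are orthogonal to its image. -/
theorem AreCongruentFramesOn.exists_isometry (h : AreCongruentFramesOn A A' Ω) (hΩ : IsOpen Ω) :
    ∃ τ : P → Euc k →L[ℝ] Euc m, ContDiffOn ℝ ∞ τ Ω ∧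
      ∀ p ∈ Ω, (∀ v, τ p (A' p v) = A p v) ∧ (∀ y, ‖τ p y‖ = ‖y‖) ∧
        (∀ a v, fderiv ℝ τ p a (A' p v) = fderiv ℝ A p a v - τ p (fderiv ℝ A' p a v)) ∧
        ∀ a y y', inner ℝ (fderiv ℝ τ p a y) (τ p y') = 0 := by
  have hτA : ∀ p ∈ Ω, ∀ v, ((A p).comp (A' p).inverse) (A' p v) = A p v := fun p hp v ↦ by
    rw [ContinuousLinearMap.comp_apply, (h.isInvertible hp).inverse_apply_eq.2 rfl]
  have hτs : ContDiffOn ℝ ∞ (fun p ↦ (A p).comp (A' p).inverse) Ω :=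
    h.smooth.clm_comp (ContDiffOn.clm_inverse h.smooth' fun p hp ↦ h.isInvertible hp)
  have hτn : ∀ p ∈ Ω, ∀ y, ‖((A p).comp (A' p).inverse) y‖ = ‖y‖ := fun p hp y ↦ by
    obtain ⟨v, rfl⟩ := h.surjective p hp y
    rw [hτA p hp, h.norm_eq p hp]
  -- This is the product rule for τA' = A. The last claim follows from it, because equal connection
  -- coefficients cancel in the inner product with τA'w = Aw.
  have hd : ∀ p ∈ Ω, ∀ a v, fderiv ℝ (fun p ↦ (A p).comp (A' p).inverse) p a (A' p v) =
      fderiv ℝ A p a v - ((A p).comp (A' p).inverse) (fderiv ℝ A' p a v) := by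
    intro p hp a v
    have d1 := ((hτs.differentiableOn (by simp)).differentiableAt (hΩ.mem_nhds hp)).hasFDerivAt
    have d2 := ((h.smooth.differentiableOn (by simp)).differentiableAt
      (hΩ.mem_nhds hp)).hasFDerivAt
    have d3 := ((h.smooth'.differentiableOn (by simp)).differentiableAt
      (hΩ.mem_nhds hp)).hasFDerivAt
    have e1 := d1.clm_apply (d3.clm_apply (hasFDerivAt_const v p))
    have e2 := d2.clm_apply (hasFDerivAt_const v p)
    have e3 : (fun p ↦ ((A p).comp (A' p).inverse) (A' p v)) =ᶠ[𝓝 p] fun p ↦ A p v := by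
      filter_upwards [hΩ.mem_nhds hp] with q hq using hτA q hq v
    have e4 := DFunLike.congr_fun (e1.unique (e2.congr_of_eventuallyEq e3)) a
    simp only [add_apply, ContinuousLinearMap.comp_apply,
      ContinuousLinearMap.flip_apply, zero_apply, map_zero, zero_add] at e4
    rw [← e4, ContinuousLinearMap.comp_apply, add_sub_cancel_left]
  refine ⟨_, hτs, fun p hp ↦ ⟨hτA p hp, hτn p hp, hd p hp, fun a y y' ↦ ?_⟩⟩
  obtain ⟨v, rfl⟩ := h.surjective p hp y
  obtain ⟨w, rfl⟩ := h.surjective p hp y'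
  rw [hd p hp, inner_sub_left, inner_map_of_norm_eq (hτn p hp), hτA p hp, h.connection p hp,
    sub_self]

end FrameComparison

section Rolling

variable {d k m : ℕ} {X : Type*} [NormedAddCommGroup X] [NormedSpace ℝ X] [FiniteDimensional ℝ X]

/-- If moreover the span of `A` is parallel along the second factor, the isometry only depends on
the first variable, and the two immersions differ by a rolling motion. -/
theorem AreCongruentFramesOn.exists_rolling {J : Set ℝ} {B : Set (Euc d)} (hJ : IsOpen J)
    (hB : IsOpen B) (hBc : Convex ℝ B) (hBne : B.Nonempty)
    {A : ℝ × Euc d → (ℝ × Euc d) × X →L[ℝ] Euc m} {A' : ℝ × Euc d → (ℝ × Euc d) × X →L[ℝ] Euc k}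
    (h : AreCongruentFramesOn A A' (J ×ˢ B)) {F : ℝ × Euc d → Euc m} {F' : ℝ × Euc d → Euc k}
    (hF : ContDiffOn ℝ ∞ F (J ×ˢ B)) (hF' : ContDiffOn ℝ ∞ F' (J ×ˢ B))
    (hAF : ∀ p ∈ J ×ˢ B, ∀ a, A p (a, 0) = fderiv ℝ F p a)
    (hAF' : ∀ p ∈ J ×ˢ B, ∀ a, A' p (a, 0) = fderiv ℝ F' p a)
    (hpar : ∀ p ∈ J ×ˢ B, ∀ (b : Euc d) v, fderiv ℝ A p ((0 : ℝ), b) v ∈ (A p).range) :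
    ∃ (τ : ℝ → Euc k →L[ℝ] Euc m) (c : ℝ → Euc m), IsRollingOn τ c J ∧
      (∀ p ∈ J ×ˢ B, F p = τ p.1 (F' p) + c p.1) ∧
      ∀ p ∈ J ×ˢ B, ∀ v, τ p.1 (A' p v) = A p v := by
  have hΩ : IsOpen (J ×ˢ B) := hJ.prod hB
  obtain ⟨T, hTs, hT⟩ := h.exists_isometry hΩ
  obtain ⟨s₀, hs₀⟩ := hBne
  have hTd : ∀ p ∈ J ×ˢ B, HasFDerivAt T (fderiv ℝ T p) p := fun p hp ↦
    ((hTs.differentiableOn (by simp)).differentiableAt (hΩ.mem_nhds hp)).hasFDerivAt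
  have hFd : ∀ p ∈ J ×ˢ B, HasFDerivAt F (fderiv ℝ F p) p := fun p hp ↦
    ((hF.differentiableOn (by simp)).differentiableAt (hΩ.mem_nhds hp)).hasFDerivAt
  have hF'd : ∀ p ∈ J ×ˢ B, HasFDerivAt F' (fderiv ℝ F' p) p := fun p hp ↦
    ((hF'.differentiableOn (by simp)).differentiableAt (hΩ.mem_nhds hp)).hasFDerivAt
  have hTF : ∀ p ∈ J ×ˢ B, ∀ a, T p (fderiv ℝ F' p a) = fderiv ℝ F p a := fun p hp a ↦ by
    rw [← hAF' p hp, ← hAF p hp, (hT p hp).1]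
  -- The derivative along the second factor lies in the range of T, because the span of A is
  -- parallel there, and it is orthogonal to that range; so it vanishes.
  have hT0 : ∀ p ∈ J ×ˢ B, ∀ b : Euc d, fderiv ℝ T p ((0 : ℝ), b) = 0 := by
    intro p hp b
    ext1 y
    obtain ⟨v, rfl⟩ := h.surjective p hp y
    have h1 : fderiv ℝ T p ((0 : ℝ), b) (A' p v) ∈ (T p).range := by
      rw [(hT p hp).2.2.1]
      refine Submodule.sub_mem _ ?_ ⟨_, rfl⟩
      obtain ⟨w, hw⟩ := hpar p hp b v
      exact ⟨A' p w, ((hT p hp).1 w).trans hw⟩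
    obtain ⟨w, hw⟩ := h1
    have h2 := (hT p hp).2.2.2 ((0 : ℝ), b) (A' p v) w
    have h3 : T p w = fderiv ℝ T p ((0 : ℝ), b) (A' p v) := hw
    rw [h3, inner_self_eq_zero] at h2
    exact h2
  have hslice : ∀ (t : ℝ) (s : Euc d), HasFDerivAt (fun s : Euc d ↦ (t, s))
      (ContinuousLinearMap.inr ℝ ℝ (Euc d)) s := fun t s ↦ hasFDerivAt_prodMk_right t s
  have hTc : ∀ t ∈ J, ∀ s ∈ B, T (t, s) = T (t, s₀) := fun t ht s hs ↦ by
    refine eq_of_hasFDerivAt_zero (f := fun s ↦ T (t, s)) hB hBc (fun s hs ↦ ?_) hs hs₀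
    have h1 := (hTd (t, s) ⟨ht, hs⟩).comp s (hslice t s)
    have h2 : (fderiv ℝ T (t, s)).comp (ContinuousLinearMap.inr ℝ ℝ (Euc d)) = 0 := by
      ext1 b
      exact hT0 (t, s) ⟨ht, hs⟩ b
    rw [← h2]
    exact h1
  have hline : ∀ t : ℝ, HasDerivAt (fun t : ℝ ↦ (t, s₀)) ((1 : ℝ), (0 : Euc d)) t := fun t ↦
    (hasDerivAt_id' t).prodMk (hasDerivAt_const t s₀)
  have hlineC : ContDiffOn ℝ ∞ (fun t : ℝ ↦ (t, s₀)) J := contDiffOn_id.prodMk contDiffOn_const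
  have hmaps : MapsTo (fun t : ℝ ↦ (t, s₀)) J (J ×ˢ B) := fun t ht ↦ ⟨ht, hs₀⟩
  have hτd : ∀ t ∈ J, HasDerivAt (fun t ↦ T (t, s₀)) (fderiv ℝ T (t, s₀) (1, 0)) t := fun t ht ↦
    HasFDerivAt.comp_hasDerivAt (f := fun t : ℝ ↦ (t, s₀)) t (hTd (t, s₀) ⟨ht, hs₀⟩) (hline t)
  -- Since T dF' = dF, only the derivative of T survives, and this is orthogonal to the image of T.
  have hcd : ∀ t ∈ J, HasDerivAt (fun t ↦ F (t, s₀) - T (t, s₀) (F' (t, s₀)))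
      (-(fderiv ℝ T (t, s₀) (1, 0) (F' (t, s₀)))) t := fun t ht ↦ by
    have hp : (t, s₀) ∈ J ×ˢ B := ⟨ht, hs₀⟩
    have h1 := HasFDerivAt.comp_hasDerivAt (f := fun t : ℝ ↦ (t, s₀)) t (hFd _ hp) (hline t)
    have h2 := HasFDerivAt.comp_hasDerivAt (f := fun t : ℝ ↦ (t, s₀)) t (hF'd _ hp) (hline t)
    have h3 := h1.sub ((hτd t ht).clm_apply h2)
    have h4 : fderiv ℝ F (t, s₀) (1, 0) - (fderiv ℝ T (t, s₀) (1, 0) (F' (t, s₀)) +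
        T (t, s₀) (fderiv ℝ F' (t, s₀) (1, 0))) = -(fderiv ℝ T (t, s₀) (1, 0) (F' (t, s₀))) := by
      rw [hTF _ hp]
      abel
    rw [← h4]
    exact h3
  refine ⟨fun t ↦ T (t, s₀), fun t ↦ F (t, s₀) - T (t, s₀) (F' (t, s₀)), ⟨hTs.comp hlineC hmaps,
    (hF.comp hlineC hmaps).sub ((hTs.comp hlineC hmaps).clm_apply (hF'.comp hlineC hmaps)),
    fun t ht ↦ (hT _ (hmaps ht)).2.1, fun t ht v w ↦ ?_, fun t ht w ↦ ?_⟩, ?_, ?_⟩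
  · rw [(hτd t ht).deriv]
    exact (hT _ (hmaps ht)).2.2.2 _ _ _
  · rw [(hcd t ht).deriv, inner_neg_left, (hT _ (hmaps ht)).2.2.2, neg_zero]
  · rintro ⟨t, s⟩ ⟨ht, hs⟩
    have h1 : F (t, s) - T (t, s₀) (F' (t, s)) = F (t, s₀) - T (t, s₀) (F' (t, s₀)) := by
      refine eq_of_hasFDerivAt_zero (f := fun s ↦ F (t, s) - T (t, s₀) (F' (t, s))) hB hBc
        (fun s hs ↦ ?_) hs hs₀
      have hp : (t, s) ∈ J ×ˢ B := ⟨ht, hs⟩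
      have h2 := ((hFd _ hp).comp s (hslice t s)).sub
        ((T (t, s₀)).hasFDerivAt.comp s ((hF'd _ hp).comp s (hslice t s)))
      have h3 : (fderiv ℝ F (t, s)).comp (ContinuousLinearMap.inr ℝ ℝ (Euc d)) -
          (T (t, s₀)).comp ((fderiv ℝ F' (t, s)).comp (ContinuousLinearMap.inr ℝ ℝ (Euc d))) =
          0 := by
        ext1 b
        simp only [sub_apply, ContinuousLinearMap.comp_apply, zero_apply]
        rw [← hTc t ht s hs, hTF _ hp, sub_self]
      rw [← h3]
      exact h2
    change F (t, s) = T (t, s₀) (F' (t, s)) + (F (t, s₀) - T (t, s₀) (F' (t, s₀)))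
    rw [← h1, add_sub_cancel]
  · rintro ⟨t, s⟩ ⟨ht, hs⟩ v
    change T (t, s₀) _ = _
    rw [← hTc t ht s hs, (hT _ ⟨ht, hs⟩).1]

/-- Rolling motions and immersions: composition near a point where the motion is not stationary to
second order. -/
theorem IsRollingOn.exists_extension {τ : ℝ → Euc k →L[ℝ] Euc m} {c : ℝ → Euc m} {J : Set ℝ}
    (h : IsRollingOn τ c J) {B : Set (Euc d)} (hJ : IsOpen J) (hB : IsOpen B)
    {F : ℝ × Euc d → Euc m} {F' : ℝ × Euc d → Euc k} (hF : ContDiffOn ℝ ∞ F (J ×ˢ B))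
    (hF' : ContDiffOn ℝ ∞ F' (J ×ˢ B)) (hFF' : ∀ p ∈ J ×ˢ B, F p = τ p.1 (F' p) + c p.1)
    (hd : ∀ p ∈ J ×ˢ B, ∀ a, fderiv ℝ F p a = τ p.1 (fderiv ℝ F' p a)) :
    (∀ p ∈ J ×ˢ B, velocity τ c (F' p) p.1 = 0) ∧
    ∀ p ∈ J ×ˢ B, deriv τ p.1 (fderiv ℝ F' p (1, 0)) ≠ 0 →
      ∃ (N : Set (ℝ × Euc d)) (W : Set (Euc k)) (e : Euc k → Euc m), N ∈ 𝓝 p ∧ IsOpen W ∧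
        F' '' N ⊆ W ∧ ContDiffOn ℝ ∞ e W ∧
        (∀ y ∈ W, ∀ v w : Euc k, inner ℝ (fderiv ℝ e y v) (fderiv ℝ e y w) = inner ℝ v w) ∧
        ∀ q ∈ N, F q = e (F' q) := by
  have hΩ : IsOpen (J ×ˢ B) := hJ.prod hB
  have hline : ∀ p : ℝ × Euc d, HasDerivAt (fun t : ℝ ↦ (t, p.2)) ((1 : ℝ), (0 : Euc d)) p.1 :=
    fun p ↦ (hasDerivAt_id' p.1).prodMk (hasDerivAt_const p.1 p.2)
  have hFd : ∀ p ∈ J ×ˢ B, HasDerivAt (fun t ↦ F (t, p.2)) (fderiv ℝ F p (1, 0)) p.1 := fun p hp ↦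
    HasFDerivAt.comp_hasDerivAt (f := fun t : ℝ ↦ (t, p.2)) p.1
      ((hF.differentiableOn (by simp)).differentiableAt (hΩ.mem_nhds hp)).hasFDerivAt (hline p)
  have hF'd : ∀ p ∈ J ×ˢ B, HasDerivAt (fun t ↦ F' (t, p.2)) (fderiv ℝ F' p (1, 0)) p.1 :=
    fun p hp ↦ HasFDerivAt.comp_hasDerivAt (f := fun t : ℝ ↦ (t, p.2)) p.1
      ((hF'.differentiableOn (by simp)).differentiableAt (hΩ.mem_nhds hp)).hasFDerivAt (hline p)
  -- Differentiating F = τF' + c in t, the terms dF and τ dF' cancel and leave the velocity at F'.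
  have hv : ∀ p ∈ J ×ˢ B, velocity τ c (F' p) p.1 = 0 := by
    intro p hp
    have h1 := ((h.hasDerivAt_linear hJ hp.1).clm_apply (hF'd p hp)).add
      (h.hasDerivAt_vector hJ hp.1)
    have h2 : (fun t ↦ F (t, p.2)) =ᶠ[𝓝 p.1] fun t ↦ τ t (F' (t, p.2)) + c t := by
      filter_upwards [hJ.mem_nhds hp.1] with t ht using hFF' (t, p.2) ⟨ht, hp.2⟩
    have h3 := (hFd p hp).unique (h1.congr_of_eventuallyEq h2)
    rw [hd p hp] at h3
    have h4 : deriv τ p.1 (F' p) + τ p.1 (fderiv ℝ F' p (1, 0)) + deriv c p.1 =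
        τ p.1 (fderiv ℝ F' p (1, 0)) := h3.symm
    rw [velocity]
    have h5 : deriv τ p.1 (F' p) + deriv c p.1 =
        deriv τ p.1 (F' p) + τ p.1 (fderiv ℝ F' p (1, 0)) + deriv c p.1 -
          τ p.1 (fderiv ℝ F' p (1, 0)) := by abel
    rw [h5, h4, sub_self]
  refine ⟨hv, fun p hp hne ↦ ?_⟩
  -- The velocity vanishes along t ↦ F'(t, s); differentiating there relates the acceleration of the
  -- fixed point F'(p) to τ'(∂_t F').
  have hacc : deriv (velocity τ c (F' p)) p.1 = -deriv τ p.1 (fderiv ℝ F' p (1, 0)) := by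
    have h0 : HasDerivAt (fun t ↦ velocity τ c (F' (t, p.2)) t) 0 p.1 :=
      (hasDerivAt_const p.1 (0 : Euc m)).congr_of_eventuallyEq
        (by filter_upwards [hJ.mem_nhds hp.1] with t ht using hv (t, p.2) ⟨ht, hp.2⟩)
    have hτ' : DifferentiableAt ℝ (deriv τ) p.1 :=
      ((h.smooth_linear.deriv_of_isOpen (m := ∞) hJ (by simp)).differentiableOn
        (by simp)).differentiableAt (hJ.mem_nhds hp.1)
    have hc' : DifferentiableAt ℝ (deriv c) p.1 :=
      ((h.smooth_vector.deriv_of_isOpen (m := ∞) hJ (by simp)).differentiableOn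
        (by simp)).differentiableAt (hJ.mem_nhds hp.1)
    have h1 := (hτ'.hasDerivAt.clm_apply (hF'd p hp)).add hc'.hasDerivAt
    have h2 := (hτ'.hasDerivAt.clm_apply (hasDerivAt_const p.1 (F' p))).add hc'.hasDerivAt
    have h3 : deriv (deriv τ) p.1 (F' p) + deriv τ p.1 (fderiv ℝ F' p (1, 0)) +
      deriv (deriv c) p.1 = 0 := h1.unique h0
    have h4 : deriv (velocity τ c (F' p)) p.1 = deriv (deriv τ) p.1 (F' p) + deriv τ p.1 0 +
      deriv (deriv c) p.1 := h2.deriv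
    rw [h4, eq_neg_iff_add_eq_zero, ← h3, map_zero]
    abel
  have hkm : k ≤ m := by
    have := LinearMap.finrank_le_finrank_of_injective
      (f := (τ p.1).toLinearMap) (injective_of_norm_eq (h.isometric p.1 hp.1))
    simpa using this
  obtain ⟨W, J', e, hW, hyW, hJ', htJ', hJJ', hes, hei, he⟩ := h.hasFlatExtension (m - k) (by omega)
    hJ hp.1 (hv p hp) (by rw [hacc]; exact neg_ne_zero.2 hne)
  refine ⟨(J' ×ˢ B) ∩ ((J ×ˢ B) ∩ F' ⁻¹' W), W, e, inter_mem ((hJ'.prod hB).mem_nhds ⟨htJ', hp.2⟩)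
    ((hF'.continuousOn.isOpen_inter_preimage hΩ hW).mem_nhds ⟨hp, hyW⟩), hW, ?_, hes, hei, ?_⟩
  · rintro _ ⟨q, hq, rfl⟩
    exact hq.2.2
  · rintro q ⟨hq, hqΩ, hqW⟩
    rw [hFF' q hqΩ, he q.1 hq.1 _ hqW (hv q hqΩ)]

end Rolling

end RuledComposition

namespace RuledComposition

open Set Filter Topology

theorem inner_add_sum_smul {m ℓ : ℕ} (e e' : Euc ℓ) (u u' : Euc m) (Y Y' : Fin ℓ → Euc m) :
    inner ℝ (u + ∑ i, e i • Y i) (u' + ∑ i, e' i • Y' i) =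
      inner ℝ u u' + ∑ i, e' i * inner ℝ u (Y' i) + ∑ i, e i * inner ℝ (Y i) u' +
        ∑ i, ∑ j, e i * (e' j * inner ℝ (Y i) (Y' j)) := by
  simp only [inner_add_left, inner_add_right, sum_inner, inner_sum, real_inner_smul_left,
    real_inner_smul_right, Finset.sum_add_distrib]
  rw [Finset.sum_comm (f := fun i j ↦ e' i * (e j * inner ℝ (Y j) (Y' i)))]
  simp only [mul_left_comm]
  ring

/-! ### The frame of an immersion together with normal fields -/

section ImmersionFrame

variable {P : Type*} [NormedAddCommGroup P] [NormedSpace ℝ P] {k m ℓ : ℕ}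

/-- The frame formed by the derivatives of `F` and the vector fields `X i` along `F`. -/
noncomputable def immersionFrame (F : P → Euc m) (X : Fin ℓ → P → Euc m) (p : P) :
    P × Euc ℓ →L[ℝ] Euc m :=
  (fderiv ℝ F p).coprod (∑ i, (EuclideanSpace.proj i : Euc ℓ →L[ℝ] ℝ).smulRight (X i p))

theorem immersionFrame_apply (F : P → Euc m) (X : Fin ℓ → P → Euc m) (p : P) (v : P × Euc ℓ) :
    immersionFrame F X p v = fderiv ℝ F p v.1 + ∑ i, v.2 i • X i p := by
  simp [immersionFrame]

variable {F : P → Euc m} {X : Fin ℓ → P → Euc m} {F' : P → Euc k} {X' : Fin ℓ → P → Euc k}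
  {Ω : Set P}

theorem contDiffOn_immersionFrame (hΩ : IsOpen Ω) (hF : ContDiffOn ℝ ∞ F Ω)
    (hX : ∀ i, ContDiffOn ℝ ∞ (X i) Ω) : ContDiffOn ℝ ∞ (immersionFrame F X) Ω := by
  have h1 : immersionFrame F X = fun p ↦
      (fderiv ℝ F p).comp (ContinuousLinearMap.fst ℝ P (Euc ℓ)) +
        (∑ i, (EuclideanSpace.proj i : Euc ℓ →L[ℝ] ℝ).smulRight (X i p)).comp
          (ContinuousLinearMap.snd ℝ P (Euc ℓ)) := by
    ext1 p
    refine ContinuousLinearMap.ext fun v ↦ ?_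
    simp [immersionFrame]
  rw [h1]
  exact ((hF.fderiv_of_isOpen hΩ (by simp)).clm_comp contDiffOn_const).add
    ((ContDiffOn.sum fun i _ ↦ contDiffOn_const.smulRight (hX i)).clm_comp contDiffOn_const)

theorem fderiv_immersionFrame (hΩ : IsOpen Ω) (hF : ContDiffOn ℝ ∞ F Ω)
    (hX : ∀ i, ContDiffOn ℝ ∞ (X i) Ω) {p : P} (hp : p ∈ Ω) (a : P) (v : P × Euc ℓ) :
    fderiv ℝ (immersionFrame F X) p a v =
      fderiv ℝ (fderiv ℝ F) p a v.1 + ∑ i, v.2 i • fderiv ℝ (X i) p a := by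
  have h1 : HasFDerivAt (immersionFrame F X) (fderiv ℝ (immersionFrame F X) p) p :=
    (((contDiffOn_immersionFrame hΩ hF hX).differentiableOn (by simp)).differentiableAt
      (hΩ.mem_nhds hp)).hasFDerivAt
  have h2 : HasFDerivAt (fderiv ℝ F) (fderiv ℝ (fderiv ℝ F) p) p :=
    (((hF.fderiv_of_isOpen (m := ∞) hΩ (by simp)).differentiableOn (by simp)).differentiableAt
      (hΩ.mem_nhds hp)).hasFDerivAt
  have h3 : ∀ i, HasFDerivAt (X i) (fderiv ℝ (X i) p) p := fun i ↦
    (((hX i).differentiableOn (by simp)).differentiableAt (hΩ.mem_nhds hp)).hasFDerivAt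
  have h4 := h1.clm_apply (hasFDerivAt_const v p)
  have h5 := (h2.clm_apply (hasFDerivAt_const v.1 p)).add
    (HasFDerivAt.fun_sum (u := Finset.univ) fun i _ ↦ (h3 i).const_smul (v.2 i))
  have h6 : (fun q ↦ immersionFrame F X q v) = fun q ↦ fderiv ℝ F q v.1 + ∑ i, v.2 i • X i q :=
    funext fun q ↦ immersionFrame_apply F X q v
  rw [h6] at h4
  have h7 := DFunLike.congr_fun (h4.unique h5) a
  simpa using h7

theorem immersionFrame_injective {p : P} (hi : Function.Injective (fderiv ℝ F p))
    (hli : LinearIndependent ℝ fun i ↦ X i p)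
    (hFX : ∀ a i, inner ℝ (fderiv ℝ F p a) (X i p) = 0) :
    Function.Injective (immersionFrame F X p) := by
  rw [injective_iff_map_eq_zero]
  rintro ⟨a, e⟩ h
  rw [immersionFrame_apply] at h
  have h1 : inner ℝ (fderiv ℝ F p a) (∑ i, e i • X i p) = 0 := by
    simp only [inner_sum, real_inner_smul_right, hFX, mul_zero, Finset.sum_const_zero]
  have h2 : fderiv ℝ F p a = 0 := by
    have h3 : inner ℝ (fderiv ℝ F p a) (fderiv ℝ F p a + ∑ i, e i • X i p) = 0 := by
      rw [h, inner_zero_right]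
    rwa [inner_add_right, h1, add_zero, inner_self_eq_zero] at h3
  rw [h2, zero_add] at h
  have h4 := Fintype.linearIndependent_iff.1 hli _ h
  rw [(injective_iff_map_eq_zero _).1 hi a h2]
  congr 1
  ext i
  exact h4 i

/-- As in the uniqueness part of the fundamental theorem of submanifolds, all connection
coefficients are determined by the data: the tangential ones by the metric, the mixed ones by the
second fundamental form, up to sign, and the normal ones by the normal connection. -/
theorem areCongruentFramesOn_immersionFrame [FiniteDimensional ℝ P] (hΩ : IsOpen Ω)
    (hk : k = Module.finrank ℝ P + ℓ) (hF : ContDiffOn ℝ ∞ F Ω) (hF' : ContDiffOn ℝ ∞ F' Ω)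
    (hX : ∀ i, ContDiffOn ℝ ∞ (X i) Ω) (hX' : ∀ i, ContDiffOn ℝ ∞ (X' i) Ω)
    (hi : ∀ p ∈ Ω, Function.Injective (fderiv ℝ F p))
    (hli : ∀ p ∈ Ω, LinearIndependent ℝ fun i ↦ X i p)
    (hFF : ∀ p ∈ Ω, ∀ a b, inner ℝ (fderiv ℝ F p a) (fderiv ℝ F p b) =
      inner ℝ (fderiv ℝ F' p a) (fderiv ℝ F' p b))
    (hFX : ∀ p ∈ Ω, ∀ a i, inner ℝ (fderiv ℝ F p a) (X i p) = 0)
    (hFX' : ∀ p ∈ Ω, ∀ a i, inner ℝ (fderiv ℝ F' p a) (X' i p) = 0)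
    (hXX : ∀ p ∈ Ω, ∀ i j, inner ℝ (X i p) (X j p) = inner ℝ (X' i p) (X' j p))
    (hα : ∀ p ∈ Ω, ∀ a b i, inner ℝ (fderiv ℝ (fderiv ℝ F) p a b) (X i p) =
      inner ℝ (fderiv ℝ (fderiv ℝ F') p a b) (X' i p))
    (hω : ∀ p ∈ Ω, ∀ a i j, inner ℝ (fderiv ℝ (X i) p a) (X j p) =
      inner ℝ (fderiv ℝ (X' i) p a) (X' j p)) :
    AreCongruentFramesOn (immersionFrame F X) (immersionFrame F' X') Ω := by
  have hinner : ∀ p ∈ Ω, ∀ v w, inner ℝ (immersionFrame F X p v) (immersionFrame F X p w) =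
      inner ℝ (immersionFrame F' X' p v) (immersionFrame F' X' p w) := by
    intro p hp v w
    rw [immersionFrame_apply, immersionFrame_apply, immersionFrame_apply, immersionFrame_apply,
      inner_add_sum_smul, inner_add_sum_smul]
    simp only [hFF p hp, hFX p hp, hFX' p hp, hXX p hp, fun i a ↦
      (real_inner_comm (fderiv ℝ F p a) (X i p)), fun i a ↦
      (real_inner_comm (fderiv ℝ F' p a) (X' i p))]
  have hnorm : ∀ p ∈ Ω, ∀ v, ‖immersionFrame F X p v‖ = ‖immersionFrame F' X' p v‖ :=
    fun p hp v ↦ by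
      rw [norm_eq_sqrt_real_inner, norm_eq_sqrt_real_inner, hinner p hp]
  have hinj : ∀ p ∈ Ω, Function.Injective (immersionFrame F X p) := fun p hp ↦
    immersionFrame_injective (hi p hp) (hli p hp) (hFX p hp)
  -- The Weingarten relation, from differentiating ⟨dF(b), X⟩ = 0.
  have hXF : ∀ {m : ℕ} {F : P → Euc m} {X : Fin ℓ → P → Euc m}, ContDiffOn ℝ ∞ F Ω →
      (∀ i, ContDiffOn ℝ ∞ (X i) Ω) → (∀ p ∈ Ω, ∀ a i, inner ℝ (fderiv ℝ F p a) (X i p) = 0) →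
      ∀ p ∈ Ω, ∀ a b i, inner ℝ (fderiv ℝ (X i) p a) (fderiv ℝ F p b) =
        -inner ℝ (fderiv ℝ (fderiv ℝ F) p a b) (X i p) := by
    intro m F X hF hX hFX p hp a b i
    have h2 : HasFDerivAt (fderiv ℝ F) (fderiv ℝ (fderiv ℝ F) p) p :=
      (((hF.fderiv_of_isOpen (m := ∞) hΩ (by simp)).differentiableOn (by simp)).differentiableAt
        (hΩ.mem_nhds hp)).hasFDerivAt
    have h3 : HasFDerivAt (X i) (fderiv ℝ (X i) p) p :=
      (((hX i).differentiableOn (by simp)).differentiableAt (hΩ.mem_nhds hp)).hasFDerivAt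
    have h4 := (h2.clm_apply (hasFDerivAt_const b p)).inner ℝ h3
    have h5 : (fun q ↦ inner ℝ (fderiv ℝ F q b) (X i q)) =ᶠ[𝓝 p] fun _ ↦ 0 := by
      filter_upwards [hΩ.mem_nhds hp] with q hq using hFX q hq b i
    have h6 := DFunLike.congr_fun (h4.unique ((hasFDerivAt_const (0 : ℝ) p).congr_of_eventuallyEq
      h5)) a
    simp at h6
    rw [real_inner_comm]
    linarith
  refine ⟨contDiffOn_immersionFrame hΩ hF hX, contDiffOn_immersionFrame hΩ hF' hX', fun p hp ↦ ?_,
    hinj, hnorm, fun p hp a v w ↦ ?_⟩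
  · have h1 : Function.Injective (immersionFrame F' X' p).toLinearMap := by
      rw [injective_iff_map_eq_zero]
      intro v hv
      refine (injective_iff_map_eq_zero _).1 (hinj p hp) v ?_
      rw [← norm_eq_zero, hnorm p hp, norm_eq_zero]
      exact hv
    exact (LinearMap.injective_iff_surjective_of_finrank_eq_finrank (by simp [hk])).1 h1
  · have hsymm : ∀ {m : ℕ} {F : P → Euc m}, ContDiffOn ℝ ∞ F Ω → ContDiffAt ℝ 2 F p := fun hF ↦
      (hF.contDiffAt (hΩ.mem_nhds hp)).of_le ENat.LEInfty.out
    -- Both sides are the first Christoffel symbol of the same induced metric.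
    have hkoszul : inner ℝ (fderiv ℝ (fderiv ℝ F) p a v.1) (fderiv ℝ F p w.1) =
        inner ℝ (fderiv ℝ (fderiv ℝ F') p a v.1) (fderiv ℝ F' p w.1) := by
      have h1 : IsPullbackMetricNear (fun q ↦ (innerSL ℝ (E := Euc m)).bilinearComp
          (fderiv ℝ F q) (fderiv ℝ F q)) F p := Eventually.of_forall fun q u v ↦ by simp
      have h2 : IsPullbackMetricNear (fun q ↦ (innerSL ℝ (E := Euc m)).bilinearComp
          (fderiv ℝ F q) (fderiv ℝ F q)) F' p := by
        filter_upwards [hΩ.mem_nhds hp] with q hq u v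
        simp [hFF q hq]
      rw [← h1.christoffelFirst (hsymm hF), h2.christoffelFirst (hsymm hF')]
    rw [immersionFrame_apply, immersionFrame_apply, fderiv_immersionFrame hΩ hF hX hp,
      fderiv_immersionFrame hΩ hF' hX' hp, inner_add_sum_smul,
      inner_add_sum_smul, hkoszul]
    simp only [hα p hp, hω p hp, hXF hF hX hFX p hp, hXF hF' hX' hFX' p hp]

end ImmersionFrame

end RuledComposition

namespace RuledComposition

open Set Filter Topology

theorem inner_starProjection_of_mem {E : Type*} [NormedAddCommGroup E] [InnerProductSpace ℝ E]
    {K : Submodule ℝ E} [K.HasOrthogonalProjection] (v : E) {y : E} (hy : y ∈ K) :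
    inner ℝ (K.starProjection v) y = inner ℝ v y := by
  rw [Submodule.inner_starProjection_left_eq_right, Submodule.starProjection_eq_self_iff.2 hy]

theorem inner_map_of_norm_eq_on {E F : Type*} [NormedAddCommGroup E] [InnerProductSpace ℝ E]
    [NormedAddCommGroup F] [InnerProductSpace ℝ F] {K : Submodule ℝ E} {σ : E →ₗ[ℝ] F}
    (h : ∀ x ∈ K, ‖σ x‖ = ‖x‖) {x y : E} (hx : x ∈ K) (hy : y ∈ K) :
    inner ℝ (σ x) (σ y) = inner ℝ x y :=
  LinearIsometry.inner_map_map (⟨σ.domRestrict K, fun z ↦ h z z.2⟩ : K →ₗᵢ[ℝ] F) ⟨x, hx⟩ ⟨y, hy⟩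

/-! ### Reductions are rolling motions -/

section ReductionRolling

variable {n : ℕ} {M : Type*} [TopologicalSpace M] [ChartedSpace (Euc n) M]
  [IsManifold (𝓡 n) ∞ M]
variable {m d : ℕ} {g : SmoothMetric n M} {D : TangentSubspaces n M} {f : M → Euc m} {J : Set ℝ}
  {B : Set (Euc d)}
  {G : ℝ × Euc d → M} {κ : M → ℝ × Euc d} {c : ℝ → Euc m} {W : ℝ → Euc d →L[ℝ] Euc m}

theorem secondFundamentalForm_comm {x : M} (hf : ContMDiffAt (𝓡 n) 𝓘(ℝ, Euc m) ∞ f x)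
    (v w : TangentSpace (𝓡 n) x) :
    secondFundamentalForm f x v w = secondFundamentalForm f x w v := by
  have h1 : ContDiffAt ℝ 2 (f ∘ (extChartAt (𝓡 n) x).symm) (extChartAt (𝓡 n) x x) :=
    contDiffAt_comp_extChartAt_symm (r := 2) (hf.of_le ENat.LEInfty.out)
  exact congrArg (normalSpace n f x).starProjection (ContDiffAt.fderiv_fderiv_comm h1 v w)

variable {k : ℕ} {f' : M → Euc k}

theorem IsRuledBox.inner_fderiv (h : IsRuledBox D f J B G κ c W)
    (hf' : IsIsometricImmersionOn g f' (G '' (J ×ˢ B))) {p : ℝ × Euc d} (hp : p ∈ J ×ˢ B)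
    (a b : ℝ × Euc d) :
    inner ℝ (fderiv ℝ (f' ∘ G) p a) (fderiv ℝ (f' ∘ G) p b) =
      g.inner (G p) (mfderiv 𝓘(ℝ, ℝ × Euc d) (𝓡 n) G p a)
        (mfderiv 𝓘(ℝ, ℝ × Euc d) (𝓡 n) G p b) := by
  have hfm : MDifferentiableAt (𝓡 n) 𝓘(ℝ, Euc k) f' (G p) :=
    (hf'.contMDiffAt h.isOpen_image ⟨p, hp, rfl⟩).mdifferentiableAt (by simp)
  rw [fderiv_comp_param hfm (h.mdifferentiableAt_param hp),
    fderiv_comp_param hfm (h.mdifferentiableAt_param hp)]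
  exact hf'.isometric _ ⟨p, hp, rfl⟩ _ _

theorem IsRuledBox.normalSpace_eq (h : IsRuledBox D f J B G κ c W) (hn : d + 1 = n)
    (hf' : IsIsometricImmersionOn g f' (G '' (J ×ˢ B))) {p : ℝ × Euc d} (hp : p ∈ J ×ˢ B) :
    normalSpace n f' (G p) = (fderiv ℝ (f' ∘ G) p).rangeᗮ :=
  normalSpace_param ((hf'.contMDiffAt h.isOpen_image ⟨p, hp, rfl⟩).mdifferentiableAt (by simp))
    (h.mdifferentiableAt_param hp) (h.bijective_mfderiv hn hp).2

theorem IsRuledBox.fderiv_injective (h : IsRuledBox D f J B G κ c W) (hn : d + 1 = n)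
    (hf' : IsIsometricImmersionOn g f' (G '' (J ×ˢ B))) {p : ℝ × Euc d} (hp : p ∈ J ×ˢ B) :
    Function.Injective (fderiv ℝ (f' ∘ G) p) := by
  intro a b hab
  have hfm : MDifferentiableAt (𝓡 n) 𝓘(ℝ, Euc k) f' (G p) :=
    (hf'.contMDiffAt h.isOpen_image ⟨p, hp, rfl⟩).mdifferentiableAt (by simp)
  rw [fderiv_comp_param hfm (h.mdifferentiableAt_param hp),
    fderiv_comp_param hfm (h.mdifferentiableAt_param hp)] at hab
  exact (h.bijective_mfderiv hn hp).1 (hf'.injective ⟨p, hp, rfl⟩ hab)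

theorem IsRuledBox.secondFundamentalForm_eq (h : IsRuledBox D f J B G κ c W)
    (hf' : IsIsometricImmersionOn g f' (G '' (J ×ˢ B))) {p : ℝ × Euc d} (hp : p ∈ J ×ˢ B)
    (a b : ℝ × Euc d) :
    secondFundamentalForm f' (G p) (mfderiv 𝓘(ℝ, ℝ × Euc d) (𝓡 n) G p a)
      (mfderiv 𝓘(ℝ, ℝ × Euc d) (𝓡 n) G p b) =
      (normalSpace n f' (G p)).starProjection (fderiv ℝ (fderiv ℝ (f' ∘ G)) p a b) :=
  secondFundamentalForm_param
    ((hf'.contMDiffAt h.isOpen_image ⟨p, hp, rfl⟩).of_le ENat.LEInfty.out)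
    ((h.contMDiffAt_param hp).of_le ENat.LEInfty.out) a b

/-- The vectors whose normal component is in the span of `X` are those in the span of the frame. -/
theorem mem_range_immersionFrame {P : Type*} [NormedAddCommGroup P] [NormedSpace ℝ P] {ℓ : ℕ}
    [FiniteDimensional ℝ P] {F : P → Euc m} {X : Fin ℓ → P → Euc m} {p : P}
    (hFX : ∀ i, X i p ∈ (fderiv ℝ F p).rangeᗮ) (y : Euc m) :
    y ∈ (immersionFrame F X p).range ↔ (fderiv ℝ F p).rangeᗮ.starProjection y ∈
      Submodule.span ℝ (range fun i ↦ X i p) := by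
  have h0 : ∀ a, (fderiv ℝ F p).rangeᗮ.starProjection (fderiv ℝ F p a) = 0 := fun a ↦ by
    rw [Submodule.starProjection_apply_eq_zero_iff]
    exact Submodule.le_orthogonal_orthogonal _ ⟨a, rfl⟩
  constructor
  · rintro ⟨⟨a, e⟩, rfl⟩
    change (fderiv ℝ F p).rangeᗮ.starProjection (immersionFrame F X p (a, e)) ∈ _
    rw [immersionFrame_apply, map_add, h0, zero_add, map_sum]
    refine Submodule.sum_mem _ fun i _ ↦ ?_
    rw [map_smul, Submodule.starProjection_eq_self_iff.2 (hFX i)]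
    exact Submodule.smul_mem _ _ (Submodule.subset_span ⟨i, rfl⟩)
  · intro h
    obtain ⟨e, he⟩ := (Submodule.mem_span_range_iff_exists_fun ℝ).1 h
    have h1 : y - (fderiv ℝ F p).rangeᗮ.starProjection y ∈ (fderiv ℝ F p).range := by
      have := Submodule.sub_starProjection_mem_orthogonal (K := (fderiv ℝ F p).rangeᗮ) y
      rwa [Submodule.orthogonal_orthogonal] at this
    obtain ⟨a, ha⟩ := h1
    have ha' : fderiv ℝ F p a = y - (fderiv ℝ F p).rangeᗮ.starProjection y := ha
    refine ⟨(a, WithLp.toLp 2 e), ?_⟩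
    change immersionFrame F X p (a, WithLp.toLp 2 e) = y
    rw [immersionFrame_apply]
    simp only
    rw [he, ha', sub_add_cancel]

/-- A reduction of a ruled immersion to a normal subbundle that is parallel along the ruling and
contains `L_D` is obtained by a rolling motion. -/
theorem IsRuledBox.exists_rolling (h : IsRuledBox D f J B G κ c W) (hn : d + 1 = n)
    (hBne : B.Nonempty) {ℓ : ℕ} (hk : k = n + ℓ) {L : M → Submodule ℝ (Euc m)}
    {σ : M → Euc m →ₗ[ℝ] Euc k} (hf : IsIsometricImmersionOn g f (G '' (J ×ˢ B)))
    (hf' : IsIsometricImmersionOn g f' (G '' (J ×ˢ B)))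
    (hσ : IsParallelBundleIsometryOn n f L f' σ (G '' (J ×ˢ B)))
    (hform : ∀ x ∈ G '' (J ×ˢ B), ∀ v w : TangentSpace (𝓡 n) x,
      secondFundamentalForm f' x v w =
        σ x ((L x).starProjection (secondFundamentalForm f x v w)))
    (hLN : ∀ x ∈ G '' (J ×ˢ B), L x ≤ normalSpace n f x)
    {ξ : Fin ℓ → M → Euc m} (hξ : ∀ i, IsSmoothSectionOn n L (ξ i) (G '' (J ×ˢ B)))
    (hξL : ∀ x ∈ G '' (J ×ˢ B), LinearIndependent ℝ (fun i ↦ ξ i x) ∧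
      Submodule.span ℝ (range fun i ↦ ξ i x) = L x)
    (hLD : ∀ x ∈ G '' (J ×ˢ B), rulingNormalSpace D f x ≤ L x)
    (hpar : IsParallelAlongOn f D L (G '' (J ×ˢ B))) :
    ∃ (τ : ℝ → Euc k →L[ℝ] Euc m) (c' : ℝ → Euc m), IsRollingOn τ c' J ∧
      (∀ p ∈ J ×ˢ B, f (G p) = τ p.1 (f' (G p)) + c' p.1) ∧
      (∀ p ∈ J ×ˢ B, ∀ a, fderiv ℝ (f ∘ G) p a = τ p.1 (fderiv ℝ (f' ∘ G) p a)) ∧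
      ∀ p ∈ J ×ˢ B, ∀ y, y ∈ (τ p.1).range ↔
        (normalSpace n f (G p)).starProjection y ∈ L (G p) := by
  have hU := h.isOpen_image
  have hΩ := h.isOpen_domain
  have hm : ∀ p ∈ J ×ˢ B, G p ∈ G '' (J ×ˢ B) := fun p hp ↦ ⟨p, hp, rfl⟩
  let X : Fin ℓ → ℝ × Euc d → Euc m := fun i ↦ ξ i ∘ G
  let X' : Fin ℓ → ℝ × Euc d → Euc k := fun i ↦ (fun x ↦ σ x (ξ i x)) ∘ G
  have hFs : ContDiffOn ℝ ∞ (f ∘ G) (J ×ˢ B) := h.contDiffOn_comp hf.smooth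
  have hF's : ContDiffOn ℝ ∞ (f' ∘ G) (J ×ˢ B) := h.contDiffOn_comp hf'.smooth
  have hX : ∀ i, ContDiffOn ℝ ∞ (X i) (J ×ˢ B) := fun i ↦ h.contDiffOn_comp (hξ i).1
  have hσs : ∀ i, ContMDiffOn (𝓡 n) 𝓘(ℝ, Euc k) ∞ (fun x ↦ σ x (ξ i x)) (G '' (J ×ˢ B)) :=
    fun i ↦ hσ.smooth _ hU subset_rfl (ξ i) (hξ i)
  have hX' : ∀ i, ContDiffOn ℝ ∞ (X' i) (J ×ˢ B) := fun i ↦ h.contDiffOn_comp (hσs i)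
  have hXL : ∀ p ∈ J ×ˢ B, ∀ i, X i p ∈ L (G p) := fun p hp i ↦ (hξ i).2 _ (hm p hp)
  have hXN : ∀ p ∈ J ×ˢ B, ∀ i, X i p ∈ normalSpace n f (G p) := fun p hp i ↦
    hLN _ (hm p hp) (hXL p hp i)
  have hX'N : ∀ p ∈ J ×ˢ B, ∀ i, X' i p ∈ normalSpace n f' (G p) := fun p hp i ↦ by
    rw [← hσ.onto _ (hm p hp)]
    exact ⟨X i p, hXL p hp i, rfl⟩
  have hσi : ∀ p ∈ J ×ˢ B, ∀ y ∈ L (G p), ∀ i,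
      inner ℝ (σ (G p) y) (X' i p) = inner ℝ y (X i p) := fun p hp y hy i ↦
    inner_map_of_norm_eq_on (hσ.isometric _ (hm p hp)) hy (hXL p hp i)
  have hperp : ∀ {k : ℕ} {f' : M → Euc k}, IsIsometricImmersionOn g f' (G '' (J ×ˢ B)) →
      ∀ p ∈ J ×ˢ B, ∀ y ∈ normalSpace n f' (G p), ∀ a,
        inner ℝ (fderiv ℝ (f' ∘ G) p a) y = 0 := by
    intro k f' hf' p hp y hy a
    rw [h.normalSpace_eq hn hf' hp, Submodule.mem_orthogonal] at hy
    exact hy _ ⟨a, rfl⟩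
  have hproj : ∀ p ∈ J ×ˢ B, ∀ v i, inner ℝ ((L (G p)).starProjection
      ((normalSpace n f (G p)).starProjection v)) (X i p) = inner ℝ v (X i p) := fun p hp v i ↦ by
    rw [inner_starProjection_of_mem _ (hXL p hp i), inner_starProjection_of_mem _ (hXN p hp i)]
  have hframes : AreCongruentFramesOn (immersionFrame (f ∘ G) X) (immersionFrame (f' ∘ G) X')
      (J ×ˢ B) := by
    refine areCongruentFramesOn_immersionFrame hΩ (by simp; omega) hFs hF's hX hX'
      (fun p hp ↦ h.fderiv_injective hn hf hp) (fun p hp ↦ (hξL _ (hm p hp)).1)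
      (fun p hp a b ↦ by rw [h.inner_fderiv hf hp, h.inner_fderiv hf' hp])
      (fun p hp a i ↦ hperp hf p hp _ (hXN p hp i) a)
      (fun p hp a i ↦ hperp hf' p hp _ (hX'N p hp i) a)
      (fun p hp i j ↦ (hσi p hp _ (hXL p hp i) j).symm) ?_ ?_
    · intro p hp a b i
      rw [← inner_starProjection_of_mem (fderiv ℝ (fderiv ℝ (f' ∘ G)) p a b) (hX'N p hp i),
        ← h.secondFundamentalForm_eq hf' hp, hform _ (hm p hp), hσi p hp _
        (Submodule.starProjection_apply_mem _ _), h.secondFundamentalForm_eq hf hp, hproj p hp]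
    · intro p hp a i j
      rw [← inner_starProjection_of_mem (fderiv ℝ (X' i) p a) (hX'N p hp j),
        ← normalDeriv_param (((hσs i).contMDiffAt (hU.mem_nhds (hm p hp))).mdifferentiableAt
          (by simp)) (h.mdifferentiableAt_param hp),
        hσ.parallel _ hU subset_rfl (ξ i) (hξ i) _ (hm p hp), hσi p hp _
        (Submodule.starProjection_apply_mem _ _),
        normalDeriv_param (((hξ i).1.contMDiffAt (hU.mem_nhds (hm p hp))).mdifferentiableAt
          (by simp)) (h.mdifferentiableAt_param hp), hproj p hp]
  have hrange : ∀ p ∈ J ×ˢ B, ∀ y, y ∈ (immersionFrame (f ∘ G) X p).range ↔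
      (normalSpace n f (G p)).starProjection y ∈ L (G p) := by
    intro p hp y
    rw [mem_range_immersionFrame (fun i ↦ by rw [← h.normalSpace_eq hn hf hp]; exact hXN p hp i),
      starProjection_congr (h.normalSpace_eq hn hf hp).symm]
    have h1 : Submodule.span ℝ (range fun i ↦ X i p) = L (G p) := (hξL _ (hm p hp)).2
    rw [h1]
  obtain ⟨τ, c', hroll, hτ, hτA⟩ := hframes.exists_rolling h.isOpen_time h.isOpen_space
    h.convex_space hBne hFs hF's
    (fun p _ a ↦ by rw [immersionFrame_apply]; simp)
    (fun p _ a ↦ by rw [immersionFrame_apply]; simp) (by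
      intro p hp b v
      rw [fderiv_immersionFrame hΩ hFs hX hp]
      have hbD : mfderiv 𝓘(ℝ, ℝ × Euc d) (𝓡 n) G p ((0 : ℝ), b) ∈ D (G p) :=
        (h.distribution p hp _).2 ⟨b, rfl⟩
      -- The span of the frame is parallel along D for two reasons: the normal part of the
      -- derivative of a tangent field is a value of α(D, TM), in L_D ≤ L, and that of a section of
      -- L is in L by hypothesis.
      refine Submodule.add_mem _ ?_ (Submodule.sum_mem _ fun i _ ↦ Submodule.smul_mem _ _ ?_)
      · rw [hrange p hp, ← h.secondFundamentalForm_eq hf hp,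
          secondFundamentalForm_comm (hf.contMDiffAt hU (hm p hp))]
        exact hLD _ (hm p hp) (Submodule.subset_span ⟨_, _, hbD, rfl⟩)
      · rw [hrange p hp, ← normalDeriv_param (((hξ i).1.contMDiffAt
          (hU.mem_nhds (hm p hp))).mdifferentiableAt (by simp)) (h.mdifferentiableAt_param hp)]
        exact hpar _ hU subset_rfl (ξ i) (hξ i) _ (hm p hp) _ hbD)
  refine ⟨τ, c', hroll, hτ, fun p hp a ↦ ?_, fun p hp y ↦ ?_⟩
  · have h1 := hτA p hp (a, 0)
    rw [immersionFrame_apply, immersionFrame_apply] at h1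
    simpa using h1.symm
  · rw [← hrange p hp]
    constructor
    · rintro ⟨w, rfl⟩
      obtain ⟨v, rfl⟩ := hframes.surjective p hp w
      exact ⟨v, (hτA p hp v).symm⟩
    · rintro ⟨v, rfl⟩
      exact ⟨_, hτA p hp v⟩

end ReductionRolling

end RuledComposition

namespace RuledComposition

open Set Filter Topology

/-! ### Composition near a point where α leaves L -/

section Restriction

variable {n : ℕ} {M : Type*} [TopologicalSpace M] [ChartedSpace (Euc n) M]
  [IsManifold (𝓡 n) ∞ M]
variable {m k d : ℕ} {g : SmoothMetric n M} {D : TangentSubspaces n M} {f : M → Euc m}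
  {f' : M → Euc k} {L : M → Submodule ℝ (Euc m)} {σ : M → Euc m →ₗ[ℝ] Euc k} {U V : Set M}

set_option linter.unusedSectionVars false

theorem IsIsometricImmersionOn.mono (h : IsIsometricImmersionOn g f V) (hUV : U ⊆ V) :
    IsIsometricImmersionOn g f U :=
  ⟨h.smooth.mono hUV, fun x hx ↦ h.isometric x (hUV hx)⟩

theorem IsParallelBundleIsometryOn.mono (h : IsParallelBundleIsometryOn n f L f' σ V)
    (hUV : U ⊆ V) : IsParallelBundleIsometryOn n f L f' σ U :=
  ⟨fun x hx ↦ h.onto x (hUV hx), fun x hx ↦ h.isometric x (hUV hx),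
    fun N hN hNU ↦ h.smooth N hN (hNU.trans hUV),
    fun N hN hNU ↦ h.parallel N hN (hNU.trans hUV)⟩

theorem IsParallelAlongOn.mono (h : IsParallelAlongOn f D L V) (hUV : U ⊆ V) :
    IsParallelAlongOn f D L U :=
  fun N hN hNU ↦ h N hN (hNU.trans hUV)

theorem IsTotallyGeodesicOn.mono (h : IsTotallyGeodesicOn g D V) (hUV : U ⊆ V) :
    IsTotallyGeodesicOn g D U :=
  fun N hN hNU ↦ h N hN (hNU.trans hUV)

theorem IsSmoothDistributionOn.mono (h : IsSmoothDistributionOn D d V) (hU : IsOpen U)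
    (hUV : U ⊆ V) : IsSmoothDistributionOn D d U := fun x hx ↦ by
  obtain ⟨N, hN, hxN, -, Y, hY, hYD⟩ := h x (hUV hx)
  exact ⟨N ∩ U, hN.inter hU, ⟨hxN, hx⟩, inter_subset_right, Y,
    fun i ↦ ContMDiffOn.mono (hY i) inter_subset_left, fun z hz ↦ hYD z hz.1⟩

end Restriction

/-- The second derivative of an immersion in terms of that of its development. -/
theorem fderiv_fderiv_of_rolling {d k m : ℕ} {τ : ℝ → Euc k →L[ℝ] Euc m} {J : Set ℝ}
    {B : Set (Euc d)} (hJ : IsOpen J) (hB : IsOpen B) (hτ : ContDiffOn ℝ ∞ τ J)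
    {F : ℝ × Euc d → Euc m} {F' : ℝ × Euc d → Euc k} (hF : ContDiffOn ℝ ∞ F (J ×ˢ B))
    (hF' : ContDiffOn ℝ ∞ F' (J ×ˢ B))
    (hd : ∀ p ∈ J ×ˢ B, ∀ a, fderiv ℝ F p a = τ p.1 (fderiv ℝ F' p a)) {p : ℝ × Euc d}
    (hp : p ∈ J ×ˢ B) (a b : ℝ × Euc d) :
    fderiv ℝ (fderiv ℝ F) p a b =
      a.1 • deriv τ p.1 (fderiv ℝ F' p b) + τ p.1 (fderiv ℝ (fderiv ℝ F') p a b) := by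
  have hΩ : IsOpen (J ×ˢ B) := hJ.prod hB
  have h2 : HasFDerivAt (fderiv ℝ F) (fderiv ℝ (fderiv ℝ F) p) p :=
    (((hF.fderiv_of_isOpen (m := ∞) hΩ (by simp)).differentiableOn (by simp)).differentiableAt
      (hΩ.mem_nhds hp)).hasFDerivAt
  have h3 : HasFDerivAt (fderiv ℝ F') (fderiv ℝ (fderiv ℝ F') p) p :=
    (((hF'.fderiv_of_isOpen (m := ∞) hΩ (by simp)).differentiableOn (by simp)).differentiableAt
      (hΩ.mem_nhds hp)).hasFDerivAt
  have h4 : HasFDerivAt (fun q : ℝ × Euc d ↦ τ q.1)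
      ((ContinuousLinearMap.toSpanSingleton ℝ (deriv τ p.1)).comp
        (ContinuousLinearMap.fst ℝ ℝ (Euc d))) p := by
    have h5 : HasFDerivAt τ (ContinuousLinearMap.toSpanSingleton ℝ (deriv τ p.1)) p.1 :=
      ((hτ.differentiableOn (by simp)).differentiableAt
        (hJ.mem_nhds hp.1)).hasDerivAt.hasFDerivAt
    exact h5.comp p hasFDerivAt_fst
  have h6 := h4.clm_apply (h3.clm_apply (hasFDerivAt_const b p))
  have h7 : (fun q ↦ fderiv ℝ F q b) =ᶠ[𝓝 p] fun q ↦ τ q.1 (fderiv ℝ F' q b) := by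
    filter_upwards [hΩ.mem_nhds hp] with q hq using hd q hq b
  have h8 := DFunLike.congr_fun ((h2.clm_apply (hasFDerivAt_const b p)).unique
    (h6.congr_of_eventuallyEq h7)) a
  simp only [add_apply, ContinuousLinearMap.comp_apply, ContinuousLinearMap.flip_apply,
    zero_apply, map_zero, zero_add, ContinuousLinearMap.coe_fst',
    ContinuousLinearMap.toSpanSingleton_apply, smul_apply] at h8
  rw [h8, add_comm]

section LocalComposition

variable {n : ℕ} {M : Type*} [TopologicalSpace M] [ChartedSpace (Euc n) M]
  [IsManifold (𝓡 n) ∞ M]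
variable {m d k : ℕ} {g : SmoothMetric n M} {D : TangentSubspaces n M} {f : M → Euc m} {J : Set ℝ}
  {B : Set (Euc d)}
  {G : ℝ × Euc d → M} {κ : M → ℝ × Euc d} {c : ℝ → Euc m} {W : ℝ → Euc d →L[ℝ] Euc m}
  {f' : M → Euc k}

set_option linter.unusedSectionVars false in
theorem IsRuledBox.exists_isCompositionOn (h : IsRuledBox D f J B G κ c W)
    {τ : ℝ → Euc k →L[ℝ] Euc m} {c' : ℝ → Euc m} (hroll : IsRollingOn τ c' J)
    (hF : ContDiffOn ℝ ∞ (f ∘ G) (J ×ˢ B)) (hF' : ContDiffOn ℝ ∞ (f' ∘ G) (J ×ˢ B))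
    (hτ : ∀ p ∈ J ×ˢ B, f (G p) = τ p.1 (f' (G p)) + c' p.1)
    (hd : ∀ p ∈ J ×ˢ B, ∀ a, fderiv ℝ (f ∘ G) p a = τ p.1 (fderiv ℝ (f' ∘ G) p a))
    {p : ℝ × Euc d} (hp : p ∈ J ×ˢ B) (hne : deriv τ p.1 (fderiv ℝ (f' ∘ G) p (1, 0)) ≠ 0) :
    ∃ J' B', IsRuledBox D f J' B' G κ c W ∧ p ∈ J' ×ˢ B' ∧ J' ⊆ J ∧ B' ⊆ B ∧
      IsCompositionOn f f' (G '' (J' ×ˢ B')) := by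
  obtain ⟨-, hext⟩ := hroll.exists_extension h.isOpen_time h.isOpen_space hF hF' hτ hd
  obtain ⟨N, Z, e, hN, hZ, hNZ, hes, hei, he⟩ := hext p hp hne
  obtain ⟨J', B', hbox, hp', hJ', hB', hsub⟩ := h.exists_subbox hp hN
  refine ⟨J', B', hbox, hp', hJ', hB', Z, e, hZ, ?_, hes, hei, ?_⟩
  · rintro _ ⟨_, ⟨q, hq, rfl⟩, rfl⟩
    exact hNZ ⟨q, hsub hq, rfl⟩
  · rintro _ ⟨q, hq, rfl⟩
    exact he q (hsub hq)

/-- If the second fundamental form takes values outside of `L`, the motion that develops `f` onto a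
reduction is not stationary. -/
theorem IsRuledBox.deriv_rolling_ne_zero (h : IsRuledBox D f J B G κ c W) (hn : d + 1 = n)
    (hf : IsIsometricImmersionOn g f (G '' (J ×ˢ B)))
    (hf' : IsIsometricImmersionOn g f' (G '' (J ×ˢ B))) {L : M → Submodule ℝ (Euc m)}
    (hLD : ∀ x ∈ G '' (J ×ˢ B), rulingNormalSpace D f x ≤ L x)
    {τ : ℝ → Euc k →L[ℝ] Euc m} (hτ : ContDiffOn ℝ ∞ τ J)
    (hd : ∀ p ∈ J ×ˢ B, ∀ a, fderiv ℝ (f ∘ G) p a = τ p.1 (fderiv ℝ (f' ∘ G) p a))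
    (hr : ∀ p ∈ J ×ˢ B, ∀ y, y ∈ (τ p.1).range →
        (normalSpace n f (G p)).starProjection y ∈ L (G p)) {p : ℝ × Euc d} (hp : p ∈ J ×ˢ B)
    (hα : ∃ v w : TangentSpace (𝓡 n) (G p), secondFundamentalForm f (G p) v w ∉ L (G p)) :
    deriv τ p.1 (fderiv ℝ (f' ∘ G) p (1, 0)) ≠ 0 := by
  intro h0
  obtain ⟨v, w, hvw⟩ := hα
  obtain ⟨a, rfl⟩ := (h.bijective_mfderiv hn hp).2 v
  obtain ⟨b, rfl⟩ := (h.bijective_mfderiv hn hp).2 w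
  have hm : G p ∈ G '' (J ×ˢ B) := ⟨p, hp, rfl⟩
  have hbD : ∀ s : Euc d, mfderiv 𝓘(ℝ, ℝ × Euc d) (𝓡 n) G p ((0 : ℝ), s) ∈ D (G p) := fun s ↦
    (h.distribution p hp _).2 ⟨s, rfl⟩
  have h1 : ∀ a s, (normalSpace n f (G p)).starProjection
      (fderiv ℝ (fderiv ℝ (f ∘ G)) p a ((0 : ℝ), s)) ∈ L (G p) := fun a s ↦ by
    rw [← h.secondFundamentalForm_eq hf hp]
    exact hLD _ hm (Submodule.subset_span ⟨_, _, hbD s, rfl⟩)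
  have h2 : ContDiffAt ℝ 2 (f ∘ G) p := ((h.contDiffOn_comp hf.smooth).contDiffAt
    (h.isOpen_domain.mem_nhds hp)).of_le ENat.LEInfty.out
  -- If τ'(∂_t f') were zero, ∂_t²f would be τ(∂_t²f'), with normal part in L. The remaining
  -- components of α involve D, so they lie in L_D ≤ L, and α would take all its values in L at p.
  have h3 : (normalSpace n f (G p)).starProjection
      (fderiv ℝ (fderiv ℝ (f ∘ G)) p (1, 0) (1, 0)) ∈ L (G p) := by
    apply hr p hp
    rw [fderiv_fderiv_of_rolling h.isOpen_time h.isOpen_space hτ (h.contDiffOn_comp hf.smooth)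
      (h.contDiffOn_comp hf'.smooth) hd hp, h0, smul_zero, zero_add]
    exact ⟨_, rfl⟩
  refine hvw ((?_ : ∀ a b : ℝ × Euc d, secondFundamentalForm f (G p)
    (mfderiv 𝓘(ℝ, ℝ × Euc d) (𝓡 n) G p a) (mfderiv 𝓘(ℝ, ℝ × Euc d) (𝓡 n) G p b) ∈ L (G p)) a b)
  intro a b
  have hdec : ∀ a : ℝ × Euc d, a = a.1 • ((1 : ℝ), (0 : Euc d)) + ((0 : ℝ), a.2) := fun a ↦ by
    simp
  rw [h.secondFundamentalForm_eq hf hp, hdec b, map_add, map_add]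
  refine Submodule.add_mem _ ?_ (h1 _ _)
  rw [map_smul, map_smul, ContDiffAt.fderiv_fderiv_comm h2, hdec a, map_add, map_add, map_smul,
    map_smul]
  exact Submodule.smul_mem _ _ (Submodule.add_mem _ (Submodule.smul_mem _ _ h3) (h1 _ _))

/-- This is (i): in a box around x the reduction is a rolling motion, whose acceleration at x is
nonzero because α leaves L there, so the flat extension applies. -/
theorem IsRuledOn.exists_composition (hn : d + 1 = n) (hf : IsIsometricImmersionOn g f univ)
    (hD : IsRuledOn g D d f univ) {V : Set M} {ℓ : ℕ} (hk : k = n + ℓ)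
    {L : M → Submodule ℝ (Euc m)} {σ : M → Euc m →ₗ[ℝ] Euc k}
    (hL : IsNormalSubbundleOn n f L ℓ V) (hpar : IsParallelAlongOn f D L V)
    (hLD : ∀ x ∈ V, rulingNormalSpace D f x ≤ L x)
    (hred : IsRuledReductionOn g D d f L f' σ V) {x : M} (hx : x ∈ V)
    (hα : ∃ v w : TangentSpace (𝓡 n) x, secondFundamentalForm f x v w ∉ L x) :
    ∃ U : Set M, IsOpen U ∧ x ∈ U ∧ U ⊆ V ∧ IsCompositionOn f f' U := by
  obtain ⟨N, hN, hxN, hNV, ξ, hξ, hξL⟩ := hL.smooth x hx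
  obtain ⟨J, B, G, κ, c, W, h, h0J, h0B, rfl, hGN⟩ := hD.exists_box hn hf x hN hxN
  have hGV := hGN.trans hNV
  have h0 : (0 : ℝ × Euc d) ∈ J ×ˢ B := ⟨h0J, h0B⟩
  have hf₁ := hf.mono (subset_univ (G '' (J ×ˢ B)))
  have hf₂ := hred.immersion.mono hGV
  obtain ⟨τ, c', hroll, hτ, hd, hr⟩ := h.exists_rolling hn ⟨0, h0B⟩ hk hf₁ hf₂
    (hred.isometry.mono hGV) (fun x hx ↦ hred.form x (hGV hx)) (fun x hx ↦ hL.normal x (hGV hx))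
    (fun i ↦ ⟨(hξ i).1.mono hGN, fun z hz ↦ (hξ i).2 z (hGN hz)⟩) (fun x hx ↦ hξL x (hGN hx))
    (fun x hx ↦ hLD x (hGV hx)) (hpar.mono hGV)
  obtain ⟨J', B', hbox, hp', hJ', hB', hcomp⟩ := h.exists_isCompositionOn hroll
    (h.contDiffOn_comp hf₁.smooth) (h.contDiffOn_comp hf₂.smooth) hτ hd h0
    (h.deriv_rolling_ne_zero hn hf₁ hf₂ (fun x hx ↦ hLD x (hGV hx)) hroll.smooth_linear hd
      (fun p hp y ↦ (hr p hp y).1) h0 hα)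
  exact ⟨_, hbox.isOpen_image, ⟨0, hp', rfl⟩, (image_mono (prod_mono hJ' hB')).trans hGV, hcomp⟩

end LocalComposition

end RuledComposition

namespace RuledComposition

open Set Filter Topology

/-! ### Constant rank and the osculating spaces of a ruled immersion -/

/-- A linear map restricted to a suitable complement of its kernel. -/
theorem exists_injective_restriction {X V : Type*} [NormedAddCommGroup X] [NormedSpace ℝ X]
    [NormedAddCommGroup V] [InnerProductSpace ℝ V] [FiniteDimensional ℝ V]
    (Φ : X →L[ℝ] V) {k : ℕ} (hk : Module.finrank ℝ Φ.range = k) :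
    ∃ ι : Euc k →L[ℝ] X, Function.Injective (Φ.comp ι) := by
  obtain ⟨r, hr⟩ := LinearMap.exists_rightInverse_of_surjective Φ.toLinearMap.rangeRestrict
    Φ.toLinearMap.range_rangeRestrict
  let b : Euc k ≃L[ℝ] Φ.range := ContinuousLinearEquiv.ofFinrankEq (by simp [hk])
  refine ⟨(r.comp b.toLinearEquiv.toLinearMap).toContinuousLinearMap, fun x y hxy ↦ ?_⟩
  have h1 : ∀ x, Φ (r (b x)) = b x := fun x ↦ congrArg Subtype.val (DFunLike.congr_fun hr (b x))
  have h2 : Φ (r (b x)) = Φ (r (b y)) := hxy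
  rw [h1, h1] at h2
  exact b.injective (Subtype.ext h2)

/-- A smooth curve of linear maps has constant rank on some interval, and its image is there the
image of a smooth curve of injective linear maps. -/
theorem exists_constant_rank {X : Type*} [NormedAddCommGroup X] [NormedSpace ℝ X] {m : ℕ}
    {Φ : ℝ → X →L[ℝ] Euc m} {J : Set ℝ} (hJ : IsOpen J) (hne : J.Nonempty)
    (hΦ : ContDiffOn ℝ ∞ Φ J) :
    ∃ (k : ℕ) (t₀ : ℝ) (J' : Set ℝ) (A : ℝ → Euc k →L[ℝ] Euc m), IsOpen J' ∧ t₀ ∈ J' ∧ J' ⊆ J ∧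
      ContDiffOn ℝ ∞ A J' ∧ ∀ t ∈ J', Function.Injective (A t) ∧ (A t).range = (Φ t).range := by
  -- At a point of maximal rank, injectivity on a complement of the kernel is an open condition, so
  -- the rank cannot drop nearby; by maximality it cannot grow.
  obtain ⟨t₀, ht₀, hmax⟩ : ∃ t₀ ∈ J, ∀ t ∈ J,
      Module.finrank ℝ (Φ t).range ≤ Module.finrank ℝ (Φ t₀).range := by
    have hbdd : BddAbove ((fun t ↦ Module.finrank ℝ (Φ t).range) '' J) :=
      ⟨m, by
        rintro _ ⟨t, -, rfl⟩
        simpa using Submodule.finrank_le (Φ t).range⟩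
    obtain ⟨t₀, ht₀, h⟩ := Nat.sSup_mem (hne.image _) hbdd
    exact ⟨t₀, ht₀, fun t ht ↦ (le_csSup hbdd ⟨t, ht, rfl⟩).trans h.ge⟩
  obtain ⟨ι, hι⟩ := exists_injective_restriction (Φ t₀) rfl
  have hA : ContDiffOn ℝ ∞ (fun t ↦ (Φ t).comp ι) J := hΦ.clm_comp contDiffOn_const
  refine ⟨_, t₀, J ∩ (fun t ↦ (Φ t).comp ι) ⁻¹' {A | Function.Injective A}, _,
    hA.continuousOn.isOpen_inter_preimage hJ ContinuousLinearMap.isOpen_injective, ⟨ht₀, hι⟩,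
    inter_subset_left, hA.mono inter_subset_left, fun t ht ↦ ⟨ht.2, ?_⟩⟩
  apply Submodule.eq_of_le_of_finrank_le
  · rintro _ ⟨x, rfl⟩
    exact ⟨ι x, rfl⟩
  · rw [LinearMap.finrank_range_of_inj (f := ((Φ t).comp ι).toLinearMap) ht.2]
    simpa using hmax t ht.1

section RuledMaps

variable {d m : ℕ}

/-- The map whose image is spanned by the derivative of the base curve, the rulings and their
derivatives. -/
noncomputable def osculatingMap (c : ℝ → Euc m) (W : ℝ → Euc d →L[ℝ] Euc m) (t : ℝ) :
    ℝ × Euc d × Euc d →L[ℝ] Euc m :=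
  (ContinuousLinearMap.toSpanSingleton ℝ (deriv c t)).comp (ContinuousLinearMap.fst ℝ _ _) +
    ((W t).comp ((ContinuousLinearMap.fst ℝ _ _).comp (ContinuousLinearMap.snd ℝ _ _)) +
    (deriv W t).comp ((ContinuousLinearMap.snd ℝ _ _).comp (ContinuousLinearMap.snd ℝ _ _)))

theorem osculatingMap_apply (c : ℝ → Euc m) (W : ℝ → Euc d →L[ℝ] Euc m) (t : ℝ)
    (v : ℝ × Euc d × Euc d) :
    osculatingMap c W t v = v.1 • deriv c t + (W t v.2.1 + deriv W t v.2.2) := rfl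

theorem contDiffOn_osculatingMap {c : ℝ → Euc m} {W : ℝ → Euc d →L[ℝ] Euc m} {J : Set ℝ}
    (hJ : IsOpen J) (hc : ContDiffOn ℝ ∞ c J) (hW : ContDiffOn ℝ ∞ W J) :
    ContDiffOn ℝ ∞ (osculatingMap c W) J := by
  have h1 : ContDiffOn ℝ ∞ (fun t ↦ ContinuousLinearMap.toSpanSingleton ℝ (deriv c t)) J :=
    (ContinuousLinearMap.toSpanSingletonCLE (𝕜 := ℝ) (E := Euc m)).contDiff.comp_contDiffOn
      (hc.deriv_of_isOpen hJ (by simp))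
  exact (h1.clm_comp contDiffOn_const).add ((hW.clm_comp contDiffOn_const).add
    ((hW.deriv_of_isOpen hJ (by simp)).clm_comp contDiffOn_const))

theorem fderiv_ruled {c : ℝ → Euc m} {W : ℝ → Euc d →L[ℝ] Euc m} {c' : Euc m}
    {W' : Euc d →L[ℝ] Euc m} {p : ℝ × Euc d} (hc : HasDerivAt c c' p.1) (hW : HasDerivAt W W' p.1)
    (a : ℝ × Euc d) :
    fderiv ℝ (fun q : ℝ × Euc d ↦ c q.1 + W q.1 q.2) p a = a.1 • (c' + W' p.2) + W p.1 a.2 := by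
  have h1 : HasFDerivAt (fun q : ℝ × Euc d ↦ c q.1) _ p := hc.hasFDerivAt.comp p hasFDerivAt_fst
  have h2 : HasFDerivAt (fun q : ℝ × Euc d ↦ W q.1) _ p := hW.hasFDerivAt.comp p hasFDerivAt_fst
  have h3 := h1.add (h2.clm_apply hasFDerivAt_snd)
  have h4 : fderiv ℝ (fun q : ℝ × Euc d ↦ c q.1 + W q.1 q.2) p = _ := h3.fderiv
  rw [h4]
  simp [smul_add]
  abel

end RuledMaps

section RuledBoxForm

variable {n : ℕ} {M : Type*} [TopologicalSpace M] [ChartedSpace (Euc n) M]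
  [IsManifold (𝓡 n) ∞ M]
variable {m d : ℕ} {g : SmoothMetric n M} {D : TangentSubspaces n M} {f : M → Euc m} {J : Set ℝ}
  {B : Set (Euc d)}
  {G : ℝ × Euc d → M} {κ : M → ℝ × Euc d} {c : ℝ → Euc m} {W : ℝ → Euc d →L[ℝ] Euc m}

set_option linter.unusedSectionVars false

theorem IsRuledBox.hasDerivAt_base (h : IsRuledBox D f J B G κ c W) {t : ℝ} (ht : t ∈ J) :
    HasDerivAt c (deriv c t) t :=
  ((h.smooth_base.differentiableOn (by simp)).differentiableAt
    (h.isOpen_time.mem_nhds ht)).hasDerivAt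

theorem IsRuledBox.hasDerivAt_ruling (h : IsRuledBox D f J B G κ c W) {t : ℝ} (ht : t ∈ J) :
    HasDerivAt W (deriv W t) t :=
  ((h.smooth_ruling.differentiableOn (by simp)).differentiableAt
    (h.isOpen_time.mem_nhds ht)).hasDerivAt

theorem IsRuledBox.fderiv_eq (h : IsRuledBox D f J B G κ c W) {p : ℝ × Euc d} (hp : p ∈ J ×ˢ B)
    (a : ℝ × Euc d) :
    fderiv ℝ (f ∘ G) p a = a.1 • (deriv c p.1 + deriv W p.1 p.2) + W p.1 a.2 := by
  have h1 : f ∘ G =ᶠ[𝓝 p] fun q ↦ c q.1 + W q.1 q.2 := by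
    filter_upwards [h.isOpen_domain.mem_nhds hp] with q hq using h.ruled q hq
  rw [h1.fderiv_eq, fderiv_ruled (h.hasDerivAt_base hp.1) (h.hasDerivAt_ruling hp.1)]

theorem IsRuledBox.contDiffOn_immersion (h : IsRuledBox D f J B G κ c W) :
    ContDiffOn ℝ ∞ (f ∘ G) (J ×ˢ B) := by
  have h1 : ContDiffOn ℝ ∞ (fun p : ℝ × Euc d ↦ c p.1 + W p.1 p.2) (J ×ˢ B) :=
    (h.smooth_base.comp contDiffOn_fst fun p hp ↦ hp.1).add
      ((h.smooth_ruling.comp contDiffOn_fst fun p hp ↦ hp.1).clm_apply contDiffOn_snd)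
  exact h1.congr fun p hp ↦ h.ruled p hp

/-- The derivative of f along a ruling direction s is W(t)s, independent of the position on the
ruling, so only its derivative in t remains. -/
theorem IsRuledBox.fderiv_fderiv_eq (h : IsRuledBox D f J B G κ c W) {p : ℝ × Euc d}
    (hp : p ∈ J ×ˢ B) (a : ℝ × Euc d) (s : Euc d) :
    fderiv ℝ (fderiv ℝ (f ∘ G)) p a ((0 : ℝ), s) = a.1 • deriv W p.1 s := by
  have h2 : HasFDerivAt (fderiv ℝ (f ∘ G)) (fderiv ℝ (fderiv ℝ (f ∘ G)) p) p :=
    (((h.contDiffOn_immersion.fderiv_of_isOpen (m := ∞) h.isOpen_domain (by simp)).differentiableOn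
      (by simp)).differentiableAt (h.isOpen_domain.mem_nhds hp)).hasFDerivAt
  have h3 : (fun q ↦ fderiv ℝ (f ∘ G) q ((0 : ℝ), s)) =ᶠ[𝓝 p] fun q ↦ W q.1 s := by
    filter_upwards [h.isOpen_domain.mem_nhds hp] with q hq
    rw [h.fderiv_eq hq]
    simp
  have h4 : HasFDerivAt (fun q : ℝ × Euc d ↦ W q.1) _ p :=
    (h.hasDerivAt_ruling hp.1).hasFDerivAt.comp p hasFDerivAt_fst
  have h5 := DFunLike.congr_fun ((h2.clm_apply (hasFDerivAt_const _ p)).unique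
    ((h4.clm_apply (hasFDerivAt_const s p)).congr_of_eventuallyEq h3)) a
  simpa using h5

/-- Since α(D, D) = 0, only α(∂_t, D) contributes to L_D, and it is the normal part of W'. -/
theorem IsRuledBox.rulingNormalSpace_eq (h : IsRuledBox D f J B G κ c W) (hn : d + 1 = n)
    (hf : IsIsometricImmersionOn g f (G '' (J ×ˢ B))) {p : ℝ × Euc d} (hp : p ∈ J ×ˢ B) :
    rulingNormalSpace D f (G p) =
      (((normalSpace n f (G p)).starProjection).comp (deriv W p.1)).range := by
  apply le_antisymm
  · rw [rulingNormalSpace, Submodule.span_le]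
    rintro _ ⟨v, w, hw, rfl⟩
    obtain ⟨a, rfl⟩ := (h.bijective_mfderiv hn hp).2 v
    obtain ⟨s, rfl⟩ := (h.distribution p hp w).1 hw
    have h1 : ∀ a : ℝ × Euc d, (normalSpace n f (G p)).starProjection (deriv W p.1 (a.1 • s)) =
        (normalSpace n f (G p)).starProjection (fderiv ℝ (fderiv ℝ (f ∘ G)) p a ((0 : ℝ), s)) :=
      fun a ↦ by rw [h.fderiv_fderiv_eq hp, map_smul]
    exact ⟨(a : ℝ × Euc d).1 • s,
      (h1 a).trans (h.secondFundamentalForm_eq hf hp a ((0 : ℝ), s)).symm⟩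
  · rintro _ ⟨s, rfl⟩
    refine Submodule.subset_span ⟨mfderiv 𝓘(ℝ, ℝ × Euc d) (𝓡 n) G p ((1 : ℝ), (0 : Euc d)), _,
      (h.distribution p hp _).2 ⟨s, rfl⟩, ?_⟩
    rw [h.secondFundamentalForm_eq hf hp, h.fderiv_fderiv_eq hp, one_smul]
    rfl

theorem IsRuledBox.rulingNormalSpace_le (h : IsRuledBox D f J B G κ c W) (hn : d + 1 = n)
    (hf : IsIsometricImmersionOn g f (G '' (J ×ˢ B))) {p : ℝ × Euc d} (hp : p ∈ J ×ˢ B) :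
    rulingNormalSpace D f (G p) ≤ normalSpace n f (G p) := by
  rw [h.rulingNormalSpace_eq hn hf hp]
  rintro _ ⟨s, rfl⟩
  exact Submodule.starProjection_apply_mem _ _

theorem IsRuledBox.secondFundamentalForm_eq_zero (h : IsRuledBox D f J B G κ c W)
    (hf : IsIsometricImmersionOn g f (G '' (J ×ˢ B))) {p : ℝ × Euc d} (hp : p ∈ J ×ˢ B) :
    ∀ v ∈ D (G p), ∀ w ∈ D (G p), secondFundamentalForm f (G p) v w = 0 := by
  intro v hv w hw
  obtain ⟨s, rfl⟩ := (h.distribution p hp v).1 hv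
  obtain ⟨s', rfl⟩ := (h.distribution p hp w).1 hw
  rw [h.secondFundamentalForm_eq hf hp, h.fderiv_fderiv_eq hp, zero_smul, map_zero]

/-- The image of the osculating map is the sum of the tangent space and `L_D`. -/
theorem IsRuledBox.mem_range_osculatingMap (h : IsRuledBox D f J B G κ c W) (hn : d + 1 = n)
    (hf : IsIsometricImmersionOn g f (G '' (J ×ˢ B))) {p : ℝ × Euc d} (hp : p ∈ J ×ˢ B)
    (y : Euc m) : y ∈ (osculatingMap c W p.1).range ↔
      (normalSpace n f (G p)).starProjection y ∈ rulingNormalSpace D f (G p) := by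
  have hN := h.normalSpace_eq hn hf hp
  have h0 : ∀ a, (normalSpace n f (G p)).starProjection (fderiv ℝ (f ∘ G) p a) = 0 := fun a ↦ by
    rw [Submodule.starProjection_apply_eq_zero_iff, hN]
    exact Submodule.le_orthogonal_orthogonal _ ⟨a, rfl⟩
  -- Splits off a tangent vector at (t, s): ∂_t f is c' + W's, so the term W's is subtracted again
  -- from the W'-part.
  have hdec : ∀ a b b', osculatingMap c W p.1 (a, b, b') =
      fderiv ℝ (f ∘ G) p (a, b) + deriv W p.1 (b' - a • p.2) := fun a b b' ↦ by
    rw [osculatingMap_apply, h.fderiv_eq hp]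
    simp only [smul_add, map_sub, map_smul]
    abel
  rw [h.rulingNormalSpace_eq hn hf hp]
  constructor
  · rintro ⟨⟨a, b, b'⟩, rfl⟩
    refine ⟨b' - a • p.2, ?_⟩
    change (normalSpace n f (G p)).starProjection _ =
      (normalSpace n f (G p)).starProjection (osculatingMap c W p.1 (a, b, b'))
    rw [hdec, map_add, h0, zero_add]
    rfl
  · rintro ⟨b', hb'⟩
    have hb'' : (normalSpace n f (G p)).starProjection (deriv W p.1 b') =
      (normalSpace n f (G p)).starProjection y := hb'
    have h1 : y - deriv W p.1 b' ∈ (fderiv ℝ (f ∘ G) p).range := by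
      have h2 : (normalSpace n f (G p)).starProjection (y - deriv W p.1 b') = 0 := by
        rw [map_sub, hb'', sub_self]
      rwa [Submodule.starProjection_apply_eq_zero_iff, hN,
        Submodule.orthogonal_orthogonal] at h2
    obtain ⟨⟨a, b⟩, hab⟩ := h1
    have hab' : fderiv ℝ (f ∘ G) p (a, b) = y - deriv W p.1 b' := hab
    refine ⟨(a, b, b' + a • p.2), ?_⟩
    change osculatingMap c W p.1 (a, b, b' + a • p.2) = y
    rw [hdec, hab', add_sub_cancel_right, sub_add_cancel]

/-- The range is the orthogonal sum of f_*TM and L_D. The left side does not involve the ruling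
coordinate, so the dimension of L_D is constant along rulings. -/
theorem IsRuledBox.finrank_range_osculatingMap (h : IsRuledBox D f J B G κ c W) (hn : d + 1 = n)
    (hf : IsIsometricImmersionOn g f (G '' (J ×ˢ B))) {p : ℝ × Euc d} (hp : p ∈ J ×ˢ B) :
    Module.finrank ℝ (osculatingMap c W p.1).range =
      n + Module.finrank ℝ (rulingNormalSpace D f (G p)) := by
  have hN := h.normalSpace_eq hn hf hp
  have h1 : (fderiv ℝ (f ∘ G) p).range ≤ (osculatingMap c W p.1).range := by
    intro y hy
    rw [h.mem_range_osculatingMap hn hf hp]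
    have h2 : (normalSpace n f (G p)).starProjection y = 0 := by
      rw [Submodule.starProjection_apply_eq_zero_iff, hN]
      exact Submodule.le_orthogonal_orthogonal _ hy
    rw [h2]
    exact Submodule.zero_mem _
  have h2 : (fderiv ℝ (f ∘ G) p).rangeᗮ ⊓ (osculatingMap c W p.1).range =
      rulingNormalSpace D f (G p) := by
    ext y
    rw [Submodule.mem_inf, ← hN, h.mem_range_osculatingMap hn hf hp]
    constructor
    · rintro ⟨h3, h4⟩
      rwa [Submodule.starProjection_eq_self_iff.2 h3] at h4
    · intro h3
      have h4 := h.rulingNormalSpace_le hn hf hp h3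
      exact ⟨h4, by rwa [Submodule.starProjection_eq_self_iff.2 h4]⟩
  rw [← Submodule.finrank_add_inf_finrank_orthogonal h1, h2,
    LinearMap.finrank_range_of_inj (f := (fderiv ℝ (f ∘ G) p).toLinearMap)
      (h.fderiv_injective hn hf hp)]
  simp
  omega

end RuledBoxForm

end RuledComposition

namespace RuledComposition

open Set Filter Topology

/-! ### The development of a ruled immersion -/

theorem apply_adjoint_of_mem_range {E F : Type*} [NormedAddCommGroup E] [InnerProductSpace ℝ E]
    [CompleteSpace E] [NormedAddCommGroup F] [InnerProductSpace ℝ F] [CompleteSpace F]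
    {τ : E →L[ℝ] F} (h : ∀ v, ‖τ v‖ = ‖v‖) {y : F} (hy : y ∈ τ.range) :
    τ (ContinuousLinearMap.adjoint τ y) = y := by
  obtain ⟨w, rfl⟩ := hy
  exact congrArg τ (adjoint_apply_of_norm_eq h w)

section Development

variable {n : ℕ} {M : Type*} [TopologicalSpace M] [ChartedSpace (Euc n) M]
  [IsManifold (𝓡 n) ∞ M]
variable {m d k : ℕ}

/-- The development of a ruled immersion along a parallel frame `τ` of its osculating spaces. -/
structure IsDevelopmentOn (κ : M → ℝ × Euc d) (c : ℝ → Euc m) (W : ℝ → Euc d →L[ℝ] Euc m)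
    (τ : ℝ → Euc k →L[ℝ] Euc m) (c₁ : ℝ → Euc k) (f₁ : M → Euc k) (J : Set ℝ) : Prop where
  smooth : ContDiffOn ℝ ∞ τ J
  isometric : ∀ t ∈ J, ∀ v, ‖τ t v‖ = ‖v‖
  perp : ∀ t ∈ J, ∀ v w, inner ℝ (deriv τ t v) (τ t w) = 0
  range_eq : ∀ t ∈ J, (τ t).range = (osculatingMap c W t).range
  smooth_base : ContDiffOn ℝ ∞ c₁ J
  hasDerivAt_base : ∀ t ∈ J, HasDerivAt c₁ (ContinuousLinearMap.adjoint (τ t) (deriv c t)) t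
  eq : f₁ = fun x ↦ c₁ (κ x).1 + ContinuousLinearMap.adjoint (τ (κ x).1) (W (κ x).1 (κ x).2)

variable {g : SmoothMetric n M} {D : TangentSubspaces n M} {f : M → Euc m} {J : Set ℝ}
  {B : Set (Euc d)}
  {G : ℝ × Euc d → M} {κ : M → ℝ × Euc d} {c : ℝ → Euc m} {W : ℝ → Euc d →L[ℝ] Euc m}
  {τ : ℝ → Euc k →L[ℝ] Euc m} {c₁ : ℝ → Euc k} {f₁ : M → Euc k}

set_option linter.unusedSectionVars false

theorem IsDevelopmentOn.mono (h : IsDevelopmentOn κ c W τ c₁ f₁ J) {J' : Set ℝ} (hJ : J' ⊆ J) :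
    IsDevelopmentOn κ c W τ c₁ f₁ J' :=
  ⟨h.smooth.mono hJ, fun t ht ↦ h.isometric t (hJ ht), fun t ht ↦ h.perp t (hJ ht),
    fun t ht ↦ h.range_eq t (hJ ht), h.smooth_base.mono hJ,
    fun t ht ↦ h.hasDerivAt_base t (hJ ht), h.eq⟩

/-- On a smaller interval the osculating spaces have constant rank, hence a parallel orthonormal
frame τ. The base curve is an antiderivative of τ*c' and the ruling is τ*W. -/
theorem IsRuledBox.exists_development (h : IsRuledBox D f J B G κ c W) (hne : J.Nonempty) :
    ∃ (k : ℕ) (J' : Set ℝ) (τ : ℝ → Euc k →L[ℝ] Euc m) (c₁ : ℝ → Euc k) (f₁ : M → Euc k),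
      IsOpen J' ∧ Convex ℝ J' ∧ J'.Nonempty ∧ J' ⊆ J ∧ IsDevelopmentOn κ c W τ c₁ f₁ J' := by
  obtain ⟨k, t₀, J₁, A, hJ₁, ht₀, hJ₁J, hA, hAi⟩ := exists_constant_rank h.isOpen_time hne
    (contDiffOn_osculatingMap h.isOpen_time h.smooth_base h.smooth_ruling)
  obtain ⟨ε, hε, hεJ, τ, hτ, hτp⟩ := exists_parallel_frame hJ₁ hA (fun t ht ↦ (hAi t ht).1) ht₀
  have hεJ' := hεJ.trans hJ₁J
  obtain ⟨c₁, hc₁, hc₁'⟩ := exists_smooth_antiderivative isOpen_Ioo ordConnected_Ioo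
    ((ContDiffOn.clm_adjoint hτ).clm_apply
      ((h.smooth_base.deriv_of_isOpen h.isOpen_time (m := ∞) (by simp)).mono hεJ'))
  refine ⟨k, Ioo (t₀ - ε) (t₀ + ε), τ, c₁, _, isOpen_Ioo, convex_Ioo _ _,
    ⟨t₀, by linarith, by linarith⟩, hεJ', hτ, fun t ht ↦ (hτp t ht).1, fun t ht v w ↦ ?_,
    fun t ht ↦ (hτp t ht).2.1.trans (hAi t (hεJ ht)).2, hc₁, hc₁', rfl⟩
  have h1 : τ t w ∈ (A t).range := (hτp t ht).2.1 ▸ ⟨w, rfl⟩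
  obtain ⟨w', hw'⟩ := h1
  have h2 : A t w' = τ t w := hw'
  rw [← h2, (hτp t ht).2.2]

theorem IsDevelopmentOn.deriv_mem (h : IsDevelopmentOn κ c W τ c₁ f₁ J) {t : ℝ} (ht : t ∈ J) :
    deriv c t ∈ (τ t).range := by
  rw [h.range_eq t ht]
  exact ⟨(1, 0, 0), by change osculatingMap c W t _ = _; simp [osculatingMap_apply]⟩

theorem IsDevelopmentOn.ruling_mem (h : IsDevelopmentOn κ c W τ c₁ f₁ J) {t : ℝ} (ht : t ∈ J)
    (s : Euc d) : W t s ∈ (τ t).range := by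
  rw [h.range_eq t ht]
  exact ⟨(0, s, 0), by change osculatingMap c W t _ = _; simp [osculatingMap_apply]⟩

theorem IsDevelopmentOn.deriv_ruling_mem (h : IsDevelopmentOn κ c W τ c₁ f₁ J) {t : ℝ} (ht : t ∈ J)
    (s : Euc d) : deriv W t s ∈ (τ t).range := by
  rw [h.range_eq t ht]
  exact ⟨(0, 0, s), by change osculatingMap c W t _ = _; simp [osculatingMap_apply]⟩

theorem IsDevelopmentOn.hasDerivAt_adjoint (h : IsDevelopmentOn κ c W τ c₁ f₁ J) (hJ : IsOpen J)
    {t : ℝ} (ht : t ∈ J) : HasDerivAt (fun t ↦ ContinuousLinearMap.adjoint (τ t))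
      (ContinuousLinearMap.adjoint (deriv τ t)) t :=
  HasDerivAt.clm_adjoint
    ((h.smooth.differentiableOn (by simp)).differentiableAt (hJ.mem_nhds ht)).hasDerivAt

/-- The derivative of the adjoint of the frame kills the osculating space. -/
theorem IsDevelopmentOn.adjoint_deriv_apply (h : IsDevelopmentOn κ c W τ c₁ f₁ J) {t : ℝ}
    (ht : t ∈ J) {y : Euc m} (hy : y ∈ (τ t).range) :
    ContinuousLinearMap.adjoint (deriv τ t) y = 0 := by
  obtain ⟨w, rfl⟩ := hy
  refine ext_inner_right ℝ fun v ↦ ?_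
  rw [ContinuousLinearMap.adjoint_inner_left, inner_zero_left, real_inner_comm]
  exact h.perp t ht v w

theorem IsDevelopmentOn.adjoint_apply_deriv (h : IsDevelopmentOn κ c W τ c₁ f₁ J) {t : ℝ}
    (ht : t ∈ J) (y : Euc k) : ContinuousLinearMap.adjoint (τ t) (deriv τ t y) = 0 := by
  refine ext_inner_right ℝ fun v ↦ ?_
  rw [ContinuousLinearMap.adjoint_inner_left, inner_zero_left]
  exact h.perp t ht y v

theorem IsDevelopmentOn.comp_param_eq (h : IsDevelopmentOn κ c W τ c₁ f₁ J)
    (hb : IsRuledBox D f J B G κ c W) {p : ℝ × Euc d} (hp : p ∈ J ×ˢ B) :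
    f₁ (G p) = c₁ p.1 + (ContinuousLinearMap.adjoint (τ p.1)).comp (W p.1) p.2 := by
  rw [h.eq]
  simp only [hb.left_inv p hp]
  rfl

/-- The term (τ*)'W drops out: W takes values in the range of τ, which the derivative of the adjoint
kills. -/
theorem IsDevelopmentOn.hasDerivAt_ruling (h : IsDevelopmentOn κ c W τ c₁ f₁ J)
    (hb : IsRuledBox D f J B G κ c W) {t : ℝ} (ht : t ∈ J) :
    HasDerivAt (fun t ↦ (ContinuousLinearMap.adjoint (τ t)).comp (W t))
      ((ContinuousLinearMap.adjoint (τ t)).comp (deriv W t)) t := by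
  have h1 := (h.hasDerivAt_adjoint hb.isOpen_time ht).clm_comp (hb.hasDerivAt_ruling ht)
  have h2 : (ContinuousLinearMap.adjoint (deriv τ t)).comp (W t) = 0 := by
    ext1 s
    exact h.adjoint_deriv_apply ht (h.ruling_mem ht s)
  rwa [h2, zero_add] at h1

theorem IsDevelopmentOn.fderiv_eq (h : IsDevelopmentOn κ c W τ c₁ f₁ J)
    (hb : IsRuledBox D f J B G κ c W) {p : ℝ × Euc d} (hp : p ∈ J ×ˢ B) (a : ℝ × Euc d) :
    fderiv ℝ (f₁ ∘ G) p a = ContinuousLinearMap.adjoint (τ p.1) (fderiv ℝ (f ∘ G) p a) := by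
  have h1 : f₁ ∘ G =ᶠ[𝓝 p] fun q ↦
      c₁ q.1 + (ContinuousLinearMap.adjoint (τ q.1)).comp (W q.1) q.2 := by
    filter_upwards [hb.isOpen_domain.mem_nhds hp] with q hq using h.comp_param_eq hb hq
  rw [h1.fderiv_eq, fderiv_ruled (W := fun t ↦ (ContinuousLinearMap.adjoint (τ t)).comp (W t))
    (h.hasDerivAt_base p.1 hp.1) (h.hasDerivAt_ruling hb hp.1), hb.fderiv_eq hp]
  simp only [ContinuousLinearMap.comp_apply, map_add, map_smul]

theorem IsDevelopmentOn.fderiv_mem (h : IsDevelopmentOn κ c W τ c₁ f₁ J)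
    (hb : IsRuledBox D f J B G κ c W) {p : ℝ × Euc d} (hp : p ∈ J ×ˢ B) (a : ℝ × Euc d) :
    fderiv ℝ (f ∘ G) p a ∈ (τ p.1).range := by
  rw [hb.fderiv_eq hp]
  exact Submodule.add_mem _ (Submodule.smul_mem _ _ (Submodule.add_mem _ (h.deriv_mem hp.1)
    (h.deriv_ruling_mem hp.1 _))) (h.ruling_mem hp.1 _)

theorem IsDevelopmentOn.fderiv_eq' (h : IsDevelopmentOn κ c W τ c₁ f₁ J)
    (hb : IsRuledBox D f J B G κ c W) {p : ℝ × Euc d} (hp : p ∈ J ×ˢ B) (a : ℝ × Euc d) :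
    fderiv ℝ (f ∘ G) p a = τ p.1 (fderiv ℝ (f₁ ∘ G) p a) := by
  rw [h.fderiv_eq hb hp, apply_adjoint_of_mem_range (h.isometric p.1 hp.1) (h.fderiv_mem hb hp a)]

theorem IsDevelopmentOn.contMDiffOn (h : IsDevelopmentOn κ c W τ c₁ f₁ J)
    (hb : IsRuledBox D f J B G κ c W) :
    ContMDiffOn (𝓡 n) 𝓘(ℝ, Euc k) ∞ f₁ (G '' (J ×ˢ B)) := by
  have h1 : ContDiffOn ℝ ∞ (fun p : ℝ × Euc d ↦
      c₁ p.1 + ContinuousLinearMap.adjoint (τ p.1) (W p.1 p.2)) (J ×ˢ B) :=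
    (h.smooth_base.comp contDiffOn_fst fun p hp ↦ hp.1).add
      (((ContDiffOn.clm_adjoint h.smooth).comp contDiffOn_fst fun p hp ↦ hp.1).clm_apply
        ((hb.smooth_ruling.comp contDiffOn_fst fun p hp ↦ hp.1).clm_apply contDiffOn_snd))
  rw [h.eq]
  exact hb.contMDiffOn_comp h1

/-- The immersion rolls along its development. -/
theorem IsDevelopmentOn.isRollingOn (h : IsDevelopmentOn κ c W τ c₁ f₁ J)
    (hb : IsRuledBox D f J B G κ c W) :
    IsRollingOn τ (fun t ↦ c t - τ t (c₁ t)) J ∧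
      ∀ p ∈ J ×ˢ B, f (G p) = τ p.1 (f₁ (G p)) + (c p.1 - τ p.1 (c₁ p.1)) := by
  refine ⟨⟨h.smooth, hb.smooth_base.sub (h.smooth.clm_apply h.smooth_base), h.isometric, h.perp,
    fun t ht w ↦ ?_⟩, fun p hp ↦ ?_⟩
  · have hτ : HasDerivAt τ (deriv τ t) t :=
      ((h.smooth.differentiableOn (by simp)).differentiableAt
        (hb.isOpen_time.mem_nhds ht)).hasDerivAt
    have h1 := (hb.hasDerivAt_base ht).sub (hτ.clm_apply (h.hasDerivAt_base t ht))
    rw [apply_adjoint_of_mem_range (h.isometric t ht) (h.deriv_mem ht)] at h1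
    have h2 : deriv (fun t ↦ c t - τ t (c₁ t)) t = _ := h1.deriv
    rw [h2, sub_add_eq_sub_sub_swap, sub_self, zero_sub, inner_neg_left, h.perp t ht, neg_zero]
  · rw [h.comp_param_eq hb hp, hb.ruled p hp, map_add, ContinuousLinearMap.comp_apply,
      apply_adjoint_of_mem_range (h.isometric p.1 hp.1) (h.ruling_mem hp.1 _)]
    abel

theorem IsDevelopmentOn.isIsometricImmersionOn (h : IsDevelopmentOn κ c W τ c₁ f₁ J)
    (hb : IsRuledBox D f J B G κ c W) (hn : d + 1 = n)
    (hf : IsIsometricImmersionOn g f (G '' (J ×ˢ B))) :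
    IsIsometricImmersionOn g f₁ (G '' (J ×ˢ B)) := by
  refine ⟨h.contMDiffOn hb, ?_⟩
  rintro _ ⟨p, hp, rfl⟩ v w
  obtain ⟨a, rfl⟩ := (hb.bijective_mfderiv hn hp).2 v
  obtain ⟨b, rfl⟩ := (hb.bijective_mfderiv hn hp).2 w
  have hfm : MDifferentiableAt (𝓡 n) 𝓘(ℝ, Euc k) f₁ (G p) :=
    ((h.contMDiffOn hb).contMDiffAt (hb.isOpen_image.mem_nhds ⟨p, hp, rfl⟩)).mdifferentiableAt
      (by simp)
  have h1 := fderiv_comp_param hfm (hb.mdifferentiableAt_param hp)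
  refine Eq.trans (congrArg₂ (inner ℝ) (h1 a).symm (h1 b).symm) ?_
  rw [← inner_map_of_norm_eq (h.isometric p.1 hp.1)]
  have h2 := h.fderiv_eq' hb hp
  exact (congrArg₂ (inner ℝ) (h2 a).symm (h2 b).symm).trans (hb.inner_fderiv hf hp a b)

theorem IsDevelopmentOn.mem_range_iff (h : IsDevelopmentOn κ c W τ c₁ f₁ J)
    (hb : IsRuledBox D f J B G κ c W) (hn : d + 1 = n)
    (hf : IsIsometricImmersionOn g f (G '' (J ×ˢ B))) {p : ℝ × Euc d} (hp : p ∈ J ×ˢ B)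
    (y : Euc m) : y ∈ (τ p.1).range ↔
      (normalSpace n f (G p)).starProjection y ∈ rulingNormalSpace D f (G p) := by
  rw [h.range_eq p.1 hp.1, hb.mem_range_osculatingMap hn hf hp]

/-- The range of τ is f_*TM ⊕ L_D, so its normal vectors are those of L_D. -/
theorem IsDevelopmentOn.mem_rulingNormalSpace_iff (h : IsDevelopmentOn κ c W τ c₁ f₁ J)
    (hb : IsRuledBox D f J B G κ c W) (hn : d + 1 = n)
    (hf : IsIsometricImmersionOn g f (G '' (J ×ˢ B))) {p : ℝ × Euc d} (hp : p ∈ J ×ˢ B)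
    (y : Euc m) : y ∈ rulingNormalSpace D f (G p) ↔
      y ∈ (τ p.1).range ∧ y ∈ normalSpace n f (G p) := by
  rw [h.mem_range_iff hb hn hf hp]
  constructor
  · intro h1
    have h2 := hb.rulingNormalSpace_le hn hf hp h1
    exact ⟨by rwa [Submodule.starProjection_eq_self_iff.2 h2], h2⟩
  · rintro ⟨h1, h2⟩
    rwa [Submodule.starProjection_eq_self_iff.2 h2] at h1

theorem IsDevelopmentOn.finrank_eq (h : IsDevelopmentOn κ c W τ c₁ f₁ J)
    (hb : IsRuledBox D f J B G κ c W) (hn : d + 1 = n)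
    (hf : IsIsometricImmersionOn g f (G '' (J ×ˢ B))) {p : ℝ × Euc d} (hp : p ∈ J ×ˢ B) :
    k = n + Module.finrank ℝ (rulingNormalSpace D f (G p)) := by
  rw [← hb.finrank_range_osculatingMap hn hf hp, ← h.range_eq p.1 hp.1,
    LinearMap.finrank_range_of_inj (f := (τ p.1).toLinearMap)
      (injective_of_norm_eq (h.isometric p.1 hp.1))]
  simp

theorem IsDevelopmentOn.mem_normalSpace_iff (h : IsDevelopmentOn κ c W τ c₁ f₁ J)
    (hb : IsRuledBox D f J B G κ c W) (hn : d + 1 = n)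
    (hf : IsIsometricImmersionOn g f (G '' (J ×ˢ B))) {p : ℝ × Euc d} (hp : p ∈ J ×ˢ B)
    (y : Euc k) : y ∈ normalSpace n f₁ (G p) ↔ τ p.1 y ∈ normalSpace n f (G p) := by
  rw [hb.normalSpace_eq hn hf hp, hb.normalSpace_eq hn (h.isIsometricImmersionOn hb hn hf) hp,
    Submodule.mem_orthogonal, Submodule.mem_orthogonal]
  have h1 : ∀ a, inner ℝ (fderiv ℝ (f ∘ G) p a) (τ p.1 y) = inner ℝ (fderiv ℝ (f₁ ∘ G) p a) y :=
    fun a ↦ by rw [h.fderiv_eq' hb hp, inner_map_of_norm_eq (h.isometric p.1 hp.1)]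
  constructor
  · rintro h2 _ ⟨a, rfl⟩
    exact (h1 a).trans (h2 _ ⟨a, rfl⟩)
  · rintro h2 _ ⟨a, rfl⟩
    exact (h1 a).symm.trans (h2 _ ⟨a, rfl⟩)

/-- The isometry τ identifies the normal space of the development with L_D, so τ* intertwines the
two normal projections. This transfers both the second fundamental form and the normal connection.
-/
theorem IsDevelopmentOn.starProjection_adjoint (h : IsDevelopmentOn κ c W τ c₁ f₁ J)
    (hb : IsRuledBox D f J B G κ c W) (hn : d + 1 = n)
    (hf : IsIsometricImmersionOn g f (G '' (J ×ˢ B))) {p : ℝ × Euc d} (hp : p ∈ J ×ˢ B)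
    (v : Euc m) :
    (normalSpace n f₁ (G p)).starProjection (ContinuousLinearMap.adjoint (τ p.1) v) =
      ContinuousLinearMap.adjoint (τ p.1) ((rulingNormalSpace D f (G p)).starProjection
        ((normalSpace n f (G p)).starProjection v)) := by
  have hiff := h.mem_rulingNormalSpace_iff hb hn hf hp
  have hmem := hiff ((rulingNormalSpace D f (G p)).starProjection
    ((normalSpace n f (G p)).starProjection v))
  have h1 := hmem.1 (Submodule.starProjection_apply_mem _ _)
  refine Submodule.eq_starProjection_of_mem_orthogonal (K := normalSpace n f₁ (G p)) ?_ ?_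
  · rw [h.mem_normalSpace_iff hb hn hf hp,
      apply_adjoint_of_mem_range (h.isometric p.1 hp.1) h1.1]
    exact h1.2
  · rw [Submodule.mem_orthogonal]
    intro y hy
    rw [h.mem_normalSpace_iff hb hn hf hp] at hy
    have hyL : τ p.1 y ∈ rulingNormalSpace D f (G p) := (hiff _).2 ⟨⟨y, rfl⟩, hy⟩
    rw [inner_sub_right, ContinuousLinearMap.adjoint_inner_right,
      ContinuousLinearMap.adjoint_inner_right, real_inner_comm, real_inner_comm _ (τ p.1 y),
      inner_starProjection_of_mem _ hyL, inner_starProjection_of_mem _ hy,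
      sub_self]

end Development

end RuledComposition

namespace RuledComposition

open Set Filter Topology

/-- The image of an open set under an injective affine map. -/
theorem isOpenInAffineSubspace_image {d k : ℕ} (y : Euc k) {A : Euc d →L[ℝ] Euc k}
    (hA : Function.Injective A) {B : Set (Euc d)} (hB : IsOpen B) :
    IsOpenInAffineSubspace ((fun s ↦ y + A s) '' B) d := by
  refine ⟨AffineSubspace.mk' y A.range, ?_, {z | leftInv A (z - y) ∈ B},
    hB.preimage (by fun_prop), ?_⟩
  · rw [AffineSubspace.direction_mk', LinearMap.finrank_range_of_inj (f := A.toLinearMap) hA]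
    simp
  · ext z
    constructor
    · rintro ⟨s, hs, rfl⟩
      refine ⟨by simpa [leftInv_apply hA] using hs, ?_⟩
      rw [SetLike.mem_coe, AffineSubspace.mem_mk', vsub_eq_sub, add_sub_cancel_left]
      exact ⟨s, rfl⟩
    · rintro ⟨hz, hzS⟩
      rw [SetLike.mem_coe, AffineSubspace.mem_mk', vsub_eq_sub] at hzS
      obtain ⟨s, hs⟩ := hzS
      have hs' : A s = z - y := hs
      refine ⟨s, ?_, by simp [hs']⟩
      rw [mem_ofPred_eq, ← hs', leftInv_apply hA] at hz
      exact hz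

/-! ### The development is a ruled reduction to L_D -/

section DevelopmentReduction

variable {n : ℕ} {M : Type*} [TopologicalSpace M] [ChartedSpace (Euc n) M]
  [IsManifold (𝓡 n) ∞ M]
variable {m d k : ℕ} {g : SmoothMetric n M} {D : TangentSubspaces n M} {f : M → Euc m} {J : Set ℝ}
  {B : Set (Euc d)}
  {G : ℝ × Euc d → M} {κ : M → ℝ × Euc d} {c : ℝ → Euc m} {W : ℝ → Euc d →L[ℝ] Euc m}
  {τ : ℝ → Euc k →L[ℝ] Euc m} {c₁ : ℝ → Euc k} {f₁ : M → Euc k}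

/-- In the box, the leaves are the slices of constant t, and on these the development is an
injective affine map of s. -/
theorem IsDevelopmentOn.isRuledOn (h : IsDevelopmentOn κ c W τ c₁ f₁ J)
    (hb : IsRuledBox D f J B G κ c W) (hn : d + 1 = n)
    (hf : IsIsometricImmersionOn g f (G '' (J ×ˢ B))) (hD : IsRuledOn g D d f univ) :
    IsRuledOn g D d f₁ (G '' (J ×ˢ B)) := by
  refine ⟨hD.smooth.mono hb.isOpen_image (subset_univ _),
    hD.totallyGeodesic.mono (subset_univ _), ?_⟩
  rintro _ ⟨p, hp, rfl⟩
  rw [hb.leafOn_eq hp, image_image]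
  have h1 : (fun s ↦ f₁ (G (p.1, s))) '' B =
      (fun s ↦ c₁ p.1 + (ContinuousLinearMap.adjoint (τ p.1)).comp (W p.1) s) '' B :=
    image_congr fun s hs ↦ h.comp_param_eq hb (p := (p.1, s)) ⟨hp.1, hs⟩
  rw [h1]
  refine isOpenInAffineSubspace_image _ ?_ hb.isOpen_space
  intro s s' hss
  have h2 := h.fderiv_eq hb hp
  have h3 : ∀ s : Euc d, fderiv ℝ (f₁ ∘ G) p ((0 : ℝ), s) =
      (ContinuousLinearMap.adjoint (τ p.1)).comp (W p.1) s := fun s ↦ by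
    rw [h2, hb.fderiv_eq hp]
    simp
  rw [← h3, ← h3] at hss
  exact congrArg Prod.snd
    (hb.fderiv_injective hn (h.isIsometricImmersionOn hb hn hf) hp hss)

/-- The bundle map is τ*. It is parallel because in the derivative of τ*ξ the term (τ*)'ξ vanishes,
as ξ lies in the range of τ. -/
theorem IsDevelopmentOn.isParallelBundleIsometryOn (h : IsDevelopmentOn κ c W τ c₁ f₁ J)
    (hb : IsRuledBox D f J B G κ c W) (hn : d + 1 = n)
    (hf : IsIsometricImmersionOn g f (G '' (J ×ˢ B))) :
    IsParallelBundleIsometryOn n f (rulingNormalSpace D f) f₁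
      (fun x ↦ (ContinuousLinearMap.adjoint (τ (κ x).1)).toLinearMap) (G '' (J ×ˢ B)) := by
  have hτ : ContMDiffOn (𝓡 n) 𝓘(ℝ, Euc m →L[ℝ] Euc k) ∞
      (fun x ↦ ContinuousLinearMap.adjoint (τ (κ x).1)) (G '' (J ×ˢ B)) :=
    hb.contMDiffOn_comp (u := fun p ↦ ContinuousLinearMap.adjoint (τ p.1))
      ((ContDiffOn.clm_adjoint h.smooth).comp contDiffOn_fst fun p hp ↦ hp.1)
  have hsmooth : ∀ V : Set M, IsOpen V → V ⊆ G '' (J ×ˢ B) → ∀ ξ : M → Euc m,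
      IsSmoothSectionOn n (rulingNormalSpace D f) ξ V → ContMDiffOn (𝓡 n) 𝓘(ℝ, Euc k) ∞
        (fun x ↦ ContinuousLinearMap.adjoint (τ (κ x).1) (ξ x)) V :=
    fun V _ hVU ξ hξ ↦ (hτ.mono hVU).clm_apply hξ.1
  refine ⟨?_, ?_, hsmooth, ?_⟩
  · rintro _ ⟨p, hp, rfl⟩
    simp only [hb.left_inv p hp]
    ext y
    rw [h.mem_normalSpace_iff hb hn hf hp]
    constructor
    · rintro ⟨z, hz, rfl⟩
      obtain ⟨hz1, hz2⟩ := (h.mem_rulingNormalSpace_iff hb hn hf hp z).1 hz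
      change τ p.1 (ContinuousLinearMap.adjoint (τ p.1) z) ∈ _
      rwa [apply_adjoint_of_mem_range (h.isometric p.1 hp.1) hz1]
    · intro hy
      exact ⟨τ p.1 y, (h.mem_rulingNormalSpace_iff hb hn hf hp _).2 ⟨⟨y, rfl⟩, hy⟩,
        adjoint_apply_of_norm_eq (h.isometric p.1 hp.1) y⟩
  · rintro _ ⟨p, hp, rfl⟩ z hz
    simp only [hb.left_inv p hp]
    obtain ⟨⟨w, rfl⟩, -⟩ := (h.mem_rulingNormalSpace_iff hb hn hf hp z).1 hz
    change ‖ContinuousLinearMap.adjoint (τ p.1) (τ p.1 w)‖ = ‖τ p.1 w‖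
    rw [adjoint_apply_of_norm_eq (h.isometric p.1 hp.1), h.isometric p.1 hp.1]
  · intro V hV hVU ξ hξ x hx X
    obtain ⟨p, hp, rfl⟩ := hVU hx
    obtain ⟨a, rfl⟩ := (hb.bijective_mfderiv hn hp).2 X
    have hξm : MDifferentiableAt (𝓡 n) 𝓘(ℝ, Euc m) ξ (G p) :=
      (hξ.1.contMDiffAt (hV.mem_nhds hx)).mdifferentiableAt (by simp)
    have hσm : MDifferentiableAt (𝓡 n) 𝓘(ℝ, Euc k)
        (fun x ↦ ContinuousLinearMap.adjoint (τ (κ x).1) (ξ x)) (G p) :=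
      ((hsmooth V hV hVU ξ hξ).contMDiffAt (hV.mem_nhds hx)).mdifferentiableAt (by simp)
    have hG := hb.mdifferentiableAt_param hp
    refine (normalDeriv_param hσm hG a).trans ?_
    refine Eq.trans ?_ (congrArg (fun z ↦ ContinuousLinearMap.adjoint (τ (κ (G p)).1)
      ((rulingNormalSpace D f (G p)).starProjection z)) (normalDeriv_param hξm hG a)).symm
    simp only [hb.left_inv p hp]
    rw [← h.starProjection_adjoint hb hn hf hp]
    congr 1
    have h1 : (fun x ↦ ContinuousLinearMap.adjoint (τ (κ x).1) (ξ x)) ∘ G =ᶠ[𝓝 p]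
        fun q ↦ ContinuousLinearMap.adjoint (τ q.1) ((ξ ∘ G) q) := by
      filter_upwards [hb.isOpen_domain.mem_nhds hp] with q hq
      simp only [Function.comp_apply, hb.left_inv q hq]
    have h2 : HasFDerivAt (fun q : ℝ × Euc d ↦ ContinuousLinearMap.adjoint (τ q.1)) _ p :=
      (h.hasDerivAt_adjoint hb.isOpen_time hp.1).hasFDerivAt.comp p hasFDerivAt_fst
    have h3 : DifferentiableAt ℝ (ξ ∘ G) p :=
      mdifferentiableAt_iff_differentiableAt.1 (hξm.comp p hG)
    have h4 := (h2.clm_apply h3.hasFDerivAt).fderiv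
    have h5 : ContinuousLinearMap.adjoint (deriv τ p.1) ((ξ ∘ G) p) = 0 :=
      h.adjoint_deriv_apply hp.1
        ((h.mem_rulingNormalSpace_iff hb hn hf hp _).1 (hξ.2 _ hx)).1
    refine (?_ : ∀ a : ℝ × Euc d, fderiv ℝ ((fun x ↦
      ContinuousLinearMap.adjoint (τ (κ x).1) (ξ x)) ∘ G) p a =
        ContinuousLinearMap.adjoint (τ p.1) (fderiv ℝ (ξ ∘ G) p a)) a
    intro a
    rw [h1.fderiv_eq, h4]
    simp only [add_apply, ContinuousLinearMap.comp_apply, ContinuousLinearMap.flip_apply,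
      ContinuousLinearMap.toSpanSingleton_apply, smul_apply, h5, smul_zero, add_zero]

/-- The second derivative of f is a multiple of a value of τ' plus τ applied to that of the
development; τ* kills the first term and inverts τ on the second. -/
theorem IsDevelopmentOn.isRuledReductionOn (h : IsDevelopmentOn κ c W τ c₁ f₁ J)
    (hb : IsRuledBox D f J B G κ c W) (hn : d + 1 = n)
    (hf : IsIsometricImmersionOn g f (G '' (J ×ˢ B))) (hD : IsRuledOn g D d f univ) :
    IsRuledReductionOn g D d f (rulingNormalSpace D f) f₁
      (fun x ↦ (ContinuousLinearMap.adjoint (τ (κ x).1)).toLinearMap) (G '' (J ×ˢ B)) := by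
  have hf₁ := h.isIsometricImmersionOn hb hn hf
  refine ⟨hf₁, h.isRuledOn hb hn hf hD, h.isParallelBundleIsometryOn hb hn hf, ?_⟩
  rintro _ ⟨p, hp, rfl⟩ v w
  obtain ⟨a, rfl⟩ := (hb.bijective_mfderiv hn hp).2 v
  obtain ⟨b, rfl⟩ := (hb.bijective_mfderiv hn hp).2 w
  have h1 := hb.secondFundamentalForm_eq hf₁ hp a b
  have h2 := hb.secondFundamentalForm_eq hf hp a b
  refine h1.trans (Eq.trans ?_ (congrArg (fun z ↦ ContinuousLinearMap.adjoint (τ (κ (G p)).1)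
    ((rulingNormalSpace D f (G p)).starProjection z)) h2).symm)
  simp only [hb.left_inv p hp]
  rw [← h.starProjection_adjoint hb hn hf hp]
  congr 1
  refine Eq.trans ?_ (congrArg (ContinuousLinearMap.adjoint (τ p.1)) (fderiv_fderiv_of_rolling
    hb.isOpen_time hb.isOpen_space h.smooth hb.contDiffOn_immersion
    (hb.contDiffOn_comp hf₁.smooth) (fun p hp a ↦ h.fderiv_eq' hb hp a) hp a b)).symm
  rw [map_add, map_smul, h.adjoint_apply_deriv hp.1, smul_zero, zero_add,
    adjoint_apply_of_norm_eq (h.isometric p.1 hp.1)]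

/-- `L_D` is parallel along the ruling. -/
theorem IsDevelopmentOn.isParallelAlongOn (h : IsDevelopmentOn κ c W τ c₁ f₁ J)
    (hb : IsRuledBox D f J B G κ c W) (hn : d + 1 = n)
    (hf : IsIsometricImmersionOn g f (G '' (J ×ˢ B))) :
    IsParallelAlongOn f D (rulingNormalSpace D f) (G '' (J ×ˢ B)) := by
  intro V hV hVU ξ hξ x hx X hX
  obtain ⟨p, hp, rfl⟩ := hVU hx
  obtain ⟨s, rfl⟩ := (hb.distribution p hp X).1 hX
  have hξm : MDifferentiableAt (𝓡 n) 𝓘(ℝ, Euc m) ξ (G p) :=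
    (hξ.1.contMDiffAt (hV.mem_nhds hx)).mdifferentiableAt (by simp)
  have hG := hb.mdifferentiableAt_param hp
  rw [normalDeriv_param hξm hG, ← h.mem_range_iff hb hn hf hp]
  have h3 : DifferentiableAt ℝ (ξ ∘ G) p :=
    mdifferentiableAt_iff_differentiableAt.1 (hξm.comp p hG)
  have hline : HasDerivAt (fun u : ℝ ↦ (p.1, p.2 + u • s)) ((0 : ℝ), s) 0 := by
    have h4 := ((hasDerivAt_id' (0 : ℝ)).smul_const s).const_add p.2
    rw [one_smul] at h4
    exact (hasDerivAt_const (0 : ℝ) p.1).prodMk h4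
  have hline0 : (p.1, p.2 + (0 : ℝ) • s) = p := by simp
  have h4 : HasDerivAt (fun u : ℝ ↦ (ξ ∘ G) (p.1, p.2 + u • s))
      (fderiv ℝ (ξ ∘ G) p ((0 : ℝ), s)) 0 :=
    HasFDerivAt.comp_hasDerivAt (f := fun u : ℝ ↦ (p.1, p.2 + u • s)) (0 : ℝ)
      (by rw [hline0]; exact h3.hasFDerivAt) hline
  -- The projection onto the range of τ at the time of p. Along the ruling the time is fixed, so ξ
  -- stays in one linear subspace, and so does its derivative.
  let π : Euc m →L[ℝ] Euc m := (τ p.1).comp (ContinuousLinearMap.adjoint (τ p.1))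
  have h5 : HasDerivAt (fun u : ℝ ↦ π ((ξ ∘ G) (p.1, p.2 + u • s)))
      (π (fderiv ℝ (ξ ∘ G) p ((0 : ℝ), s))) 0 := π.hasFDerivAt.comp_hasDerivAt (0 : ℝ) h4
  have hcont : Tendsto (fun u : ℝ ↦ (p.1, p.2 + u • s)) (𝓝 0) (𝓝 p) := by
    have := hline.continuousAt.tendsto
    rwa [hline0] at this
  have h6 : (fun u : ℝ ↦ π ((ξ ∘ G) (p.1, p.2 + u • s))) =ᶠ[𝓝 0]
      fun u ↦ (ξ ∘ G) (p.1, p.2 + u • s) := by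
    filter_upwards [hcont (hb.isOpen_domain.mem_nhds hp),
      hcont ((hb.contMDiffAt_param hp).continuousAt (hV.mem_nhds hx))] with u hu huV
    exact apply_adjoint_of_mem_range (h.isometric p.1 hp.1)
      ((h.mem_rulingNormalSpace_iff hb hn hf hu _).1 (hξ.2 _ huV)).1
  rw [← (h5.congr_of_eventuallyEq h6.symm).unique h4]
  exact ⟨_, rfl⟩

end DevelopmentReduction

end RuledComposition

namespace RuledComposition

open Set Filter Topology

/-! ### Uniqueness of reductions and local composition for L_D -/

theorem eq_zero_of_const_on_open {E V : Type*} [NormedAddCommGroup E] [NormedSpace ℝ E]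
    [NormedAddCommGroup V] [NormedSpace ℝ V] {A : E →L[ℝ] V} {B : Set E} (hB : IsOpen B) {s : E}
    (hs : s ∈ B) {y : V} (h : ∀ s ∈ B, A s = y) : A = 0 := by
  have h1 : (A : E → V) =ᶠ[𝓝 s] fun _ ↦ y := by
    filter_upwards [hB.mem_nhds hs] with z hz using h z hz
  exact A.hasFDerivAt.unique ((hasFDerivAt_const y s).congr_of_eventuallyEq h1)

theorem eq_of_deriv_eq_zero {V : Type*} [NormedAddCommGroup V] [NormedSpace ℝ V] {u : ℝ → V}
    {J : Set ℝ} (hJ : IsOpen J) (hJc : Convex ℝ J) (h : ∀ t ∈ J, HasDerivAt u 0 t) {s t : ℝ}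
    (hs : s ∈ J) (ht : t ∈ J) : u s = u t :=
  eq_of_hasFDerivAt_zero hJ hJc (fun t ht ↦ by simpa using (h t ht).hasFDerivAt) hs ht

/-- Immersions with the same development up to a change of frame differ by a rigid motion. -/
theorem isCompositionOn_of_rolling {M : Type*} {d k m : ℕ} {J : Set ℝ} {B : Set (Euc d)}
    (hJ : IsOpen J) (hJc : Convex ℝ J) (hB : IsOpen B) (hBc : Convex ℝ B)
    (hne : (J ×ˢ B).Nonempty) {τ τ₂ : ℝ → Euc k →L[ℝ] Euc m} {c c₂ : ℝ → Euc m}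
    (hτ : IsRollingOn τ c J) (hτ₂ : IsRollingOn τ₂ c₂ J)
    (hr : ∀ t ∈ J, (τ t).range = (τ₂ t).range) {G : ℝ × Euc d → M} {f : M → Euc m}
    {f₁ f₂ : M → Euc k} (hf₁ : ContDiffOn ℝ ∞ (f₁ ∘ G) (J ×ˢ B))
    (hf₂ : ContDiffOn ℝ ∞ (f₂ ∘ G) (J ×ˢ B))
    (hd₁ : ∀ p ∈ J ×ˢ B, ∀ a, fderiv ℝ (f ∘ G) p a = τ p.1 (fderiv ℝ (f₁ ∘ G) p a))
    (hd₂ : ∀ p ∈ J ×ˢ B, ∀ a, fderiv ℝ (f ∘ G) p a = τ₂ p.1 (fderiv ℝ (f₂ ∘ G) p a))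
    (h : IsCompositionOn f f₁ (G '' (J ×ˢ B))) : IsCompositionOn f f₂ (G '' (J ×ˢ B)) := by
  obtain ⟨p₀, hp₀⟩ := hne
  have hΩ : IsOpen (J ×ˢ B) := hJ.prod hB
  -- Both frames are parallel for the same family of subspaces, so each term in the derivative of
  -- τ*τ₂ vanishes and the change of frame is a constant isometry Q.
  have hQd : ∀ t ∈ J, HasDerivAt (fun t ↦ (ContinuousLinearMap.adjoint (τ t)).comp (τ₂ t)) 0 t := by
    intro t ht
    have h1 := (HasDerivAt.clm_adjoint (hτ.hasDerivAt_linear hJ ht)).clm_comp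
      (hτ₂.hasDerivAt_linear hJ ht)
    have h2 : (ContinuousLinearMap.adjoint (deriv τ t)).comp (τ₂ t) +
        (ContinuousLinearMap.adjoint (τ t)).comp (deriv τ₂ t) = 0 := by
      ext1 y
      refine ext_inner_right ℝ fun z ↦ ?_
      simp only [add_apply, ContinuousLinearMap.comp_apply, inner_add_left,
        ContinuousLinearMap.adjoint_inner_left, zero_apply, inner_zero_left]
      have h3 : τ₂ t y ∈ (τ t).range := by rw [hr t ht]; exact ⟨y, rfl⟩
      have h4 : τ t z ∈ (τ₂ t).range := by rw [← hr t ht]; exact ⟨z, rfl⟩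
      obtain ⟨y', hy'⟩ := h3
      obtain ⟨z', hz'⟩ := h4
      have hy : τ t y' = τ₂ t y := hy'
      have hz : τ₂ t z' = τ t z := hz'
      rw [← hy, ← hz, real_inner_comm, hτ.linear_perp t ht, hτ₂.linear_perp t ht, add_zero]
    rw [h2] at h1
    exact h1
  set Q := (ContinuousLinearMap.adjoint (τ p₀.1)).comp (τ₂ p₀.1) with hQ
  have hQc : ∀ t ∈ J, (ContinuousLinearMap.adjoint (τ t)).comp (τ₂ t) = Q := fun t ht ↦
    eq_of_deriv_eq_zero hJ hJc hQd ht hp₀.1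
  have hQi : ∀ y, ‖Q y‖ = ‖y‖ := fun y ↦ by
    rw [← hτ.isometric p₀.1 hp₀.1, ← hτ₂.isometric p₀.1 hp₀.1 y, hQ,
      ContinuousLinearMap.comp_apply, apply_adjoint_of_mem_range (hτ.isometric p₀.1 hp₀.1)]
    rw [hr _ hp₀.1]
    exact ⟨y, rfl⟩
  have hdQ : ∀ p ∈ J ×ˢ B, HasFDerivAt (fun p ↦ f₁ (G p) - Q (f₂ (G p)))
      (0 : ℝ × Euc d →L[ℝ] Euc k) p := fun p hp ↦ by
    have e₁ : HasFDerivAt (f₁ ∘ G) (fderiv ℝ (f₁ ∘ G) p) p :=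
      ((hf₁.differentiableOn (by simp)).differentiableAt (hΩ.mem_nhds hp)).hasFDerivAt
    have e₂ : HasFDerivAt (f₂ ∘ G) (fderiv ℝ (f₂ ∘ G) p) p :=
      ((hf₂.differentiableOn (by simp)).differentiableAt (hΩ.mem_nhds hp)).hasFDerivAt
    have h1 : fderiv ℝ (f₁ ∘ G) p - Q.comp (fderiv ℝ (f₂ ∘ G) p) = 0 := by
      refine ContinuousLinearMap.ext fun a ↦ ?_
      rw [sub_apply, ContinuousLinearMap.comp_apply, ← hQc p.1 hp.1,
        ContinuousLinearMap.comp_apply, ← hd₂ p hp, hd₁ p hp,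
        adjoint_apply_of_norm_eq (hτ.isometric p.1 hp.1), sub_self, zero_apply]
    rw [← h1]
    exact e₁.sub (Q.hasFDerivAt.comp p e₂)
  set b := f₁ (G p₀) - Q (f₂ (G p₀)) with hb
  -- The two reductions differ by the rigid motion y ↦ Qy + b, so the extension for f₁ is
  -- precomposed with it.
  have hf₁₂ : ∀ p ∈ J ×ˢ B, f₁ (G p) = Q (f₂ (G p)) + b := fun p hp ↦ by
    rw [hb, ← eq_of_hasFDerivAt_zero hΩ (hJc.prod hBc) hdQ hp hp₀]
    abel
  obtain ⟨Z, e, hZ, hfZ, he, hei, hfe⟩ := h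
  have hcont : Continuous fun y ↦ Q y + b := by fun_prop
  refine ⟨(fun y ↦ Q y + b) ⁻¹' Z, fun y ↦ e (Q y + b), hZ.preimage hcont, ?_,
    he.comp (Q.contDiff.add contDiff_const).contDiffOn fun y hy ↦ hy, ?_, ?_⟩
  · rintro _ ⟨_, ⟨p, hp, rfl⟩, rfl⟩
    rw [mem_preimage, ← hf₁₂ p hp]
    exact hfZ ⟨_, ⟨p, hp, rfl⟩, rfl⟩
  · intro y hy v w
    have h1 : HasFDerivAt e (fderiv ℝ e (Q y + b)) (Q y + b) :=
      ((he.differentiableOn (by simp)).differentiableAt (hZ.mem_nhds hy)).hasFDerivAt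
    have h2 : HasFDerivAt (fun y ↦ e (Q y + b)) ((fderiv ℝ e (Q y + b)).comp Q) y :=
      h1.comp y (Q.hasFDerivAt.add_const b)
    rw [h2.fderiv]
    exact (hei _ hy (Q v) (Q w)).trans (inner_map_of_norm_eq hQi v w)
  · rintro _ ⟨p, hp, rfl⟩
    rw [hfe _ ⟨p, hp, rfl⟩, hf₁₂ p hp]

section LocalExistence

variable {n : ℕ} {M : Type*} [TopologicalSpace M] [ChartedSpace (Euc n) M]
  [IsManifold (𝓡 n) ∞ M]
variable {m d k : ℕ} {g : SmoothMetric n M} {D : TangentSubspaces n M} {f : M → Euc m} {J : Set ℝ}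
  {B : Set (Euc d)}
  {G : ℝ × Euc d → M} {κ : M → ℝ × Euc d} {c : ℝ → Euc m} {W : ℝ → Euc d →L[ℝ] Euc m}
  {τ : ℝ → Euc k →L[ℝ] Euc m} {c₁ : ℝ → Euc k} {f₁ : M → Euc k}

/-- Near every point, `L_D` has a smooth frame. -/
theorem IsDevelopmentOn.exists_frame (h : IsDevelopmentOn κ c W τ c₁ f₁ J)
    (hb : IsRuledBox D f J B G κ c W) (hn : d + 1 = n)
    (hf : IsIsometricImmersionOn g f (G '' (J ×ˢ B))) {ℓ : ℕ} (hk : k = n + ℓ) {p : ℝ × Euc d}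
    (hp : p ∈ J ×ˢ B) :
    ∃ (J' : Set ℝ) (B' : Set (Euc d)) (ξ : Fin ℓ → M → Euc m), IsRuledBox D f J' B' G κ c W ∧
      p ∈ J' ×ˢ B' ∧ J' ⊆ J ∧ B' ⊆ B ∧
      (∀ i, IsSmoothSectionOn n (rulingNormalSpace D f) (ξ i) (G '' (J' ×ˢ B'))) ∧
      ∀ x ∈ G '' (J' ×ˢ B'), LinearIndependent ℝ (fun i ↦ ξ i x) ∧
        Submodule.span ℝ (range fun i ↦ ξ i x) = rulingNormalSpace D f x := by
  -- `leftInv` needs an inner product on its domain, which the product ℝ × `Euc d` does not carry;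
  -- hence this linear change of coordinates.
  let e : Euc n ≃L[ℝ] ℝ × Euc d := ContinuousLinearEquiv.ofFinrankEq (by simp; omega)
  let A : ℝ × Euc d → Euc n →L[ℝ] Euc m := fun q ↦
    (fderiv ℝ (f ∘ G) q).comp (e : Euc n →L[ℝ] ℝ × Euc d)
  have hAi : ∀ q ∈ J ×ˢ B, Function.Injective (A q) := fun q hq ↦
    (hb.fderiv_injective hn hf hq).comp e.injective
  have hA : ContDiffOn ℝ ∞ A (J ×ˢ B) :=
    (hb.contDiffOn_immersion.fderiv_of_isOpen hb.isOpen_domain (by simp)).clm_comp contDiffOn_const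
  have hN : ∀ q ∈ J ×ˢ B, ∀ v, (normalSpace n f (G q)).starProjection v =
      v - A q (leftInv (A q) v) := fun q hq v ↦ by
    rw [← starProjection_range_orthogonal (hAi q hq)]
    refine starProjection_congr ?_ v
    rw [hb.normalSpace_eq hn hf hq]
    congr 1
    ext y
    constructor
    · rintro ⟨a, rfl⟩
      exact ⟨e.symm a, congrArg (fderiv ℝ (f ∘ G) q) (e.apply_symm_apply a)⟩
    · rintro ⟨a, rfl⟩
      exact ⟨e a, rfl⟩
  have hfin : ∀ q ∈ J ×ˢ B, Module.finrank ℝ (rulingNormalSpace D f (G q)) = ℓ := fun q hq ↦ by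
    have := h.finrank_eq hb hn hf hq
    omega
  -- L_D is the image of the normal part of W'. Restricted to a complement of the kernel at p, this
  -- map remains injective nearby, and since the dimension is constantly ℓ its values give a frame.
  obtain ⟨ι, hι⟩ := exists_injective_restriction
    (((normalSpace n f (G p)).starProjection).comp (deriv W p.1)) (k := ℓ)
    (by rw [← hb.rulingNormalSpace_eq hn hf hp, hfin p hp])
  let Ψ : ℝ × Euc d → Euc ℓ →L[ℝ] Euc m := fun q ↦
    (ContinuousLinearMap.id ℝ (Euc m) - (A q).comp (leftInv (A q))).comp ((deriv W q.1).comp ι)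
  have hΨ : ContDiffOn ℝ ∞ Ψ (J ×ˢ B) :=
    (contDiffOn_const.sub (hA.clm_comp (ContDiffOn.leftInv hA hAi))).clm_comp
      (((hb.smooth_ruling.deriv_of_isOpen hb.isOpen_time (m := ∞) (by simp)).comp contDiffOn_fst
        fun q hq ↦ hq.1).clm_comp contDiffOn_const)
  have hΨv : ∀ q ∈ J ×ˢ B, ∀ v, Ψ q v =
      (normalSpace n f (G q)).starProjection (deriv W q.1 (ι v)) := fun q hq v ↦ by
    rw [hN q hq]
    rfl
  have hΨi : Function.Injective (Ψ p) := by
    intro v w hvw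
    rw [hΨv p hp, hΨv p hp] at hvw
    exact hι hvw
  obtain ⟨J', B', hbox, hp', hJ', hB', hsub⟩ := hb.exists_subbox hp
    ((hΨ.continuousOn.isOpen_inter_preimage hb.isOpen_domain
      ContinuousLinearMap.isOpen_injective).mem_nhds ⟨hp, hΨi⟩)
  refine ⟨J', B', fun i ↦ (fun q ↦ Ψ q (EuclideanSpace.single i 1)) ∘ κ, hbox, hp', hJ', hB',
    fun i ↦ ⟨hbox.contMDiffOn_comp ((hΨ.mono (prod_mono hJ' hB')).clm_apply contDiffOn_const),
      ?_⟩, ?_⟩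
  · rintro _ ⟨q, hq, rfl⟩
    have hq' := prod_mono hJ' hB' hq
    simp only [Function.comp_apply, hbox.left_inv q hq]
    rw [hΨv q hq', hb.rulingNormalSpace_eq hn hf hq']
    exact ⟨_, rfl⟩
  · rintro _ ⟨q, hq, rfl⟩
    have hq' := prod_mono hJ' hB' hq
    simp only [Function.comp_apply, hbox.left_inv q hq]
    have hli : LinearIndependent ℝ fun i ↦ Ψ q (EuclideanSpace.single i 1) := by
      have h1 := (EuclideanSpace.basisFun (Fin ℓ) ℝ).toBasis.linearIndependent.map'
        (Ψ q).toLinearMap (LinearMap.ker_eq_bot.2 (hsub hq).2)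
      have h2 : (Ψ q).toLinearMap ∘ (EuclideanSpace.basisFun (Fin ℓ) ℝ).toBasis =
          fun i ↦ Ψ q (EuclideanSpace.single i 1) := funext fun i ↦ by simp
      rwa [h2] at h1
    refine ⟨hli, Submodule.eq_of_le_of_finrank_eq ?_ ?_⟩
    · rw [Submodule.span_le]
      rintro _ ⟨i, rfl⟩
      simp only [SetLike.mem_coe]
      rw [hΨv q hq', hb.rulingNormalSpace_eq hn hf hq']
      exact ⟨_, rfl⟩
    · rw [finrank_span_eq_card hli, Fintype.card_fin, hfin q hq']

/-- On some smaller box the immersion is a composition of its development. -/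
theorem IsDevelopmentOn.exists_isCompositionOn (h : IsDevelopmentOn κ c W τ c₁ f₁ J)
    (hb : IsRuledBox D f J B G κ c W) (hne : (J ×ˢ B).Nonempty) :
    ∃ J' B', IsRuledBox D f J' B' G κ c W ∧ (J' ×ˢ B').Nonempty ∧ J' ⊆ J ∧ B' ⊆ B ∧
      IsCompositionOn f f₁ (G '' (J' ×ˢ B')) := by
  obtain ⟨hroll, hff₁⟩ := h.isRollingOn hb
  have hF₁ : ContDiffOn ℝ ∞ (f₁ ∘ G) (J ×ˢ B) := hb.contDiffOn_comp (h.contMDiffOn hb)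
  have hd : ∀ p ∈ J ×ˢ B, ∀ a, fderiv ℝ (f ∘ G) p a = τ p.1 (fderiv ℝ (f₁ ∘ G) p a) :=
    fun p hp a ↦ h.fderiv_eq' hb hp a
  by_cases hcase : ∃ p ∈ J ×ˢ B, deriv τ p.1 (fderiv ℝ (f₁ ∘ G) p (1, 0)) ≠ 0
  · obtain ⟨p, hp, hpne⟩ := hcase
    obtain ⟨J', B', hbox, hp', hJ', hB', hcomp⟩ := hb.exists_isCompositionOn hroll
      hb.contDiffOn_immersion hF₁ hff₁ hd hp hpne
    exact ⟨J', B', hbox, ⟨p, hp'⟩, hJ', hB', hcomp⟩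
  -- In the stationary case τ'(∂_t f₁) = 0 on the whole box. The motion then turns out to be
  -- constant and f is f₁ followed by an affine isometric embedding.
  push Not at hcase
  obtain ⟨⟨t₀, s₀⟩, ht₀, hs₀⟩ := hne
  obtain ⟨hv, -⟩ := hroll.exists_extension hb.isOpen_time hb.isOpen_space
    hb.contDiffOn_immersion hF₁ hff₁ hd
  have hτ0 : ∀ t ∈ J, deriv τ t = 0 := by
    intro t ht
    -- R is τ'τ*, the derivative of τ read on the osculating space. It kills W, because the velocity
    -- vanishes at all points of a ruling; by stationarity it kills c' + W's for s in an open set,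
    -- hence W' and c'. These span the range of τ, so τ' = 0.
    let R : Euc m →L[ℝ] Euc m := (deriv τ t).comp (ContinuousLinearMap.adjoint (τ t))
    have h1 : R.comp (W t) = 0 := by
      refine eq_zero_of_const_on_open hb.isOpen_space hs₀
        (y := -(deriv τ t (c₁ t) + deriv (fun t ↦ c t - τ t (c₁ t)) t)) fun s hs ↦ ?_
      have h2 := hv (t, s) ⟨ht, hs⟩
      rw [velocity, Function.comp_apply, h.comp_param_eq hb (p := (t, s)) ⟨ht, hs⟩, map_add] at h2
      rw [eq_neg_iff_add_eq_zero, ← h2]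
      simp only [R, ContinuousLinearMap.comp_apply]
      abel
    have h2 : ∀ s ∈ B, R (deriv c t) + R (deriv W t s) = 0 := fun s hs ↦ by
      have h3 := hcase (t, s) ⟨ht, hs⟩
      rw [h.fderiv_eq hb ⟨ht, hs⟩, hb.fderiv_eq ⟨ht, hs⟩, map_zero, add_zero, one_smul, map_add,
        map_add] at h3
      exact h3
    have h3 : R.comp (deriv W t) = 0 :=
      eq_zero_of_const_on_open hb.isOpen_space hs₀ (y := -R (deriv c t)) fun s hs ↦ by
        rw [eq_neg_iff_add_eq_zero, add_comm]
        exact h2 s hs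
    have h4 : R (deriv c t) = 0 := by
      have h5 := h2 s₀ hs₀
      have h6 := DFunLike.congr_fun h3 s₀
      rw [ContinuousLinearMap.comp_apply, zero_apply] at h6
      rwa [h6, add_zero] at h5
    ext1 y
    have h5 : τ t y ∈ (osculatingMap c W t).range := by
      rw [← h.range_eq t ht]
      exact ⟨y, rfl⟩
    obtain ⟨⟨a, b, b'⟩, hab⟩ := h5
    have hab' : osculatingMap c W t (a, b, b') = τ t y := hab
    have h6 : R (τ t y) = deriv τ t y := by
      simp only [R, ContinuousLinearMap.comp_apply, adjoint_apply_of_norm_eq (h.isometric t ht)]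
    rw [← h6, ← hab', osculatingMap_apply, map_add, map_add, map_smul, h4, smul_zero, zero_add]
    have h7 := DFunLike.congr_fun h1 b
    have h8 := DFunLike.congr_fun h3 b'
    rw [ContinuousLinearMap.comp_apply, zero_apply] at h7 h8
    rw [h7, h8, add_zero, zero_apply]
  have hc0 : ∀ t ∈ J, deriv (fun t ↦ c t - τ t (c₁ t)) t = 0 := fun t ht ↦ by
    have h1 := hv (t, s₀) ⟨ht, hs₀⟩
    rw [velocity, hτ0 t ht, zero_apply, zero_add] at h1
    exact h1
  refine ⟨J, B, hb, ⟨(t₀, s₀), ht₀, hs₀⟩, subset_rfl, subset_rfl, univ,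
    fun y ↦ τ t₀ y + (c t₀ - τ t₀ (c₁ t₀)), isOpen_univ, subset_univ _,
    ((τ t₀).contDiff.add contDiff_const).contDiffOn, fun y _ v w ↦ ?_, ?_⟩
  · rw [((τ t₀).hasFDerivAt.add_const _).fderiv, inner_map_of_norm_eq (h.isometric t₀ ht₀)]
  · rintro _ ⟨p, hp, rfl⟩
    have e1 : τ p.1 = τ t₀ := eq_of_deriv_eq_zero hb.isOpen_time hb.convex_time
      (fun t ht ↦ by rw [← hτ0 t ht]; exact hroll.hasDerivAt_linear hb.isOpen_time ht) hp.1 ht₀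
    have e2 : c p.1 - τ p.1 (c₁ p.1) = c t₀ - τ t₀ (c₁ t₀) :=
      eq_of_deriv_eq_zero (u := fun t ↦ c t - τ t (c₁ t)) hb.isOpen_time hb.convex_time
        (fun t ht ↦ by rw [← hc0 t ht]; exact hroll.hasDerivAt_vector hb.isOpen_time ht) hp.1 ht₀
    rw [hff₁ p hp, e2, e1]

/-- Every nonempty open set contains a connected open set on which the immersion is a composition of
every ruled reduction to `L_D`. -/
theorem IsRuledOn.exists_local_composition (hn : d + 1 = n) (hf : IsIsometricImmersionOn g f univ)
    (hD : IsRuledOn g D d f univ) {O : Set M} (hO : IsOpen O) (hne : O.Nonempty) :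
    ∃ U : Set M, IsOpen U ∧ U.Nonempty ∧ IsPreconnected U ∧ U ⊆ O ∧ ∃ ℓ : ℕ,
      (∀ y ∈ U, Module.finrank ℝ (rulingNormalSpace D f y) = ℓ ∧ curvatureRank g y = ℓ) ∧
      (∃ (fD : M → Euc (n + ℓ)) (σ : M → Euc m →ₗ[ℝ] Euc (n + ℓ)),
        IsRuledReductionOn g D d f (rulingNormalSpace D f) fD σ U) ∧
      ∀ (fD : M → Euc (n + ℓ)) (σ : M → Euc m →ₗ[ℝ] Euc (n + ℓ)),
        IsRuledReductionOn g D d f (rulingNormalSpace D f) fD σ U → IsCompositionOn f fD U := by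
  obtain ⟨x, hx⟩ := hne
  obtain ⟨J₀, B₀, G, κ, c, W, hb₀, h0J, h0B, -, hGO⟩ := hD.exists_box hn hf x hO hx
  obtain ⟨k, J₁, τ, c₁, f₁, hJ₁, hJ₁c, ⟨t₁, ht₁⟩, hJ₁₀, hdev₁⟩ := hb₀.exists_development ⟨0, h0J⟩
  have hb₁ := hb₀.mono hJ₁ hJ₁c hb₀.isOpen_space hb₀.convex_space hJ₁₀ subset_rfl
  obtain ⟨J₂, B₂, hb₂, ⟨p, hp⟩, hJ₂, hB₂, hcomp₂⟩ := hdev₁.exists_isCompositionOn hb₁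
    ⟨(t₁, 0), ht₁, h0B⟩
  have hdev₂ := hdev₁.mono hJ₂
  have hfU : ∀ {U : Set M}, IsIsometricImmersionOn g f U := hf.mono (subset_univ _)
  obtain ⟨ℓ, rfl⟩ : ∃ ℓ, k = n + ℓ := ⟨_, hdev₂.finrank_eq hb₂ hn hfU hp⟩
  obtain ⟨J, B, ξ, hb, hpJ, hJ, hB, hξ, hξL⟩ := hdev₂.exists_frame hb₂ hn hfU rfl hp
  have hdev := hdev₂.mono hJ
  have hsub : G '' (J ×ˢ B) ⊆ G '' (J₂ ×ˢ B₂) := image_mono (prod_mono hJ hB)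
  have hcomp : IsCompositionOn f f₁ (G '' (J ×ˢ B)) := by
    obtain ⟨Z, e, hZ, hfZ, he, hei, hfe⟩ := hcomp₂
    exact ⟨Z, e, hZ, (image_mono hsub).trans hfZ, he, hei, fun x hx ↦ hfe x (hsub hx)⟩
  refine ⟨G '' (J ×ˢ B), hb.isOpen_image, ⟨_, p, hpJ, rfl⟩, hb.isPreconnected_image,
    (hsub.trans (image_mono (prod_mono (hJ₂.trans hJ₁₀) hB₂))).trans hGO, ℓ, ?_,
    ⟨f₁, _, hdev.isRuledReductionOn hb hn hfU hD⟩, fun fD σ hred ↦ ?_⟩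
  · rintro _ ⟨q, hq, rfl⟩
    have h1 : Module.finrank ℝ (rulingNormalSpace D f (G q)) = ℓ := by
      have := hdev.finrank_eq hb hn hfU hq
      omega
    refine ⟨h1, ?_⟩
    rw [curvatureRank_eq hf (G q) (by rw [hD.smooth.finrank_eq (mem_univ _), hn])
      (hb.secondFundamentalForm_eq_zero hfU hq), h1]
  · have hne : (J ×ˢ B).Nonempty := ⟨p, hpJ⟩
    -- An arbitrary reduction to L_D is again a rolling motion along the same spaces f_*TM ⊕ L_D, so
    -- the composition property of the development passes to it.
    obtain ⟨τ₂, c₂, hroll₂, -, hd₂, hr₂⟩ := hb.exists_rolling hn ⟨p.2, hpJ.2⟩ rfl hfU hred.immersion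
      hred.isometry hred.form
      (by rintro _ ⟨q, hq, rfl⟩; exact hb.rulingNormalSpace_le hn hfU hq) hξ hξL
      (fun _ _ ↦ le_rfl) (hdev.isParallelAlongOn hb hn hfU)
    refine isCompositionOn_of_rolling hb.isOpen_time hb.convex_time hb.isOpen_space hb.convex_space
      hne (hdev.isRollingOn hb).1 hroll₂ (fun t ht ↦ ?_)
      (hb.contDiffOn_comp (hdev.contMDiffOn hb)) (hb.contDiffOn_comp hred.immersion.smooth)
      (fun q hq a ↦ hdev.fderiv_eq' hb hq a) hd₂ hcomp
    ext y
    rw [hdev.mem_range_iff hb hn hfU (p := (t, p.2)) ⟨ht, hpJ.2⟩,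
      hr₂ (t, p.2) ⟨ht, hpJ.2⟩]

end LocalExistence

end RuledComposition

namespace RuledComposition

open Set Filter Topology

/-! ### Globalization by a maximal disjoint family -/

/-- If every nonempty open set contains a nonempty connected open set with the property `P`, then
there is an open dense set whose connected components have the property `P`. -/
theorem exists_dense_open_components {X : Type*} [TopologicalSpace X] {P : Set X → Prop}
    (h : ∀ O : Set X, IsOpen O → O.Nonempty →
      ∃ U, IsOpen U ∧ U.Nonempty ∧ IsPreconnected U ∧ U ⊆ O ∧ P U) :
    ∃ O : Set X, IsOpen O ∧ Dense O ∧ ∀ x ∈ O, P (connectedComponentIn O x) := by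
  let good : Set X → Prop := fun U ↦ IsOpen U ∧ U.Nonempty ∧ IsPreconnected U ∧ P U
  -- A maximal family of disjoint good sets has dense union: otherwise a good set in the complement
  -- of its closure could be added.
  obtain ⟨S, hS⟩ : ∃ S : Set (Set X),
      Maximal (fun S ↦ (∀ U ∈ S, good U) ∧ S.PairwiseDisjoint id) S := by
    refine zorn_subset {S : Set (Set X) | (∀ U ∈ S, good U) ∧ S.PairwiseDisjoint id} ?_
    intro C hC hchain
    refine ⟨⋃₀ C, ⟨?_, ?_⟩, fun S hS ↦ subset_sUnion_of_mem hS⟩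
    · rintro U ⟨S, hS, hU⟩
      exact (hC hS).1 U hU
    · exact (pairwiseDisjoint_sUnion hchain.directedOn).2 fun S hS ↦ (hC hS).2
  obtain ⟨hgood, hdisj⟩ := hS.prop
  have hopen : IsOpen (⋃₀ S) := isOpen_sUnion fun U hU ↦ (hgood U hU).1
  refine ⟨⋃₀ S, hopen, ?_, ?_⟩
  · rw [dense_iff_closure_eq, ← compl_empty_iff]
    by_contra hne
    obtain ⟨U, hUo, hUne, hUc, hUsub, hUP⟩ := h _ isClosed_closure.isOpen_compl
      (nonempty_iff_ne_empty.2 hne)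
    have hUdisj : ∀ V ∈ S, Disjoint U V := fun V hV ↦
      (disjoint_compl_left.mono_right subset_closure).mono hUsub (subset_sUnion_of_mem hV)
    have h1 : insert U S ⊆ S := hS.le_of_ge (y := insert U S) ⟨?_, ?_⟩ (subset_insert U S)
    · have h2 := hUdisj U (h1 (mem_insert U S))
      rw [disjoint_self] at h2
      exact hUne.ne_empty h2
    · rintro V (rfl | hV)
      · exact ⟨hUo, hUne, hUc, hUP⟩
      · exact hgood V hV
    · exact hdisj.insert fun V hV _ ↦ hUdisj V hV
  · rintro x ⟨U, hU, hxU⟩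
    have hUsub : U ⊆ ⋃₀ S := subset_sUnion_of_mem hU
    -- The members are connected, open and disjoint, so they are exactly the components of their
    -- union; no property of smaller subsets is needed.
    have h1 : connectedComponentIn (⋃₀ S) x = U := by
      apply Subset.antisymm
      · have hsplit : ⋃₀ S = U ∪ ⋃₀ (S \ {U}) := by
          rw [← sUnion_insert, insert_sdiff_singleton, insert_eq_of_mem hU]
        have hd : Disjoint U (⋃₀ (S \ {U})) := by
          rw [disjoint_sUnion_right]
          exact fun V hV ↦ hdisj hU hV.1 (Ne.symm hV.2)
        refine isPreconnected_connectedComponentIn.subset_left_of_subset_union (hgood U hU).1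
          (isOpen_sUnion fun V hV ↦ (hgood V hV.1).1) hd
          ((connectedComponentIn_subset _ _).trans hsplit.subset)
          ⟨x, mem_connectedComponentIn ⟨U, hU, hxU⟩, hxU⟩
      · exact (hgood U hU).2.2.1.subset_connectedComponentIn hxU hUsub
    rw [h1]
    exact (hgood U hU).2.2.2

end RuledComposition
theorem mainTheorem9 {n p : ℕ} (hn : 1 ≤ n)
    {M : Type*} [TopologicalSpace M] [T2Space M] [SecondCountableTopology M]
    [ChartedSpace (Euc n) M] [IsManifold (𝓡 n) ∞ M]
    (g : SmoothMetric n M) (D : TangentSubspaces n M) (f : M → Euc (n + p))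
    (hf : IsIsometricImmersionOn g f Set.univ)
    (hD : IsRuledOn g D (n - 1) f Set.univ) :
    (∀ (V : Set M) (ℓ : ℕ) (L : M → Submodule ℝ (Euc (n + p))) (f' : M → Euc (n + ℓ))
        (σ : M → Euc (n + p) →ₗ[ℝ] Euc (n + ℓ)),
      IsOpen V → IsNormalSubbundleOn n f L ℓ V → IsParallelAlongOn f D L V →
      (∀ x ∈ V, rulingNormalSpace D f x ≤ L x) →
      IsRuledReductionOn g D (n - 1) f L f' σ V →
      ∀ x ∈ V, (∃ v w : TangentSpace (𝓡 n) x, secondFundamentalForm f x v w ∉ L x) →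
        ∃ U : Set M, IsOpen U ∧ x ∈ U ∧ U ⊆ V ∧ IsCompositionOn f f' U) ∧
    ∃ O : Set M, IsOpen O ∧ Dense O ∧ ∀ x ∈ O, ∃ ℓ : ℕ,
      (∀ y ∈ connectedComponentIn O x,
        Module.finrank ℝ (rulingNormalSpace D f y) = ℓ ∧ curvatureRank g y = ℓ) ∧
      (∃ (fD : M → Euc (n + ℓ)) (σ : M → Euc (n + p) →ₗ[ℝ] Euc (n + ℓ)),
        IsRuledReductionOn g D (n - 1) f (rulingNormalSpace D f) fD σ
          (connectedComponentIn O x)) ∧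
      ∀ (fD : M → Euc (n + ℓ)) (σ : M → Euc (n + p) →ₗ[ℝ] Euc (n + ℓ)),
        IsRuledReductionOn g D (n - 1) f (rulingNormalSpace D f) fD σ
          (connectedComponentIn O x) →
        IsCompositionOn f fD (connectedComponentIn O x) := by
  have hn' : n - 1 + 1 = n := Nat.sub_add_cancel hn
  refine ⟨fun V ℓ L f' σ _ hL hpar hLD hred x hx hα ↦
    hD.exists_composition hn' hf rfl hL hpar hLD hred hx hα, ?_⟩
  exact exists_dense_open_components fun O hO hne ↦ hD.exists_local_composition hn' hf hO hne
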